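/- **Setting.** Consider a finite two-player zero-sum extensive-form game with chance moves and perfect recall, with terminal payoffs of absolute value at most $\Delta$. Let $H$ be its horizon (largest length of a history) and $|A|$ the largest number of actions at an information set. A population consists of a finite set of pure strategies for each player; its restricted game keeps at each information set only the actions chosen there by some pure strategy in the population. *SRMDO* with frequency function $m\ge 1$ ($m(j)$ may depend on the window index $j$ and on the population in window $j$) runs as follows. The first population consists of best responses to the uniform strategy. Each iteration is one iteration of outcome-sampling MCCFR in the current restricted game: a terminal history $z$ is sampled with some sampling profile of the restricted game, the sampled counterfactual regrets along $z$ are added up, and the next strategy is given by regret matching. The sampling profile may be any function of the current state such that every terminal history of the restricted game which the chance player and one player's opponent reach with positive probability under the current strategy is sampled with probability at least $q_0>0$ (for either player). If the iteration number is a multiple of $m(j)$, where $j$ is the current window, then for both players a best response in the original game to the (reach-weighted) average strategy of the current window is added to the population; if the population changes, a new window starts and the regret minimizer is reset to the uniform strategy. The last-window average strategy is the average strategy of the current window. The responses may be randomized and depend on the past. *Cost.* An MCCFR iteration costs the length of the sampled trajectory. A round of oracle best responses for both players costs the number of information sets (of both players) of the current restricted game. A $\delta$-best response (a pure strategy whose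 value is within $\delta$ of the best-response value) costs $H$ for each player. Let the last-window average be an $\varepsilon$-Nash equilibrium for the first time after iteration $\tau$. Let $k$ be the number of windows up to then, $X$ the number of information sets of the restricted game in the last of these windows, and $H_j$ and $m(j)$ the horizon of the restricted game and the frequency in window $j$. **Theorem.** There are universal constants $C>0$ and $d\in\mathbb N$ such that for every such game, $m$ and sampling rule, all $0<\varepsilon\le 2\Delta$ and all $p\in(0,1]$, with $M=(\Delta/q_0)^2$ and $L=\log(2+k|A|X/p)$, the following holds. 1. With oracle (exact) best responses, with probability at least $1-p$ the time $\tau$ is finite and the total cost up to and including iteration $\tau$ is at most $$C L^d\Big(\frac{M\,kH|A|X^2}{\varepsilon^2}+\sum_{j=1}^k\Big(H_j m(j)+\frac{M\,|A|X^3}{\varepsilon^2 m(j)}\Big)\Big).$$ 2. With $\delta$-best responses, $0\le\delta<\varepsilon$, where the probability that some response computed before the last-window average becomes an $\varepsilon$-Nash equilibrium fails to be a $\delta$-best response is at most $\eta$, with probability at least $1-p-\eta$ the time $\tau$ is finite and the total cost up to and including iteration $\tau$ is at most $$C L^d\Big(\frac{M\,kH|A|X^2}{(\varepsilon-\delta)^2}+\sum_{j=1}^k\Big(H_j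 m(j)+\frac{M\,H|A|X^2}{(\varepsilon-\delta)^2 m(j)}\Big)\Big).$$ -/

import Mathlib

open MeasureTheory

universe u v w

namespace SRMDO

noncomputable section

/-- The data of a finite two-player zero-sum extensive-form game. Histories are lists of actions,
oldest action first. `I` is the set of information sets of both players. -/
structure GameTree (A : Type u) (I : Type v) where
  /-- the histories (nodes of the game tree) -/
  hist : Finset (List A)
  /-- the information set of a decision node; `none` at chance nodes and terminal nodes -/
  infoset : List A → Option I
  /-- the player who moves at an information set -/
  owner : I → Fin 2
  /-- the actions available at an information set -/
  actions : I → Finset A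
  /-- the law of the chance player's move at a chance node -/
  chance : List A → A → ℝ
  /-- the payoff of player `0` at a terminal history (player `1` gets the negative) -/
  payoff : List A → ℝ

namespace GameTree

variable {A : Type u} {I : Type v} [Fintype A] [DecidableEq A]

/-- The actions that continue the history `h`. -/
def avail (G : GameTree A I) (h : List A) : Finset A :=
  Finset.univ.filter (fun a => h ++ [a] ∈ G.hist)

/-- The sequence of (information set, action) pairs of player `i` along `h`. -/
def ownSeq (G : GameTree A I) (i : Fin 2) (h : List A) : List (I × A) :=
  (List.range h.length).filterMap (fun n =>
    match G.infoset (h.take n), h[n]? with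
    | some s, some a => if G.owner s = i then some (s, a) else none
    | _, _ => none)

end GameTree

/-- A finite two-player zero-sum extensive-form game with chance moves and perfect recall. -/
structure EFG (A : Type u) (I : Type v) [Fintype A] [DecidableEq A] extends GameTree A I where
  nil_mem : [] ∈ hist
  prefix_mem : ∀ h a, h ++ [a] ∈ hist → h ∈ hist
  infoset_mem : ∀ h s, infoset h = some s → h ∈ hist
  infoset_surj : ∀ s, ∃ h, infoset h = some s
  actions_nonempty : ∀ s, (actions s).Nonempty
  avail_eq : ∀ h s, infoset h = some s → toGameTree.avail h = actions s
  chance_nonneg : ∀ h a, 0 ≤ chance h a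
  chance_sum : ∀ h ∈ hist, infoset h = none → (toGameTree.avail h).Nonempty →
    ∑ a ∈ toGameTree.avail h, chance h a = 1
  perfect_recall : ∀ h h' s, infoset h = some s → infoset h' = some s →
    toGameTree.ownSeq (owner s) h = toGameTree.ownSeq (owner s) h'

namespace EFG

variable {A : Type u} {I : Type v} [Fintype A] [DecidableEq A] [Fintype I] [DecidableEq I]

/-- The terminal histories. -/
def terminal (G : EFG A I) : Finset (List A) := G.hist.filter (fun h => G.avail h = ∅)

/-- The horizon `H`: the largest length of a history. -/
def horizon (G : EFG A I) : ℕ := G.hist.sup List.length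

/-- `|A|`: the largest number of actions at an information set. -/
def numActions (G : EFG A I) : ℕ := Finset.univ.sup (fun s => (G.actions s).card)

/-- The payoff of player `i` at `z`. -/
def payoffOf (G : EFG A I) (i : Fin 2) (z : List A) : ℝ :=
  if i = 0 then G.payoff z else - G.payoff z

/-- The player who moves at `h`; `none` is the chance player. -/
def mover (G : EFG A I) (h : List A) : Option (Fin 2) := (G.infoset h).map G.owner

/-! A joint behavioural strategy is a function `π : I → A → ℝ`; the strategy of player `i` is its
restriction to the information sets that `i` owns. -/

/-- `π` is a joint behavioural strategy that plays only actions in `B s` at `s`. -/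
def IsProfileOn (B : I → Finset A) (π : I → A → ℝ) : Prop :=
  ∀ s, (∀ a, 0 ≤ π s a) ∧ (∀ a, a ∉ B s → π s a = 0) ∧ ∑ a ∈ B s, π s a = 1

/-- `π` is a joint behavioural strategy of the game. -/
def IsProfile (G : EFG A I) (π : I → A → ℝ) : Prop := IsProfileOn G.actions π

/-- The probability that action `a` is played at history `h`. -/
def actProb (G : EFG A I) (π : I → A → ℝ) (h : List A) (a : A) : ℝ :=
  match G.infoset h with
  | some s => π s a
  | none => G.chance h a

/-- The reaching probability of `h`. -/
def reach (G : EFG A I) (π : I → A → ℝ) (h : List A) : ℝ :=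
  ∏ n : Fin h.length, G.actProb π (h.take n) (h.get n)

/-- The contribution of player `i` to the reaching probability of `h` by the moves from position
`l` on; for `l = 0` this is the reaching contribution of player `i`. -/
def ownReach (G : EFG A I) (i : Fin 2) (π : I → A → ℝ) (l : ℕ) (h : List A) : ℝ :=
  ∏ n : Fin h.length,
    if G.mover (h.take n) = some i ∧ l ≤ n then G.actProb π (h.take n) (h.get n) else 1

/-- The contribution of everybody except player `i` (chance included) to the reaching probability
of `h`. -/
def othersReach (G : EFG A I) (i : Fin 2) (π : I → A → ℝ) (h : List A) : ℝ :=
  ∏ n : Fin h.length,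
    if G.mover (h.take n) = some i then 1 else G.actProb π (h.take n) (h.get n)

/-- The expected payoff of player `i` under `π`. -/
def value (G : EFG A I) (π : I → A → ℝ) (i : Fin 2) : ℝ :=
  ∑ z ∈ G.terminal, G.reach π z * G.payoffOf i z

/-- `π` is an `ε`-Nash equilibrium of the game. -/
def IsNash (G : EFG A I) (ε : ℝ) (π : I → A → ℝ) : Prop :=
  G.IsProfile π ∧ ∀ i : Fin 2,
    (∀ π', G.IsProfile π' → (∀ s, G.owner s = i → π' s = π s) →
      G.value π i ≤ G.value π' i + ε) ∧
    (∀ π', G.IsProfile π' → (∀ s, G.owner s ≠ i → π' s = π s) →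
      G.value π' i - ε ≤ G.value π i)

/-- Pure strategies of player `i`. -/
abbrev Pure (G : EFG A I) (i : Fin 2) : Type (max u v) :=
  (s : {s : I // G.owner s = i}) → {a : A // a ∈ G.actions s.1}

/-- One pure strategy for each player, as returned by the two best-response computations. -/
abbrev Response (G : EFG A I) : Type (max u v) := (i : Fin 2) → G.Pure i

/-- Populations: a finite set of pure strategies for each player. -/
abbrev Population (G : EFG A I) : Type (max u v) := (i : Fin 2) → Finset (G.Pure i)

/-- The joint strategy in which player `i` switches from `π` to the pure strategy `f`. -/
def deviate (G : EFG A I) (π : I → A → ℝ) (i : Fin 2) (f : G.Pure i) : I → A → ℝ :=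
  fun s a => if hs : G.owner s = i then (if (f ⟨s, hs⟩).1 = a then 1 else 0) else π s a

/-- `f` is a `δ`-best response of player `i` to the opponent's strategy in `π` among all strategies
of the original game; for `δ = 0` it is an exact best response. -/
def IsBestResponse (G : EFG A I) (δ : ℝ) (π : I → A → ℝ) (i : Fin 2) (f : G.Pure i) : Prop :=
  ∀ π', G.IsProfile π' → (∀ s, G.owner s ≠ i → π' s = π s) →
    G.value π' i - δ ≤ G.value (G.deviate π i f) i

/-! ### Restricted games -/

/-- The actions at `s` in the restricted game of a population: those chosen at `s` by some pure
strategy in the population. -/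
def restrictedActions (G : EFG A I) (P : G.Population) (s : I) : Finset A :=
  (P (G.owner s)).image (fun f => (f ⟨s, rfl⟩).1)

/-- The histories of the restricted game. -/
def restrictedHist (G : EFG A I) (P : G.Population) : Finset (List A) :=
  G.hist.filter (fun h => ∀ n : Fin h.length, ∀ s : I,
    G.infoset (h.take n) = some s → h.get n ∈ G.restrictedActions P s)

/-- The number of information sets (of both players together) in the restricted game. -/
def restrictedSize (G : EFG A I) (P : G.Population) : ℕ :=
  (Finset.univ.filter (fun s : I => ∃ h ∈ G.restrictedHist P, G.infoset h = some s)).card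

/-- The horizon of the restricted game. -/
def restrictedHorizon (G : EFG A I) (P : G.Population) : ℕ := (G.restrictedHist P).sup List.length

/-! ### The algorithm -/

/-- Normalize nonnegative weights on the action sets `B s`; uniform where all weights vanish. -/
def normalize (B : I → Finset A) (W : I → A → ℝ) : I → A → ℝ :=
  fun s a =>
    if a ∈ B s then
      if 0 < ∑ b ∈ B s, W s b then W s a / ∑ b ∈ B s, W s b else 1 / ((B s).card : ℝ)
    else 0

/-- The uniform random joint strategy of the original game. -/
def uniform (G : EFG A I) : I → A → ℝ := normalize G.actions (fun _ _ => 0)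

/-- The memory of the algorithm. -/
structure State (G : EFG A I) where
  /-- number of iterations performed so far -/
  time : ℕ
  /-- index of the current time window, starting from `0` -/
  window : ℕ
  /-- `pops j` is the population during window `j`, for `j ≤ window` -/
  pops : ℕ → G.Population
  /-- cumulative sampled counterfactual regrets in the current window -/
  regret : I → A → ℝ
  /-- cumulative reach-weighted strategies in the current window -/
  weight : I → A → ℝ
  /-- total cost so far -/
  cost : ℕ

namespace State

variable {G : EFG A I}

/-- The current population. -/
def pop (S : G.State) : G.Population := S.pops S.window

/-- The current strategy in the restricted game: regret matching on the cumulative sampled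
counterfactual regrets. -/
def strategy (S : G.State) : I → A → ℝ :=
  normalize (G.restrictedActions S.pop) (fun s a => max 0 (S.regret s a))

/-- The average strategy of the current window, extended to the original game by giving probability
zero to actions outside the restricted game. -/
def average (S : G.State) : I → A → ℝ := normalize (G.restrictedActions S.pop) S.weight

end State

/-- The outcome-sampling MCCFR estimate of the immediate counterfactual regret of action `a` at `s`
in a game with action sets `B`, when the current strategy is `π` and the terminal history `z` was
sampled with the sampling profile `ξ`: if `z` passes through `s` by the action `c`, it is
`w * (1[c = a] - π s c)`, where `w` is the payoff of the owner `i` of `s` at `z`, times the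
probability that the others play towards `z`, times the probability that `i` plays towards `z` after
taking `c` at `s`, divided by the sampling probability of `z`. -/
def sampledRegret (G : EFG A I) (B : I → Finset A) (π ξ : I → A → ℝ) (z : List A)
    (s : I) (a : A) : ℝ :=
  if a ∈ B s then
    ∑ n : Fin z.length,
      if G.infoset (z.take n) = some s then
        (G.payoffOf (G.owner s) z * G.othersReach (G.owner s) π z *
            G.ownReach (G.owner s) π (n + 1) z / G.reach ξ z) *
          ((if z.get n = a then 1 else 0) - π s (z.get n))
      else 0
  else 0

/-- The contribution of the strategy `π` to the average strategy at `s`. By perfect recall all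
histories in `s` have the same reaching contribution of the owner of `s`, so the sum over `s` is
that contribution times the number of histories in `s`; this factor cancels in the
normalization. -/
def reachWeight (G : EFG A I) (π : I → A → ℝ) (s : I) (a : A) : ℝ :=
  (∑ h ∈ G.hist.filter (fun h => G.infoset h = some s), G.ownReach (G.owner s) π 0 h) * π s a

/-- One iteration of outcome-sampling MCCFR in the current restricted game, with sampled terminal
history `z` and sampling profile `samp S`. Its cost is the length of the sampled trajectory. -/
def mccfrIter (G : EFG A I) (samp : G.State → I → A → ℝ) (S : G.State) (z : List A) : G.State :=
  { S with
    time := S.time + 1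
    regret := fun s a => S.regret s a +
      G.sampledRegret (G.restrictedActions S.pop) S.strategy (samp S) z s a
    weight := fun s a => S.weight s a + G.reachWeight S.strategy s a
    cost := S.cost + z.length }

/-- The expansion step after an iteration. If the iteration number is a multiple of the frequency
`m` of the current window, the best responses `b` are computed, at cost `price`, and added to the
population; if the population changes, a new window starts and the regret minimizer is reset. -/
def expand (G : EFG A I) (m : ℕ → G.Population → ℕ) (price : G.Population → ℕ)
    (S : G.State) (b : G.Response) : G.State :=
  if m S.window S.pop ∣ S.time then
    if (fun i => insert (b i) (S.pop i)) = S.pop then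
      { S with cost := S.cost + price S.pop }
    else
      { time := S.time
        window := S.window + 1
        pops := Function.update S.pops (S.window + 1) (fun i => insert (b i) (S.pop i))
        regret := fun _ _ => 0
        weight := fun _ _ => 0
        cost := S.cost + price S.pop }
  else S

/-- The initial state: the first population consists of the responses `b` to the uniform strategy. -/
def init (G : EFG A I) (price : G.Population → ℕ) (b : G.Response) : G.State :=
  { time := 0
    window := 0
    pops := fun _ i => {b i}
    regret := fun _ _ => 0
    weight := fun _ _ => 0
    cost := price (fun i => {b i}) }

/-- The state after `t` iterations of SRMDO, as a function of the best responses `b 0` (initial),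
`b 1, b 2, …` (in iterations `1, 2, …`, ignored when none is computed) and of the terminal histories
`y 0, y 1, …` sampled in iterations `1, 2, …`. -/
def run (G : EFG A I) (m : ℕ → G.Population → ℕ) (price : G.Population → ℕ)
    (samp : G.State → I → A → ℝ) (b : ℕ → G.Response) (y : ℕ → List A) : ℕ → G.State
  | 0 => G.init price (b 0)
  | t + 1 => G.expand m price (G.mccfrIter samp (G.run m price samp b y t) (y t)) (b (t + 1))

/-- The state inside iteration `t + 1`, after the strategy update and before the expansion step. Its
`average` is the last-window average strategy after `t + 1` iterations. -/
def runMid (G : EFG A I) (m : ℕ → G.Population → ℕ) (price : G.Population → ℕ)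
    (samp : G.State → I → A → ℝ) (b : ℕ → G.Response) (y : ℕ → List A) (t : ℕ) : G.State :=
  G.mccfrIter samp (G.run m price samp b y t) (y t)

/-- The probability that outcome sampling with the profile `ξ` samples `z`. -/
def sampleProb (G : EFG A I) (ξ : I → A → ℝ) (z : List A) : ℝ :=
  if z ∈ G.terminal then G.reach ξ z else 0

/-- `ξ` is an admissible sampling profile with exploration parameter `q₀` in state `S`: it is a
strategy in the current restricted game, and every terminal history `z` of the restricted game that
the others reach with positive probability is sampled with probability at least `q₀`. -/
def Explores (G : EFG A I) (q₀ : ℝ) (S : G.State) (ξ : I → A → ℝ) : Prop :=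
  IsProfileOn (G.restrictedActions S.pop) ξ ∧
    ∀ i : Fin 2, ∀ z ∈ G.terminal, z ∈ G.restrictedHist S.pop →
      G.othersReach i S.strategy z = 0 ∨ q₀ ≤ G.reach ξ z

/-- The best responses computed initially (`t = 0`) or in iteration `t > 0`, if any are computed
there, are `δ`-best responses to the uniform strategy, respectively to the last-window average. -/
def GoodResponse (G : EFG A I) (m : ℕ → G.Population → ℕ) (price : G.Population → ℕ)
    (samp : G.State → I → A → ℝ) (δ : ℝ) (b : ℕ → G.Response) (y : ℕ → List A) : ℕ → Prop
  | 0 => ∀ i, G.IsBestResponse δ G.uniform i (b 0 i)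
  | t + 1 =>
      m (G.runMid m price samp b y t).window (G.runMid m price samp b y t).pop ∣
          (G.runMid m price samp b y t).time →
        ∀ i, G.IsBestResponse δ (G.runMid m price samp b y t).average i (b (t + 1) i)

/-- `β` and `ζ` are the responses and the sampled histories of a random execution of SRMDO: given
the past, the next history is sampled with the current sampling profile, which explores. Nothing is
said about the law of the responses, which may be randomized and depend on the past. -/
structure IsExecution (G : EFG A I) (m : ℕ → G.Population → ℕ) (price : G.Population → ℕ)
    (samp : G.State → I → A → ℝ) (q₀ : ℝ) {Ω : Type w} [MeasurableSpace Ω] (μ : Measure Ω)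
    (β : ℕ → Ω → G.Response) (ζ : ℕ → Ω → List A) : Prop where
  measurable_response : ∀ t b, MeasurableSet {ω | β t ω = b}
  measurable_sample : ∀ t z, MeasurableSet {ω | ζ t ω = z}
  law : ∀ (t : ℕ) (b : ℕ → G.Response) (y : ℕ → List A) (z : List A),
    μ.real {ω | ((∀ r ≤ t, β r ω = b r) ∧ ∀ r < t, ζ r ω = y r) ∧ ζ t ω = z} =
      μ.real {ω | (∀ r ≤ t, β r ω = b r) ∧ ∀ r < t, ζ r ω = y r} *
        G.sampleProb (samp (G.run m price samp b y t)) z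
  explores : ∀ᵐ ω ∂μ, ∀ t,
    G.Explores q₀ (G.run m price samp (fun r => β r ω) (fun r => ζ r ω) t)
      (samp (G.run m price samp (fun r => β r ω) (fun r => ζ r ω) t))

/-- In the execution `(b, y)`, the last-window average strategy becomes an `ε`-Nash equilibrium, and
when it first does, after iteration `τ + 1`, the total cost (including the expansion step of this
iteration) is at most `bound` of the state at that moment. -/
def ReachesWithin (G : EFG A I) (m : ℕ → G.Population → ℕ) (price : G.Population → ℕ)
    (samp : G.State → I → A → ℝ) (ε : ℝ) (bound : G.State → ℝ) (b : ℕ → G.Response)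
    (y : ℕ → List A) : Prop :=
  ∃ τ : ℕ, IsLeast {t | G.IsNash ε (G.runMid m price samp b y t).average} τ ∧
    ((G.run m price samp b y (τ + 1)).cost : ℝ) ≤ bound (G.runMid m price samp b y τ)

/-! ### The quantities in the bounds -/

namespace State

variable {G : EFG A I}

/-- `k`: the number of time windows so far. -/
def numWindows (S : G.State) : ℕ := S.window + 1

/-- `X`: the number of information sets in the last restricted game. -/
def finalSize (S : G.State) : ℕ := G.restrictedSize S.pop

/-- The logarithmic factor `log (2 + k |A| X / p)`. -/
def logFactor (S : G.State) (p : ℝ) : ℝ :=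
  Real.log (2 + (S.numWindows * G.numActions * S.finalSize : ℝ) / p)

/-- `M k H |A| X² / ε² + ∑ⱼ (Hⱼ m(j) + M |A| X³ / (ε² m(j)))`. -/
def oracleBound (S : G.State) (m : ℕ → G.Population → ℕ) (M ε : ℝ) : ℝ :=
  M * (S.numWindows * G.horizon * G.numActions * S.finalSize ^ 2) / ε ^ 2 +
    ∑ j ∈ Finset.range S.numWindows,
      ((G.restrictedHorizon (S.pops j) * m j (S.pops j) : ℝ) +
        M * (G.numActions * S.finalSize ^ 3) / (ε ^ 2 * m j (S.pops j)))

/-- `M k H |A| X² / ε² + ∑ⱼ (Hⱼ m(j) + M H |A| X² / (ε² m(j)))`. -/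
def approxBound (S : G.State) (m : ℕ → G.Population → ℕ) (M ε : ℝ) : ℝ :=
  M * (S.numWindows * G.horizon * G.numActions * S.finalSize ^ 2) / ε ^ 2 +
    ∑ j ∈ Finset.range S.numWindows,
      ((G.restrictedHorizon (S.pops j) * m j (S.pops j) : ℝ) +
        M * (G.horizon * G.numActions * S.finalSize ^ 2) / (ε ^ 2 * m j (S.pops j)))

end State

end EFG

end

end SRMDO

/-!
The proof rests on three facts.

*Regrets decompose along every single trajectory.* Replacing the moves of player `i` along a
terminal history `z` one at a time turns the reaching contribution of the current strategy into
that of any behavioural strategy `σ` (`ownReach_sub_ownReach`). With perfect recall this says that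
the sampled regrets, weighted by the reaching contributions of `σ`, add up to the
importance-weighted payoff difference (`sum_infosetReach_mul_sampledRegret`). Taking the mean over
`z`, the regret against `σ` is a combination, with coefficients in `[0, 1]`, of the immediate
counterfactual regrets. Since the reach-weighted average strategy has the average reaching
contributions (`card_mul_ownReach_average`) and the values of the two players cancel, the gain of
a player from deviating from the average strategy is at most the sum over the `X` information sets
of the positive part of the largest average immediate regret
(`card_mul_value_sub_value_average`). Exploration bounds a
sampled regret by `K = Δ / q₀`, so regret matching keeps the accumulated sampled regrets below
`K √(|A| n)` after `n` iterations (`sum_sq_runMid_regret_le`).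

*The sampling noise is controlled in all windows at once.* For each information set and action the
difference between true and sampled regrets is a martingale with bounded increments. In window `j`
its exponentials with rate `e / (8 X K²)` are summed with weights `p / ((j + 1) (j + 2) X |A|)`,
and `p / (j + 2)` is added for the later windows. This `potential` is a nonnegative
supermartingale, which a change of window only decreases, and it starts at `p` or below. By
Ville's inequality (`measure_exists_one_le`) it stays below `1` with probability at least `1 - p`.
On that event, the average strategy is an `e`-equilibrium of the restricted game as soon as the
window is older than `State.regretTime`, which is of the order `L K² |A| X² / e²`; an exponential
barrier linear in time is what keeps `log (1 / e)` out of this bound.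

*Every window is short.* If the average is an `e`-equilibrium of the restricted game and the
computed `δ`-best responses are already in the population, then the average is an
`(e + δ)`-equilibrium of the game (`isNash_of_response_mem`). So before the first equilibrium a window
ends at the first multiple of `m j` after its regret time (`sub_windowStart_lt`). Each window adds
a pure strategy, hence there are finitely many, and adding up the costs of the windows gives the
bounds, with `e = ε` for oracle responses and `e = ε - δ` for approximate ones. Lower-order terms
are absorbed because `q₀ ≤ 1` and `e ≤ 2 Δ`.
-/

namespace SRMDO

noncomputable section

set_option linter.unusedSectionVars false

/-! ### Exponential moments and a maximal inequality -/

/-- Hoeffding's bound for the exponential moment of a bounded random variable about its mean. -/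
lemma sum_mul_exp_mean_sub_le {ι : Type*} (F : Finset ι) (P x : ι → ℝ) (hP : ∀ z ∈ F, 0 ≤ P z)
    (hP1 : ∑ z ∈ F, P z = 1) {K : ℝ} (hK : 0 < K) (hx : ∀ z ∈ F, |x z| ≤ K) (l : ℝ) :
    ∑ z ∈ F, P z * Real.exp (l * (∑ z' ∈ F, P z' * x z' - x z)) ≤ Real.exp (2 * l ^ 2 * K ^ 2) := by
  set c := ∑ z' ∈ F, P z' * x z' with hc
  have hcK : |c| ≤ K := by
    calc |c| ≤ ∑ z ∈ F, |P z * x z| := Finset.abs_sum_le_sum_abs _ _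
      _ ≤ ∑ z ∈ F, P z * K := by
        refine Finset.sum_le_sum fun z hz => ?_
        rw [abs_mul, abs_of_nonneg (hP z hz)]
        exact mul_le_mul_of_nonneg_left (hx z hz) (hP z hz)
      _ = K := by rw [← Finset.sum_mul, hP1, one_mul]
  -- the chord of the exponential over `[-2 K, 2 K]` is affine, and the mean of `c - x` is `0`
  calc ∑ z ∈ F, P z * Real.exp (l * (c - x z))
      ≤ ∑ z ∈ F, P z *
          (Real.cosh (l * (2 * K)) + (c - x z) / (2 * K) * Real.sinh (l * (2 * K))) := by
        refine Finset.sum_le_sum fun z hz => mul_le_mul_of_nonneg_left ?_ (hP z hz)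
        have h1 : |(c - x z) / (2 * K)| ≤ 1 := by
          rw [abs_div, abs_of_pos (by positivity : 0 < 2 * K), div_le_one (by positivity)]
          have := abs_sub c (x z)
          have := hx z hz
          linarith
        have h2 := Real.exp_mul_le_cosh_add_mul_sinh h1 (l * (2 * K))
        have h3 : (c - x z) / (2 * K) * (l * (2 * K)) = l * (c - x z) := by field_simp
        rwa [h3] at h2
    _ = Real.cosh (l * (2 * K)) := by
        have h4 : ∑ z ∈ F, P z * (c - x z) = 0 := by
          simp only [mul_sub, Finset.sum_sub_distrib, ← Finset.sum_mul, hP1, ← hc]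
          ring
        have h5 : ∀ z ∈ F, P z * (Real.cosh (l * (2 * K)) +
            (c - x z) / (2 * K) * Real.sinh (l * (2 * K))) = P z * Real.cosh (l * (2 * K)) +
            P z * (c - x z) * (Real.sinh (l * (2 * K)) / (2 * K)) := fun z _ => by ring
        rw [Finset.sum_congr rfl h5, Finset.sum_add_distrib, ← Finset.sum_mul, ← Finset.sum_mul,
          h4, hP1]
        ring
    _ ≤ Real.exp ((l * (2 * K)) ^ 2 / 2) := Real.cosh_le_exp_half_sq _
    _ = Real.exp (2 * l ^ 2 * K ^ 2) := by ring_nf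

section Ville

variable {Ω : Type*} [MeasurableSpace Ω] {R Z : Type*}

/-- The event that the past before the draw `t` of `ζ` is the one in `b` and `y`. -/
def pastEvent (β : ℕ → Ω → R) (ζ : ℕ → Ω → Z) (t : ℕ) (b : ℕ → R) (y : ℕ → Z) : Set Ω :=
  {ω | (∀ r ≤ t, β r ω = b r) ∧ ∀ r < t, ζ r ω = y r}

lemma measurableSet_pastEvent {β : ℕ → Ω → R} {ζ : ℕ → Ω → Z}
    (hβ : ∀ t b, MeasurableSet {ω | β t ω = b}) (hζ : ∀ t z, MeasurableSet {ω | ζ t ω = z})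
    (t : ℕ) (b : ℕ → R) (y : ℕ → Z) : MeasurableSet (pastEvent β ζ t b y) := by
  have : pastEvent β ζ t b y =
      (⋂ r : {r // r ≤ t}, {ω | β r ω = b r}) ∩ ⋂ r : {r // r < t}, {ω | ζ r ω = y r} := by
    ext ω
    simp [pastEvent]
  rw [this]
  exact (MeasurableSet.iInter fun r => hβ _ _).inter (MeasurableSet.iInter fun r => hζ _ _)

/-- Representatives of the pasts before the draw `t`. -/
def extendPast [Nonempty R] [Nonempty Z] (t : ℕ) (k : (Fin (t + 1) → R) × (Fin t → Z)) :
    (ℕ → R) × (ℕ → Z) :=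
  (fun r => if h : r < t + 1 then k.1 ⟨r, h⟩ else Classical.arbitrary R,
    fun r => if h : r < t then k.2 ⟨r, h⟩ else Classical.arbitrary Z)

variable [Nonempty R] [Nonempty Z]

lemma mem_pastEvent_extendPast (β : ℕ → Ω → R) (ζ : ℕ → Ω → Z) (t : ℕ)
    (k : (Fin (t + 1) → R) × (Fin t → Z)) (ω : Ω) :
    ω ∈ pastEvent β ζ t (extendPast t k).1 (extendPast t k).2 ↔
      k = (fun r : Fin (t + 1) => β r ω, fun r : Fin t => ζ r ω) := by
  constructor
  · rintro ⟨h1, h2⟩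
    refine Prod.ext (funext fun r => ?_) (funext fun r => ?_)
    · have := h1 r (Nat.le_of_lt_succ r.2)
      simpa [extendPast, Nat.le_of_lt_succ r.2] using this.symm
    · have := h2 r r.2
      simpa [extendPast] using this.symm
  · rintro rfl
    refine ⟨fun r hr => ?_, fun r hr => ?_⟩
    · simp [extendPast, hr.not_gt]
    · simp [extendPast, hr]

lemma iUnion_pastEvent (β : ℕ → Ω → R) (ζ : ℕ → Ω → Z) (t : ℕ) :
    ⋃ k, pastEvent β ζ t (extendPast t k).1 (extendPast t k).2 = Set.univ := by
  ext ω
  simp [mem_pastEvent_extendPast]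

lemma pairwise_disjoint_pastEvent (β : ℕ → Ω → R) (ζ : ℕ → Ω → Z) (t : ℕ) :
    Pairwise (Function.onFun Disjoint
      fun k => pastEvent β ζ t (extendPast t k).1 (extendPast t k).2) := by
  intro k k' hne
  refine Set.disjoint_left.mpr fun ω h h' => hne ?_
  rw [mem_pastEvent_extendPast] at h h'
  exact h.trans h'.symm

variable [Countable R] [Countable Z]

/-- An event that depends only on finitely many of the variables is measurable. -/
lemma measurableSet_of_past {β : ℕ → Ω → R} {ζ : ℕ → Ω → Z}
    (hβ : ∀ t b, MeasurableSet {ω | β t ω = b}) (hζ : ∀ t z, MeasurableSet {ω | ζ t ω = z})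
    (t : ℕ) (Q : (ℕ → R) → (ℕ → Z) → Prop)
    (hQ : ∀ b b' y y', (∀ r ≤ t, b r = b' r) → (∀ r < t, y r = y' r) → (Q b y ↔ Q b' y')) :
    MeasurableSet {ω | Q (fun r => β r ω) (fun r => ζ r ω)} := by
  have : {ω | Q (fun r => β r ω) (fun r => ζ r ω)} =
      ⋃ k : {k : (Fin (t + 1) → R) × (Fin t → Z) // Q (extendPast t k).1 (extendPast t k).2},
        pastEvent β ζ t (extendPast t k.1).1 (extendPast t k.1).2 := by
    ext ω
    simp only [Set.mem_ofPred_eq, Set.mem_iUnion]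
    constructor
    · intro h
      have hm := (mem_pastEvent_extendPast β ζ t
        (fun r : Fin (t + 1) => β r ω, fun r : Fin t => ζ r ω) ω).mpr rfl
      exact ⟨⟨_, (hQ _ _ _ _ hm.1 hm.2).mp h⟩, hm⟩
    · rintro ⟨⟨k, hk⟩, hm⟩
      exact (hQ _ _ _ _ hm.1 hm.2).mpr hk
  rw [this]
  exact MeasurableSet.iUnion fun k => measurableSet_pastEvent hβ hζ _ _ _

/-- One step of the process: if the mean of `g` over the next draw is at most `f`, whatever the
past, then the integral of `g` is at most the integral of `f`. -/
lemma lintegral_step_le (μ : Measure Ω) [IsProbabilityMeasure μ] {β : ℕ → Ω → R} {ζ : ℕ → Ω → Z}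
    (hβ : ∀ t b, MeasurableSet {ω | β t ω = b}) (hζ : ∀ t z, MeasurableSet {ω | ζ t ω = z})
    (t : ℕ) (F : Finset Z) (P : (ℕ → R) → (ℕ → Z) → Z → ℝ) (hP : ∀ b y, ∀ z, z ∉ F → P b y z = 0)
    (law : ∀ b y z, μ.real (pastEvent β ζ t b y ∩ {ω | ζ t ω = z}) =
      μ.real (pastEvent β ζ t b y) * P b y z)
    (f g : (ℕ → R) → (ℕ → Z) → ℝ) (hf0 : ∀ b y, 0 ≤ f b y) (hg0 : ∀ b y, 0 ≤ g b y)
    (hf : ∀ b b' y y', (∀ r ≤ t, b r = b' r) → (∀ r < t, y r = y' r) → f b y = f b' y')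
    (hg : ∀ b b' y y', (∀ r ≤ t, b r = b' r) → (∀ r ≤ t, y r = y' r) → g b y = g b' y')
    (hstep : ∀ b y, μ.real (pastEvent β ζ t b y) ≠ 0 →
      ∑ z ∈ F, P b y z * g b (Function.update y t z) ≤ f b y) :
    ∫⁻ ω, ENNReal.ofReal (g (fun r => β r ω) (fun r => ζ r ω)) ∂μ ≤
      ∫⁻ ω, ENNReal.ofReal (f (fun r => β r ω) (fun r => ζ r ω)) ∂μ := by
  rw [← setLIntegral_univ, ← setLIntegral_univ (fun ω => ENNReal.ofReal (f _ _)),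
    ← iUnion_pastEvent β ζ t,
    lintegral_iUnion (fun k => measurableSet_pastEvent hβ hζ _ _ _)
      (pairwise_disjoint_pastEvent β ζ t),
    lintegral_iUnion (fun k => measurableSet_pastEvent hβ hζ _ _ _)
      (pairwise_disjoint_pastEvent β ζ t)]
  refine ENNReal.tsum_le_tsum fun k => ?_
  set b := (extendPast t k).1
  set y := (extendPast t k).2
  set E := pastEvent β ζ t b y with hE
  have hEm : MeasurableSet E := measurableSet_pastEvent hβ hζ _ _ _
  have hR : ∫⁻ ω in E, ENNReal.ofReal (f (fun r => β r ω) (fun r => ζ r ω)) ∂μ =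
      ENNReal.ofReal (f b y) * μ E := by
    rw [← setLIntegral_const]
    refine setLIntegral_congr_fun hEm fun ω hω => ?_
    simp only [hf _ b _ y hω.1 hω.2]
  have hU : E = ⋃ z, E ∩ {ω | ζ t ω = z} := by
    ext ω
    simp
  have hL : ∫⁻ ω in E, ENNReal.ofReal (g (fun r => β r ω) (fun r => ζ r ω)) ∂μ =
      ∑' z, ENNReal.ofReal (g b (Function.update y t z)) * μ (E ∩ {ω | ζ t ω = z}) := by
    conv_lhs => rw [hU]
    rw [lintegral_iUnion (fun z => hEm.inter (hζ t z))]
    · refine tsum_congr fun z => ?_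
      rw [← setLIntegral_const]
      refine setLIntegral_congr_fun (hEm.inter (hζ t z)) fun ω hω => ?_
      rw [hg _ b _ (Function.update y t z) hω.1.1]
      intro r hr
      rcases hr.lt_or_eq with h | h
      · rw [Function.update_of_ne h.ne, hω.1.2 r h]
      · rw [h, Function.update_self]
        exact hω.2
    · intro z z' hne
      refine Set.disjoint_left.mpr fun ω h h' => hne ?_
      exact h.2.symm.trans h'.2
  rw [hL, hR]
  have hm : ∀ z, μ (E ∩ {ω | ζ t ω = z}) = ENNReal.ofReal (μ.real E * P b y z) := fun z => by
    rw [← law b y z, ofReal_measureReal]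
  rw [tsum_eq_sum (s := F) fun z hz => by rw [hm, hP b y z hz]; simp]
  by_cases h0 : μ.real E = 0
  · refine le_of_eq_of_le (Finset.sum_eq_zero fun z _ => ?_) zero_le
    rw [hm, h0]
    simp
  have hEpos : 0 < μ.real E := lt_of_le_of_ne measureReal_nonneg (Ne.symm h0)
  have hPn : ∀ z, 0 ≤ P b y z := fun z => by
    have h1 : 0 ≤ μ.real E * P b y z := law b y z ▸ measureReal_nonneg
    exact nonneg_of_mul_nonneg_right h1 hEpos
  calc ∑ z ∈ F, ENNReal.ofReal (g b (Function.update y t z)) * μ (E ∩ {ω | ζ t ω = z})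
      = ∑ z ∈ F, ENNReal.ofReal (μ.real E * (P b y z * g b (Function.update y t z))) := by
        refine Finset.sum_congr rfl fun z _ => ?_
        rw [hm, ← ENNReal.ofReal_mul (hg0 _ _)]
        congr 1
        ring
    _ = ENNReal.ofReal (μ.real E * ∑ z ∈ F, P b y z * g b (Function.update y t z)) := by
        rw [← ENNReal.ofReal_sum_of_nonneg, Finset.mul_sum]
        intro z _
        exact mul_nonneg hEpos.le (mul_nonneg (hPn z) (hg0 _ _))
    _ ≤ ENNReal.ofReal (μ.real E * f b y) := by
        refine ENNReal.ofReal_le_ofReal (mul_le_mul_of_nonneg_left (hstep b y h0) hEpos.le)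
    _ = ENNReal.ofReal (f b y) * μ E := by
        rw [mul_comm, ENNReal.ofReal_mul (hf0 _ _), ofReal_measureReal]

/-- Ville's inequality for a nonnegative process that is `f t` before and `g t` after the draw `t`,
does not increase in the mean in a draw and does not increase between draws. -/
lemma measure_exists_one_le (μ : Measure Ω) [IsProbabilityMeasure μ] {β : ℕ → Ω → R}
    {ζ : ℕ → Ω → Z}
    (hβ : ∀ t b, MeasurableSet {ω | β t ω = b}) (hζ : ∀ t z, MeasurableSet {ω | ζ t ω = z})
    (F : Finset Z) (P : ℕ → (ℕ → R) → (ℕ → Z) → Z → ℝ)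
    (hP : ∀ t b y, ∀ z, z ∉ F → P t b y z = 0)
    (law : ∀ t b y z, μ.real (pastEvent β ζ t b y ∩ {ω | ζ t ω = z}) =
      μ.real (pastEvent β ζ t b y) * P t b y z)
    (f g : ℕ → (ℕ → R) → (ℕ → Z) → ℝ) (hf0 : ∀ t b y, 0 ≤ f t b y) (hg0 : ∀ t b y, 0 ≤ g t b y)
    (hf : ∀ t b b' y y', (∀ r ≤ t, b r = b' r) → (∀ r < t, y r = y' r) → f t b y = f t b' y')
    (hg : ∀ t b b' y y', (∀ r ≤ t, b r = b' r) → (∀ r ≤ t, y r = y' r) → g t b y = g t b' y')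
    (hstep : ∀ t b y, μ.real (pastEvent β ζ t b y) ≠ 0 →
      ∑ z ∈ F, P t b y z * g t b (Function.update y t z) ≤ f t b y)
    (hfg : ∀ t b y, f (t + 1) b y ≤ g t b y) {p : ℝ} (hp : ∀ b y, f 0 b y ≤ p) :
    μ {ω | ∃ t, 1 ≤ g t (fun r => β r ω) (fun r => ζ r ω)} ≤ ENNReal.ofReal p := by
  classical
  -- `alive t` says that the process has not reached `1` in the first `t` draws
  set alive : ℕ → (ℕ → R) → (ℕ → Z) → Prop := fun t b y => ∀ r < t, g r b y < 1 with halive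
  have hac : ∀ t b b' y y', (∀ r ≤ t, b r = b' r) → (∀ r < t, y r = y' r) →
      (alive t b y ↔ alive t b' y') := by
    intro t b b' y y' hb hy
    refine forall₂_congr fun r hr => ?_
    rw [hg r b b' y y' (fun r' h => hb r' (h.trans hr.le)) (fun r' h => hy r' (h.trans_lt hr))]
  set E : ℕ → Set Ω := fun t => {ω | alive t (fun r => β r ω) (fun r => ζ r ω) ∧
    1 ≤ g t (fun r => β r ω) (fun r => ζ r ω)} with hE
  set a : ℕ → ENNReal := fun t => ∫⁻ ω, ENNReal.ofReal
    (if alive t (fun r => β r ω) (fun r => ζ r ω) then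
      f t (fun r => β r ω) (fun r => ζ r ω) else 0) ∂μ with ha
  have hEm : ∀ t, MeasurableSet (E t) := by
    intro t
    refine measurableSet_of_past hβ hζ (t + 1) (fun b y => alive t b y ∧ 1 ≤ g t b y) ?_
    intro b b' y y' hb hy
    have hy' : ∀ r ≤ t, y r = y' r := fun r hr => hy r (Nat.lt_succ_of_le hr)
    have hb' : ∀ r ≤ t, b r = b' r := fun r hr => hb r (Nat.le_succ_of_le hr)
    rw [hac t b b' y y' hb' (fun r hr => hy' r hr.le), hg t b b' y y' hb' hy']
  have hstep' : ∀ t, μ (E t) + a (t + 1) ≤ a t := by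
    intro t
    have h1 : ∫⁻ ω, ENNReal.ofReal (if alive t (fun r => β r ω) (fun r => ζ r ω) then
        g t (fun r => β r ω) (fun r => ζ r ω) else 0) ∂μ ≤ a t := by
      refine lintegral_step_le μ hβ hζ t F (P t) (hP t) (law t)
        (fun b y => if alive t b y then f t b y else 0)
        (fun b y => if alive t b y then g t b y else 0) ?_ ?_ ?_ ?_ ?_
      · intro b y
        split_ifs
        exacts [hf0 _ _ _, le_rfl]
      · intro b y
        split_ifs
        exacts [hg0 _ _ _, le_rfl]
      · intro b b' y y' hb hy
        simp only [hac t b b' y y' hb hy, hf t b b' y y' hb hy]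
      · intro b b' y y' hb hy
        simp only [hac t b b' y y' hb (fun r hr => hy r hr.le), hg t b b' y y' hb hy]
      · intro b y h0
        have h2 : ∀ z, alive t b (Function.update y t z) ↔ alive t b y := fun z =>
          hac t b b _ _ (fun _ _ => rfl) fun r hr => Function.update_of_ne hr.ne _ _
        simp only [h2]
        split_ifs
        · exact hstep t b y h0
        · simp
    refine le_trans ?_ h1
    have h2 : μ (E t) = ∫⁻ ω, (E t).indicator 1 ω ∂μ := by
      rw [lintegral_indicator_one (hEm t)]
    rw [h2, ha]
    simp only
    rw [← lintegral_add_left (measurable_one.indicator (hEm t))]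
    refine lintegral_mono fun ω => ?_
    dsimp only
    set b := fun r => β r ω with hb
    set y := fun r => ζ r ω with hy
    by_cases hal : alive t b y
    · by_cases h1g : 1 ≤ g t b y
      · have hmem : ω ∈ E t := ⟨hal, h1g⟩
        have hna : ¬ alive (t + 1) b y := fun h => absurd (h t (Nat.lt_succ_self t)) h1g.not_gt
        rw [Set.indicator_of_mem hmem, if_neg hna, if_pos hal]
        simpa using h1g
      · have hmem : ω ∉ E t := fun h => h1g h.2
        rw [Set.indicator_of_notMem hmem, if_pos hal, zero_add]
        refine ENNReal.ofReal_le_ofReal ?_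
        split_ifs
        exacts [hfg t b y, hg0 t b y]
    · have hmem : ω ∉ E t := fun h => hal h.1
      have hna : ¬ alive (t + 1) b y := fun h => hal fun r hr => h r (Nat.lt_succ_of_lt hr)
      rw [Set.indicator_of_notMem hmem, if_neg hna, if_neg hal]
      simp
  have hsum : ∀ n, ∑ t ∈ Finset.range n, μ (E t) + a n ≤ a 0 := by
    intro n
    induction n with
    | zero => simp
    | succ n ih =>
      rw [Finset.sum_range_succ, add_assoc]
      exact (add_le_add le_rfl (hstep' n)).trans ih
  have ha0 : a 0 ≤ ENNReal.ofReal p := by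
    rw [ha]
    calc _ ≤ ∫⁻ _, ENNReal.ofReal p ∂μ := by
          refine lintegral_mono fun ω => ENNReal.ofReal_le_ofReal ?_
          rw [if_pos fun r hr => absurd hr (Nat.not_lt_zero r)]
          exact hp _ _
      _ = ENNReal.ofReal p := by simp
  have hsub : {ω | ∃ t, 1 ≤ g t (fun r => β r ω) (fun r => ζ r ω)} ⊆ ⋃ t, E t := by
    intro ω hω
    have hω' : ∃ t, 1 ≤ g t (fun r => β r ω) (fun r => ζ r ω) := hω
    exact Set.mem_iUnion.mpr ⟨Nat.find hω', fun r hr => not_le.mp (Nat.find_min hω' hr),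
      Nat.find_spec hω'⟩
  calc _ ≤ μ (⋃ t, E t) := measure_mono hsub
    _ ≤ ∑' t, μ (E t) := measure_iUnion_le _
    _ ≤ a 0 := ENNReal.tsum_le_of_sum_range_le fun n => le_self_add.trans (hsum n)
    _ ≤ _ := ha0

/-- The conditional probabilities of the draws add up to `1` on a past of positive probability. -/
lemma sum_law_eq_one (μ : Measure Ω) [IsProbabilityMeasure μ] {β : ℕ → Ω → R} {ζ : ℕ → Ω → Z}
    (hβ : ∀ t b, MeasurableSet {ω | β t ω = b}) (hζ : ∀ t z, MeasurableSet {ω | ζ t ω = z})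
    (t : ℕ) (F : Finset Z) (P : Z → ℝ) (hP : ∀ z, z ∉ F → P z = 0) {b : ℕ → R} {y : ℕ → Z}
    (law : ∀ z, μ.real (pastEvent β ζ t b y ∩ {ω | ζ t ω = z}) =
      μ.real (pastEvent β ζ t b y) * P z)
    (h0 : μ.real (pastEvent β ζ t b y) ≠ 0) : ∑ z ∈ F, P z = 1 := by
  set E := pastEvent β ζ t b y with hE
  have hEm : MeasurableSet E := measurableSet_pastEvent hβ hζ _ _ _
  have hU : E = ⋃ z, E ∩ {ω | ζ t ω = z} := by
    ext ω
    simp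
  have hdisj : Pairwise (Function.onFun Disjoint fun z => E ∩ {ω | ζ t ω = z}) := by
    intro z z' hne
    refine Set.disjoint_left.mpr fun ω h h' => hne ?_
    exact h.2.symm.trans h'.2
  have h1 : μ E = ∑ z ∈ F, μ (E ∩ {ω | ζ t ω = z}) := by
    conv_lhs => rw [hU]
    rw [measure_iUnion hdisj fun z => hEm.inter (hζ t z), tsum_eq_sum (s := F)]
    intro z hz
    rw [← measureReal_eq_zero_iff, law z, hP z hz, mul_zero]
  have h2 : μ.real E = ∑ z ∈ F, μ.real (E ∩ {ω | ζ t ω = z}) := by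
    simp only [measureReal_def]
    rw [h1, ENNReal.toReal_sum fun z _ => measure_ne_top _ _]
  simp only [law, ← Finset.mul_sum] at h2
  exact (mul_eq_left₀ h0).mp h2.symm

/-- Almost surely every draw has positive probability given the past. -/
lemma ae_law_ne_zero (μ : Measure Ω) [IsProbabilityMeasure μ] {β : ℕ → Ω → R} {ζ : ℕ → Ω → Z}
    (P : ℕ → (ℕ → R) → (ℕ → Z) → Z → ℝ)
    (law : ∀ t b y z, μ.real (pastEvent β ζ t b y ∩ {ω | ζ t ω = z}) =
      μ.real (pastEvent β ζ t b y) * P t b y z)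
    (hPc : ∀ t b b' y y', (∀ r ≤ t, b r = b' r) → (∀ r < t, y r = y' r) → P t b y = P t b' y') :
    ∀ᵐ ω ∂μ, ∀ t, P t (fun r => β r ω) (fun r => ζ r ω) (ζ t ω) ≠ 0 := by
  rw [ae_all_iff]
  intro t
  have hsub : {ω | ¬ P t (fun r => β r ω) (fun r => ζ r ω) (ζ t ω) ≠ 0} ⊆
      ⋃ x : {x : ((Fin (t + 1) → R) × (Fin t → Z)) × Z //
          P t (extendPast t x.1).1 (extendPast t x.1).2 x.2 = 0},
        pastEvent β ζ t (extendPast t x.1.1).1 (extendPast t x.1.1).2 ∩ {ω | ζ t ω = x.1.2} := by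
    intro ω hω
    simp only [ne_eq, not_not, Set.mem_ofPred_eq] at hω
    have hm := (mem_pastEvent_extendPast β ζ t
        (fun r : Fin (t + 1) => β r ω, fun r : Fin t => ζ r ω) ω).mpr rfl
    rw [hPc t _ _ _ _ hm.1 hm.2] at hω
    exact Set.mem_iUnion.mpr ⟨⟨((fun r : Fin (t + 1) => β r ω, fun r : Fin t => ζ r ω), ζ t ω), hω⟩,
      hm, rfl⟩
  refine measure_mono_null hsub (measure_iUnion_null fun x => ?_)
  have := law t (extendPast t x.1.1).1 (extendPast t x.1.1).2 x.1.2
  rw [x.2, mul_zero] at this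
  exact (measureReal_eq_zero_iff).mp this

end Ville

namespace EFG

variable {A : Type u} {I : Type v} [Fintype A] [DecidableEq A] [Fintype I] [DecidableEq I]

/-! ### Products and sums along a history -/

@[to_additive]
lemma prod_steps_concat {N : Type*} [CommMonoid N] (f : List A → A → N) (h : List A) (a : A) :
    ∏ n : Fin (h ++ [a]).length, f ((h ++ [a]).take n) ((h ++ [a]).get n) =
      (∏ n : Fin h.length, f (h.take n) (h.get n)) * f h a := by
  have hl : h.length + 1 = (h ++ [a]).length := by simp
  rw [← (finCongr hl).prod_comp, Fin.prod_univ_castSucc]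
  congr 1
  · refine Finset.prod_congr rfl fun n _ => ?_
    have hn : (n : ℕ) ≤ h.length := n.2.le
    simp [List.take_append_of_le_length hn, List.getElem_append_left]
  · simp

/-- The product of a factor `F g a` over the moves `a` of a history, `g` being the history before
the move. -/
def stepProd (F : List A → A → ℝ) (h : List A) : ℝ :=
  ∏ n : Fin h.length, F (h.take n) (h.get n)

@[simp] lemma stepProd_nil (F : List A → A → ℝ) : stepProd F [] = 1 := by
  simp [stepProd]

@[simp] lemma stepProd_concat (F : List A → A → ℝ) (h : List A) (a : A) :
    stepProd F (h ++ [a]) = stepProd F h * F h a :=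
  prod_steps_concat F h a

lemma reach_eq_stepProd (G : EFG A I) (π : I → A → ℝ) (h : List A) :
    G.reach π h = stepProd (fun g a => G.actProb π g a) h := rfl

lemma ownReach_eq_stepProd (G : EFG A I) (i : Fin 2) (π : I → A → ℝ) (l : ℕ) (h : List A) :
    G.ownReach i π l h =
      stepProd (fun g a => if G.mover g = some i ∧ l ≤ g.length then G.actProb π g a else 1) h := by
  refine Finset.prod_congr rfl fun n _ => ?_
  simp [List.length_take]

@[simp] lemma ownReach_nil (G : EFG A I) (i : Fin 2) (π : I → A → ℝ) (l : ℕ) :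
    G.ownReach i π l [] = 1 := by simp [ownReach_eq_stepProd]

lemma ownReach_concat (G : EFG A I) (i : Fin 2) (π : I → A → ℝ) (l : ℕ) (h : List A) (a : A) :
    G.ownReach i π l (h ++ [a]) = G.ownReach i π l h *
      if G.mover h = some i ∧ l ≤ h.length then G.actProb π h a else 1 := by
  simp [ownReach_eq_stepProd]

lemma ownReach_eq_one (G : EFG A I) (i : Fin 2) (π : I → A → ℝ) (l : ℕ) (h : List A)
    (hl : h.length ≤ l) : G.ownReach i π l h = 1 := by
  refine Finset.prod_eq_one fun n _ => if_neg ?_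
  rintro ⟨-, h'⟩
  exact absurd n.2 (by omega)

lemma othersReach_mul_ownReach (G : EFG A I) (i : Fin 2) (π : I → A → ℝ) (h : List A) :
    G.othersReach i π h * G.ownReach i π 0 h = G.reach π h := by
  simp only [othersReach, ownReach, reach, ← Finset.prod_mul_distrib]
  refine Finset.prod_congr rfl fun n _ => ?_
  by_cases h : G.mover (List.take n h) = some i <;> simp [h]

/-- The probability that the chance player plays along `h`. -/
def chanceReach (G : EFG A I) (h : List A) : ℝ :=
  stepProd (fun g a => if G.mover g = none then G.chance g a else 1) h

lemma othersReach_eq (G : EFG A I) (i j : Fin 2) (hij : i ≠ j) (π : I → A → ℝ) (h : List A) :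
    G.othersReach i π h = G.chanceReach h * G.ownReach j π 0 h := by
  simp only [othersReach, ownReach, chanceReach, stepProd, ← Finset.prod_mul_distrib]
  refine Finset.prod_congr rfl fun n _ => ?_
  rcases hm : G.infoset (List.take n h) with _ | s
  · simp [mover, hm, actProb]
  · by_cases hs : G.owner s = i
    · have : G.owner s ≠ j := fun h => hij (hs.symm.trans h)
      simp [mover, hm, hs, hij]
    · have : G.owner s = j := by omega
      simp [mover, hm, this, hij.symm]

/-- Replacing the moves of player `i` one at a time, from the end of `z` to its beginning, changes
the contribution of `i` from that of `π` to that of `σ`. -/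
lemma ownReach_sub_ownReach (G : EFG A I) (i : Fin 2) (σ π : I → A → ℝ) (z : List A) :
    G.ownReach i σ 0 z - G.ownReach i π 0 z =
      ∑ n : Fin z.length, if G.mover (z.take n) = some i then
        G.ownReach i σ 0 (z.take n) *
          (G.actProb σ (z.take n) (z.get n) - G.actProb π (z.take n) (z.get n)) *
          G.ownReach i π (n + 1) z else 0 := by
  induction z using List.reverseRecOn with
  | nil => simp
  | append_singleton h a ih =>
    have key := sum_steps_concat (N := ℝ) (fun g c => if G.mover g = some i then
        G.ownReach i σ 0 g * (G.actProb σ g c - G.actProb π g c) *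
          G.ownReach i π (g.length + 1) (h ++ [a]) else 0) h a
    have e : ∀ z' : List A, (∑ n : Fin z'.length, if G.mover (z'.take n) = some i then
        G.ownReach i σ 0 (z'.take n) *
          (G.actProb σ (z'.take n) (z'.get n) - G.actProb π (z'.take n) (z'.get n)) *
          G.ownReach i π (n + 1) (h ++ [a]) else 0) =
        ∑ n : Fin z'.length, if G.mover (z'.take n) = some i then
        G.ownReach i σ 0 (z'.take n) *
          (G.actProb σ (z'.take n) (z'.get n) - G.actProb π (z'.take n) (z'.get n)) *
          G.ownReach i π ((z'.take n).length + 1) (h ++ [a]) else 0 := by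
      intro z'
      refine Finset.sum_congr rfl fun n _ => ?_
      rw [List.length_take, min_eq_left n.2.le]
    rw [e, key, ← e]
    have e2 : (∑ n : Fin h.length, if G.mover (h.take n) = some i then
        G.ownReach i σ 0 (h.take n) *
          (G.actProb σ (h.take n) (h.get n) - G.actProb π (h.take n) (h.get n)) *
          G.ownReach i π (n + 1) (h ++ [a]) else 0) =
        (G.ownReach i σ 0 h - G.ownReach i π 0 h) *
          if G.mover h = some i then G.actProb π h a else 1 := by
      rw [ih, Finset.sum_mul]
      refine Finset.sum_congr rfl fun n _ => ?_
      have hn : (n : ℕ) + 1 ≤ h.length := n.2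
      simp only [ownReach_concat, hn, and_true]
      split_ifs <;> ring
    rw [e2]
    clear e e2 key ih
    rw [ownReach_concat, ownReach_concat, ownReach_eq_one G i π (h.length + 1) (h ++ [a]) (by simp)]
    by_cases hm : G.mover h = some i
    · simp [hm]
      ring
    · simp [hm]

lemma ownSeq_concat (G : EFG A I) (i : Fin 2) (h : List A) (a : A) :
    G.ownSeq i (h ++ [a]) = G.ownSeq i h ++
      (match G.infoset h with
        | some s => if G.owner s = i then [(s, a)] else []
        | none => []) := by
  unfold GameTree.ownSeq
  rw [List.length_append, List.length_singleton, List.range_succ, List.filterMap_append]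
  congr 1
  · refine List.filterMap_congr fun n hn => ?_
    rw [List.mem_range] at hn
    rw [List.take_append_of_le_length hn.le, List.getElem?_append_left hn]
  · rcases hs : G.infoset h with _ | s
    · simp [hs]
    · by_cases ho : G.owner s = i <;> simp [hs, ho]

lemma ownReach_eq_ownSeq (G : EFG A I) (i : Fin 2) (π : I → A → ℝ) (h : List A) :
    G.ownReach i π 0 h = ((G.ownSeq i h).map (fun x => π x.1 x.2)).prod := by
  induction h using List.reverseRecOn with
  | nil => simp [GameTree.ownSeq]
  | append_singleton h a ih =>
    rw [ownReach_concat, ownSeq_concat, ih]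
    rcases hs : G.infoset h with _ | s
    · simp [mover, hs]
    · by_cases ho : G.owner s = i <;> simp [mover, actProb, hs, ho]

/-- By perfect recall all histories of an information set have the same reaching contribution of
its owner. -/
lemma ownReach_eq_of_infoset_eq (G : EFG A I) (π : I → A → ℝ) {h h' : List A} {s : I}
    (hs : G.infoset h = some s) (hs' : G.infoset h' = some s) :
    G.ownReach (G.owner s) π 0 h = G.ownReach (G.owner s) π 0 h' := by
  rw [ownReach_eq_ownSeq, ownReach_eq_ownSeq, G.perfect_recall h h' s hs hs']

lemma ownSeq_length_take_mono (G : EFG A I) (i : Fin 2) (z : List A) :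
    Monotone fun n => (G.ownSeq i (z.take n)).length := by
  refine monotone_nat_of_le_succ fun n => ?_
  rcases lt_or_ge n z.length with hn | hn
  · rw [List.take_succ_eq_append_getElem hn, ownSeq_concat]
    simp
  · rw [List.take_of_length_le hn, List.take_of_length_le (by omega)]

/-- By perfect recall no history passes through an information set twice. -/
lemma infoset_take_injective (G : EFG A I) (z : List A) (s : I) {n n' : ℕ} (hn : n < z.length)
    (hn' : n' < z.length)
    (h : G.infoset (z.take n) = some s) (h' : G.infoset (z.take n') = some s) : n = n' := by
  have key : ∀ k k' : ℕ, k < z.length → G.infoset (z.take k) = some s →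
      G.infoset (z.take k') = some s → ¬ k < k' := by
    intro k k' hk h1 h2 hlt
    have h3 := ownSeq_length_take_mono G (G.owner s) z (Nat.succ_le_of_lt hlt)
    simp only [Nat.succ_eq_add_one, List.take_succ_eq_append_getElem hk, ownSeq_concat, h1,
      G.perfect_recall _ _ s h2 h1] at h3
    simp at h3
  have h1 := key n n' hn h h'
  have h2 := key n' n hn' h' h
  omega

/-! ### Profiles on restricted action sets -/

lemma actProb_nonneg (G : EFG A I) {π : I → A → ℝ} (hπ : ∀ s a, 0 ≤ π s a) (h : List A) (a : A) :
    0 ≤ G.actProb π h a := by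
  unfold actProb
  split
  · exact hπ _ _
  · exact G.chance_nonneg _ _

lemma reach_nonneg (G : EFG A I) {π : I → A → ℝ} (hπ : ∀ s a, 0 ≤ π s a) (h : List A) :
    0 ≤ G.reach π h :=
  Finset.prod_nonneg fun _ _ => actProb_nonneg G hπ _ _

lemma ownReach_nonneg (G : EFG A I) (i : Fin 2) {π : I → A → ℝ} (hπ : ∀ s a, 0 ≤ π s a) (l : ℕ)
    (h : List A) : 0 ≤ G.ownReach i π l h :=
  Finset.prod_nonneg fun _ _ => by
    split_ifs
    exacts [actProb_nonneg G hπ _ _, zero_le_one]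

lemma othersReach_nonneg (G : EFG A I) (i : Fin 2) {π : I → A → ℝ} (hπ : ∀ s a, 0 ≤ π s a)
    (h : List A) : 0 ≤ G.othersReach i π h :=
  Finset.prod_nonneg fun _ _ => by
    split_ifs
    exacts [zero_le_one, actProb_nonneg G hπ _ _]

lemma IsProfileOn.le_one {B : I → Finset A} {π : I → A → ℝ} (hπ : IsProfileOn B π) (s : I)
    (a : A) : π s a ≤ 1 := by
  by_cases ha : a ∈ B s
  · rw [← (hπ s).2.2]
    exact Finset.single_le_sum (fun b _ => (hπ s).1 b) ha
  · rw [(hπ s).2.1 a ha]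
    exact zero_le_one

lemma take_mem_hist (G : EFG A I) {h : List A} (hh : h ∈ G.hist) (n : ℕ) : h.take n ∈ G.hist := by
  induction h using List.reverseRecOn with
  | nil => simpa using hh
  | append_singleton h a ih =>
    rcases le_or_gt n h.length with hn | hn
    · rw [List.take_append_of_le_length hn]
      exact ih (G.prefix_mem h a hh)
    · rw [List.take_of_length_le (by simp; omega)]
      exact hh

lemma get_mem_avail (G : EFG A I) {h : List A} (hh : h ∈ G.hist) (n : Fin h.length) :
    h.get n ∈ G.avail (h.take n) := by
  have := take_mem_hist G hh (n + 1)
  rw [List.take_succ_eq_append_getElem n.2] at this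
  simpa [GameTree.avail] using this

lemma actProb_le_one (G : EFG A I) {B : I → Finset A} {π : I → A → ℝ} (hπ : IsProfileOn B π)
    {h : List A} (hh : h ∈ G.hist) {a : A} (ha : a ∈ G.avail h) : G.actProb π h a ≤ 1 := by
  unfold actProb
  split
  · exact hπ.le_one _ _
  · rename_i hs
    rw [← G.chance_sum h hh hs ⟨a, ha⟩]
    exact Finset.single_le_sum (fun b _ => G.chance_nonneg h b) ha

lemma ownReach_le_one (G : EFG A I) (i : Fin 2) {B : I → Finset A} {π : I → A → ℝ}
    (hπ : IsProfileOn B π) (l : ℕ) {h : List A} (hh : h ∈ G.hist) : G.ownReach i π l h ≤ 1 := by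
  refine Finset.prod_le_one (fun n _ => ?_) (fun n _ => ?_)
  · split_ifs
    exacts [actProb_nonneg G (fun s => (hπ s).1) _ _, zero_le_one]
  · split_ifs
    exacts [actProb_le_one G hπ (take_mem_hist G hh n) (get_mem_avail G hh n), le_rfl]

lemma othersReach_le_one (G : EFG A I) (i : Fin 2) {B : I → Finset A} {π : I → A → ℝ}
    (hπ : IsProfileOn B π) {h : List A} (hh : h ∈ G.hist) : G.othersReach i π h ≤ 1 := by
  refine Finset.prod_le_one (fun n _ => ?_) (fun n _ => ?_)
  · split_ifs
    exacts [zero_le_one, actProb_nonneg G (fun s => (hπ s).1) _ _]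
  · split_ifs
    exacts [le_rfl, actProb_le_one G hπ (take_mem_hist G hh n) (get_mem_avail G hh n)]

lemma reach_le_one (G : EFG A I) {B : I → Finset A} {π : I → A → ℝ}
    (hπ : IsProfileOn B π) {h : List A} (hh : h ∈ G.hist) : G.reach π h ≤ 1 :=
  Finset.prod_le_one (fun _ _ => actProb_nonneg G (fun s => (hπ s).1) _ _)
    (fun n _ => actProb_le_one G hπ (take_mem_hist G hh n) (get_mem_avail G hh n))

/-- A history uses only actions in `B` at the information sets it passes through. -/
def StaysIn (G : EFG A I) (B : I → Finset A) (h : List A) : Prop :=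
  ∀ n : Fin h.length, ∀ s : I, G.infoset (h.take n) = some s → h.get n ∈ B s

lemma mem_restrictedHist (G : EFG A I) (P : G.Population) (h : List A) :
    h ∈ G.restrictedHist P ↔ h ∈ G.hist ∧ G.StaysIn (G.restrictedActions P) h := by
  simp [restrictedHist, StaysIn]

lemma StaysIn.take {G : EFG A I} {B : I → Finset A} {h : List A} (hh : G.StaysIn B h) (k : ℕ) :
    G.StaysIn B (h.take k) := by
  intro n s hs
  have hn := n.2
  simp only [List.length_take, lt_min_iff] at hn
  have := hh ⟨n, hn.2⟩ s (by simpa [List.take_take, min_eq_left hn.1.le] using hs)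
  simpa using this

lemma staysIn_of_reach_ne_zero (G : EFG A I) {B : I → Finset A} {π : I → A → ℝ}
    (hπ : IsProfileOn B π) {h : List A} (hh : G.reach π h ≠ 0) : G.StaysIn B h := by
  intro n s hs
  by_contra hn
  refine hh (Finset.prod_eq_zero (Finset.mem_univ n) ?_)
  simp only [actProb, hs]
  exact (hπ s).2.1 _ hn

/-- Some terminal history is reached with positive probability by both players and chance. -/
lemma exists_terminal_reach_pos (G : EFG A I) {B : I → Finset A} (hB : ∀ s, B s ⊆ G.actions s)
    {π : I → A → ℝ} (hπ : IsProfileOn B π) : ∃ z ∈ G.terminal, 0 < G.reach π z := by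
  have hne : (G.hist.filter fun h => 0 < G.reach π h).Nonempty :=
    ⟨[], Finset.mem_filter.mpr ⟨G.nil_mem, by simp [reach_eq_stepProd]⟩⟩
  obtain ⟨z, hz, hmax⟩ := Finset.exists_max_image _ List.length hne
  simp only [Finset.mem_filter] at hz hmax
  refine ⟨z, ?_, hz.2⟩
  simp only [terminal, Finset.mem_filter]
  refine ⟨hz.1, ?_⟩
  by_contra hav
  have hav' := Finset.nonempty_iff_ne_empty.mpr hav
  have hsum : ∑ a ∈ G.avail z, G.actProb π z a = 1 := by
    rcases hs : G.infoset z with _ | s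
    · simp only [actProb, hs]
      exact G.chance_sum z hz.1 hs hav'
    · simp only [actProb, hs]
      rw [G.avail_eq z s hs, ← (hπ s).2.2]
      exact (Finset.sum_subset (hB s) fun a _ ha => (hπ s).2.1 a ha).symm
  obtain ⟨a, ha, hpos⟩ : ∃ a ∈ G.avail z, 0 < G.actProb π z a := by
    by_contra! hcon
    have := Finset.sum_nonpos hcon
    linarith
  have h1 := hmax (z ++ [a]) ⟨by simpa [GameTree.avail] using ha, by
    rw [reach_eq_stepProd, stepProd_concat]
    exact mul_pos hz.2 hpos⟩
  simp at h1

/-! ### Regret decomposition -/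

/-- The reaching contribution of the owner of `s` at `s`, which by perfect recall may be read off
any history in `s`. -/
def infosetReach (G : EFG A I) (σ : I → A → ℝ) (s : I) : ℝ :=
  G.ownReach (G.owner s) σ 0 (G.infoset_surj s).choose

lemma infosetReach_eq (G : EFG A I) (σ : I → A → ℝ) {h : List A} {s : I}
    (hs : G.infoset h = some s) : G.infosetReach σ s = G.ownReach (G.owner s) σ 0 h :=
  ownReach_eq_of_infoset_eq G σ (G.infoset_surj s).choose_spec hs

lemma infosetReach_nonneg (G : EFG A I) {σ : I → A → ℝ} (hσ : ∀ s a, 0 ≤ σ s a) (s : I) :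
    0 ≤ G.infosetReach σ s := ownReach_nonneg G _ hσ _ _

lemma infosetReach_le_one (G : EFG A I) {B : I → Finset A} {σ : I → A → ℝ}
    (hσ : IsProfileOn B σ) (s : I) : G.infosetReach σ s ≤ 1 :=
  ownReach_le_one G _ hσ _ (G.infoset_mem _ _ (G.infoset_surj s).choose_spec)

/-- On every single terminal history `z`, the sampled regrets against `σ`, weighted by the reaching
contributions of `σ`, add up to the importance-weighted payoff difference between `σ` and `π`. -/
lemma sum_infosetReach_mul_sampledRegret (G : EFG A I) {B : I → Finset A} {σ π : I → A → ℝ}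
    (hσ : IsProfileOn B σ) (ξ : I → A → ℝ) (z : List A) (i : Fin 2) :
    (∑ s, if G.owner s = i then
      G.infosetReach σ s * ∑ a ∈ B s, σ s a * G.sampledRegret B π ξ z s a else 0) =
    G.payoffOf i z * G.othersReach i π z / G.reach ξ z *
      (G.ownReach i σ 0 z - G.ownReach i π 0 z) := by
  have h1 : ∀ s, G.owner s = i →
      G.infosetReach σ s * ∑ a ∈ B s, σ s a * G.sampledRegret B π ξ z s a =
      ∑ n : Fin z.length, if G.infoset (z.take n) = some s then
        G.payoffOf i z * G.othersReach i π z / G.reach ξ z *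
          (G.ownReach i σ 0 (z.take n) * (σ s (z.get n) - π s (z.get n)) *
          G.ownReach i π (n + 1) z) else 0 := by
    rintro s rfl
    have h2 : ∑ a ∈ B s, σ s a * G.sampledRegret B π ξ z s a =
        ∑ a ∈ B s, ∑ n : Fin z.length, if G.infoset (z.take n) = some s then
        (G.payoffOf (G.owner s) z * G.othersReach (G.owner s) π z *
            G.ownReach (G.owner s) π (n + 1) z / G.reach ξ z) *
          ((if z.get n = a then σ s a else 0) - σ s a * π s (z.get n)) else 0 := by
      refine Finset.sum_congr rfl fun a ha => ?_
      rw [sampledRegret, if_pos ha, Finset.mul_sum]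
      refine Finset.sum_congr rfl fun n _ => ?_
      split_ifs <;> ring
    rw [h2, Finset.sum_comm, Finset.mul_sum]
    refine Finset.sum_congr rfl fun n _ => ?_
    split_ifs with hn
    · rw [← Finset.mul_sum, Finset.sum_sub_distrib, ← Finset.sum_mul, (hσ s).2.2, one_mul,
        Finset.sum_ite_eq, infosetReach_eq G σ hn]
      have : (if z.get n ∈ B s then σ s (z.get n) else 0) = σ s (z.get n) := by
        split_ifs with h
        · rfl
        · exact ((hσ s).2.1 _ h).symm
      rw [this]
      ring
    · simp
  have h3 : (∑ s, if G.owner s = i then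
      G.infosetReach σ s * ∑ a ∈ B s, σ s a * G.sampledRegret B π ξ z s a else 0) =
      ∑ s, ∑ n : Fin z.length, if G.owner s = i then if G.infoset (z.take n) = some s then
        G.payoffOf i z * G.othersReach i π z / G.reach ξ z *
          (G.ownReach i σ 0 (z.take n) * (σ s (z.get n) - π s (z.get n)) *
          G.ownReach i π (n + 1) z) else 0 else 0 := by
    refine Finset.sum_congr rfl fun s _ => ?_
    split_ifs with hs
    · exact h1 s hs
    · simp
  rw [h3, Finset.sum_comm, ownReach_sub_ownReach, Finset.mul_sum]
  refine Finset.sum_congr rfl fun n _ => ?_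
  rcases hn : G.infoset (z.take n) with _ | s₀
  · simp [mover, hn]
  · rw [Finset.sum_eq_single s₀]
    · by_cases ho : G.owner s₀ = i <;> simp [mover, actProb, hn, ho]
    · intro s _ hs
      simp [hs.symm]
    · simp

/-- The immediate counterfactual regret of `a` at `s`, defined as the mean of its estimate
`sampledRegret` under the sampling profile `ξ`. -/
def trueRegret (G : EFG A I) (B : I → Finset A) (π ξ : I → A → ℝ) (s : I) (a : A) : ℝ :=
  ∑ z ∈ G.terminal, G.reach ξ z * G.sampledRegret B π ξ z s a

/-- The payoff of player `i` when `i` plays by `σ` and the opponent by `π`. -/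
def mixedValue (G : EFG A I) (i : Fin 2) (σ π : I → A → ℝ) : ℝ :=
  ∑ z ∈ G.terminal, G.othersReach i π z * G.ownReach i σ 0 z * G.payoffOf i z

lemma mixedValue_self (G : EFG A I) (i : Fin 2) (π : I → A → ℝ) :
    G.mixedValue i π π = G.value π i := by
  simp only [mixedValue, value, othersReach_mul_ownReach]

lemma ownReach_congr (G : EFG A I) (i : Fin 2) {σ π : I → A → ℝ}
    (h : ∀ s, G.owner s = i → σ s = π s) (l : ℕ) (z : List A) :
    G.ownReach i σ l z = G.ownReach i π l z := by
  refine Finset.prod_congr rfl fun n _ => ?_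
  split_ifs with hn
  · rcases hs : G.infoset (z.take n) with _ | s
    · simp [mover, hs] at hn
    · simp only [mover, hs, Option.map_some, Option.some.injEq] at hn
      simp [actProb, hs, h s hn.1]
  · rfl

lemma othersReach_congr (G : EFG A I) (i : Fin 2) {σ π : I → A → ℝ}
    (h : ∀ s, G.owner s ≠ i → σ s = π s) (z : List A) :
    G.othersReach i σ z = G.othersReach i π z := by
  refine Finset.prod_congr rfl fun n _ => ?_
  split_ifs with hn
  · rfl
  · rcases hs : G.infoset (z.take n) with _ | s
    · simp [actProb, hs]
    · simp only [mover, hs, Option.map_some, Option.some.injEq] at hn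
      simp [actProb, hs, h s hn]

lemma value_eq_mixedValue (G : EFG A I) (i : Fin 2) {σ π : I → A → ℝ}
    (h : ∀ s, G.owner s ≠ i → σ s = π s) : G.value σ i = G.mixedValue i σ π := by
  rw [← mixedValue_self]
  simp only [mixedValue, othersReach_congr G i h]

lemma sum_value (G : EFG A I) (π : I → A → ℝ) : ∑ i, G.value π i = 0 := by
  simp [Fin.sum_univ_two, value, payoffOf]

/-- The sampling profile `ξ` samples with probability at least `q₀` every terminal history in the
action sets `B` that is reached by the opponents of some player under `π`. -/
def ExploresOn (G : EFG A I) (B : I → Finset A) (q₀ : ℝ) (π ξ : I → A → ℝ) : Prop :=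
  IsProfileOn B ξ ∧ ∀ i : Fin 2, ∀ z ∈ G.terminal, G.StaysIn B z →
    G.othersReach i π z = 0 ∨ q₀ ≤ G.reach ξ z

lemma othersReach_mul_ownReach_eq_zero (G : EFG A I) {B : I → Finset A} {σ π : I → A → ℝ}
    (hσ : IsProfileOn B σ) (hπ : IsProfileOn B π) {z : List A} (hz : ¬ G.StaysIn B z) (i : Fin 2) :
    G.othersReach i π z * G.ownReach i σ 0 z = 0 := by
  simp only [StaysIn, not_forall] at hz
  obtain ⟨n, s, hs, hn⟩ := hz
  by_cases ho : G.owner s = i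
  · rw [mul_eq_zero]
    right
    refine Finset.prod_eq_zero (Finset.mem_univ n) ?_
    simpa [mover, actProb, hs, ho] using (hσ s).2.1 _ hn
  · rw [mul_eq_zero]
    left
    refine Finset.prod_eq_zero (Finset.mem_univ n) ?_
    simpa [mover, actProb, hs, ho] using (hπ s).2.1 _ hn

/-- The regret of player `i` against `σ` is the sum of the immediate counterfactual regrets. -/
lemma sum_infosetReach_mul_trueRegret (G : EFG A I) {B : I → Finset A} {σ π ξ : I → A → ℝ}
    {q₀ : ℝ} (hq : 0 < q₀) (hσ : IsProfileOn B σ) (hπ : IsProfileOn B π)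
    (hξ : G.ExploresOn B q₀ π ξ) (i : Fin 2) :
    (∑ s, if G.owner s = i then
      G.infosetReach σ s * ∑ a ∈ B s, σ s a * G.trueRegret B π ξ s a else 0) =
    G.mixedValue i σ π - G.value π i := by
  have h1 : (∑ s, if G.owner s = i then
      G.infosetReach σ s * ∑ a ∈ B s, σ s a * G.trueRegret B π ξ s a else 0) =
      ∑ s, ∑ z ∈ G.terminal, G.reach ξ z * if G.owner s = i then
        G.infosetReach σ s * ∑ a ∈ B s, σ s a * G.sampledRegret B π ξ z s a else 0 := by
    refine Finset.sum_congr rfl fun s _ => ?_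
    split_ifs
    · simp only [trueRegret, Finset.mul_sum]
      rw [Finset.sum_comm]
      refine Finset.sum_congr rfl fun z _ => Finset.sum_congr rfl fun a _ => by ring
    · simp
  rw [h1, Finset.sum_comm, ← mixedValue_self, mixedValue, mixedValue, ← Finset.sum_sub_distrib]
  refine Finset.sum_congr rfl fun z hz => ?_
  rw [← Finset.mul_sum, sum_infosetReach_mul_sampledRegret G hσ]
  by_cases hst : G.StaysIn B z
  · rcases hξ.2 i z hz hst with h0 | h0
    · simp [h0]
    · have : G.reach ξ z ≠ 0 := (hq.trans_le h0).ne'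
      field_simp
  · have e1 := othersReach_mul_ownReach_eq_zero G hσ hπ hst i
    have e2 := othersReach_mul_ownReach_eq_zero G hπ hπ hst i
    have e3 : G.reach ξ z = 0 := by
      by_contra h
      exact hst (staysIn_of_reach_ne_zero G hξ.1 h)
    rw [e1, e2, e3]
    simp

/-! ### The average strategy -/

lemma isProfileOn_normalize {B : I → Finset A} (hB : ∀ s, (B s).Nonempty) {W : I → A → ℝ}
    (hW : ∀ s a, 0 ≤ W s a) : IsProfileOn B (normalize B W) := by
  intro s
  refine ⟨fun a => ?_, fun a ha => by simp [normalize, ha], ?_⟩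
  · unfold normalize
    split_ifs with h1 h2
    exacts [div_nonneg (hW s a) h2.le, by positivity, le_rfl]
  · by_cases h : 0 < ∑ b ∈ B s, W s b
    · rw [Finset.sum_congr rfl fun a ha => by
        rw [normalize, if_pos ha, if_pos h], ← Finset.sum_div, div_self h.ne']
    · rw [Finset.sum_congr rfl fun a ha => by
        rw [normalize, if_pos ha, if_neg h]]
      have := (hB s).card_pos
      simp only [Finset.sum_const, nsmul_eq_mul]
      field_simp

lemma reachWeight_nonneg (G : EFG A I) {π : I → A → ℝ} (hπ : ∀ s a, 0 ≤ π s a) (s : I) (a : A) :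
    0 ≤ G.reachWeight π s a :=
  mul_nonneg (Finset.sum_nonneg fun _ _ => ownReach_nonneg G _ hπ _ _) (hπ s a)

lemma reachWeight_eq (G : EFG A I) (π : I → A → ℝ) {h : List A} {s : I}
    (hs : G.infoset h = some s) (a : A) :
    G.reachWeight π s a = ((G.hist.filter fun h => G.infoset h = some s).card : ℝ) *
      (G.ownReach (G.owner s) π 0 h * π s a) := by
  rw [reachWeight, Finset.sum_congr rfl fun h' hh' =>
    ownReach_eq_of_infoset_eq G π (Finset.mem_filter.mp hh').2 hs]
  simp [mul_assoc]

/-- The reaching contributions of the average strategy are the averages of the reaching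
contributions. -/
lemma card_mul_ownReach_average (G : EFG A I) {ι : Type*} (J : Finset ι) {B : I → Finset A}
    {π : ι → I → A → ℝ} (hπ : ∀ r ∈ J, IsProfileOn B (π r)) (i : Fin 2) (h : List A) :
    J.card * G.ownReach i (normalize B fun s a => ∑ r ∈ J, G.reachWeight (π r) s a) 0 h =
      ∑ r ∈ J, G.ownReach i (π r) 0 h := by
  set W : I → A → ℝ := fun s a => ∑ r ∈ J, G.reachWeight (π r) s a with hW
  induction h using List.reverseRecOn with
  | nil => simp
  | append_singleton h a ih =>
    simp only [ownReach_concat, zero_le, and_true]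
    rw [← mul_assoc, ih]
    by_cases hm : G.mover h = some i
    · rcases hs : G.infoset h with _ | s
      · simp [mover, hs] at hm
      have ho : G.owner s = i := by simpa [mover, hs] using hm
      subst ho
      simp only [hm, if_true, actProb, hs]
      set c : ℝ := ((G.hist.filter fun h => G.infoset h = some s).card : ℝ) with hc
      have hcpos : 0 < c := by
        rw [hc, Nat.cast_pos, Finset.card_pos]
        exact ⟨h, Finset.mem_filter.mpr ⟨G.infoset_mem h s hs, hs⟩⟩
      have hWs : ∀ b, W s b = c * ∑ r ∈ J, G.ownReach (G.owner s) (π r) 0 h * π r s b := by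
        intro b
        rw [hW, Finset.mul_sum]
        exact Finset.sum_congr rfl fun r _ => reachWeight_eq G (π r) hs b
      have hsum : ∑ b ∈ B s, W s b = c * ∑ r ∈ J, G.ownReach (G.owner s) (π r) 0 h := by
        simp only [hWs, ← Finset.mul_sum]
        rw [Finset.sum_comm]
        congr 1
        refine Finset.sum_congr rfl fun r hr => ?_
        rw [← Finset.mul_sum, (hπ r hr s).2.2, mul_one]
      by_cases ha : a ∈ B s
      · by_cases hp : 0 < ∑ b ∈ B s, W s b
        · rw [normalize, if_pos ha, if_pos hp, hsum, hWs]
          rw [hsum] at hp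
          have := (pos_iff_pos_of_mul_pos hp).mp hcpos
          field_simp
        · have hnn : ∀ r ∈ J, 0 ≤ G.ownReach (G.owner s) (π r) 0 h := fun r hr =>
            ownReach_nonneg G _ (fun s => (hπ r hr s).1) _ _
          have h0 : ∑ r ∈ J, G.ownReach (G.owner s) (π r) 0 h = 0 := by
            refine le_antisymm ?_ (Finset.sum_nonneg hnn)
            by_contra! hcon
            exact hp (hsum ▸ mul_pos hcpos hcon)
          rw [h0, zero_mul]
          refine (Finset.sum_eq_zero fun r hr => ?_).symm
          rw [(Finset.sum_eq_zero_iff_of_nonneg hnn).mp h0 r hr, zero_mul]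
      · rw [normalize, if_neg ha, mul_zero]
        refine (Finset.sum_eq_zero fun r hr => ?_).symm
        rw [(hπ r hr s).2.1 a ha, mul_zero]
    · simp [hm]

/-- The gain of a player from deviating from the average strategy is an average of immediate
counterfactual regrets. The game being zero-sum, the values of the individual strategies cancel. -/
lemma card_mul_value_sub_value_average (G : EFG A I) {ι : Type*} (J : Finset ι)
    {B : I → Finset A} {π ξ : ι → I → A → ℝ} {q₀ : ℝ} (hq : 0 < q₀)
    (hπ : ∀ r ∈ J, IsProfileOn B (π r)) (hξ : ∀ r ∈ J, G.ExploresOn B q₀ (π r) (ξ r))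
    {σ σ' : I → A → ℝ} (hσ' : σ' = normalize B fun s a => ∑ r ∈ J, G.reachWeight (π r) s a)
    (hσ : IsProfileOn B σ) (i : Fin 2) (h : ∀ s, G.owner s ≠ i → σ s = σ' s) :
    J.card * (G.value σ i - G.value σ' i) =
      ∑ s, G.infosetReach σ s * ∑ a ∈ B s, σ s a * ∑ r ∈ J, G.trueRegret B (π r) (ξ r) s a := by
  have h1 : ∀ j, ∑ r ∈ J, G.mixedValue j σ (π r) = J.card * G.mixedValue j σ σ' := by
    intro j
    obtain ⟨k, hk⟩ : ∃ k, j ≠ k := exists_ne j |>.imp fun _ h => h.symm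
    simp only [mixedValue]
    rw [Finset.sum_comm, Finset.mul_sum]
    refine Finset.sum_congr rfl fun z _ => ?_
    simp only [othersReach_eq G j k hk]
    have := card_mul_ownReach_average G J hπ k z
    rw [← hσ'] at this
    rw [← Finset.sum_mul, ← Finset.sum_mul, ← Finset.mul_sum, ← this]
    ring
  have h2 : ∑ j, (G.mixedValue j σ σ' - G.value σ' j) = G.value σ i - G.value σ' i := by
    rw [Finset.sum_eq_single i, value_eq_mixedValue G i h]
    · intro j _ hj
      rw [← mixedValue_self]
      simp only [mixedValue]
      rw [sub_eq_zero]
      refine Finset.sum_congr rfl fun z _ => ?_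
      rw [ownReach_congr G j fun s hs => h s (hs.trans_ne hj)]
    · simp
  rw [← h2, Finset.sum_sub_distrib, sum_value, sub_zero, Finset.mul_sum]
  simp only [← h1]
  rw [Finset.sum_comm]
  have h3 : ∀ r ∈ J, ∑ j, G.mixedValue j σ (π r) =
      ∑ s, G.infosetReach σ s * ∑ a ∈ B s, σ s a * G.trueRegret B (π r) (ξ r) s a := by
    intro r hr
    rw [← sub_zero (∑ j, G.mixedValue j σ (π r)), ← sum_value G (π r), ← Finset.sum_sub_distrib]
    simp only [← sum_infosetReach_mul_trueRegret G hq hσ (hπ r hr) (hξ r hr)]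
    rw [Finset.sum_comm]
    simp
  rw [Finset.sum_congr rfl h3, Finset.sum_comm]
  refine Finset.sum_congr rfl fun s _ => ?_
  rw [← Finset.mul_sum, Finset.sum_comm]
  simp only [Finset.mul_sum]

/-! ### Bounds on the sampled regrets -/

lemma abs_sampledRegret_le (G : EFG A I) {B : I → Finset A} {π ξ : I → A → ℝ} {q₀ Δ : ℝ}
    (hq : 0 < q₀) (hΔ0 : 0 ≤ Δ) (hΔ : ∀ z ∈ G.terminal, |G.payoff z| ≤ Δ) (hπ : IsProfileOn B π)
    (hξ : G.ExploresOn B q₀ π ξ) {z : List A} (hz : z ∈ G.terminal) (s : I) (a : A) :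
    |G.sampledRegret B π ξ z s a| ≤ Δ / q₀ := by
  have hK : 0 ≤ Δ / q₀ := by positivity
  have hzh : z ∈ G.hist := (Finset.mem_filter.mp hz).1
  have hπ0 : ∀ s a, 0 ≤ π s a := fun s => (hπ s).1
  rw [sampledRegret]
  split_ifs with ha
  swap
  · simpa using hK
  by_cases hex : ∃ n : Fin z.length, G.infoset (z.take n) = some s
  swap
  · rw [Finset.sum_eq_zero]
    · simpa using hK
    · intro n _
      rw [if_neg fun h => hex ⟨n, h⟩]
  obtain ⟨n, hn⟩ := hex
  rw [Finset.sum_eq_single n]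
  rotate_left
  · intro n' _ hne
    refine if_neg fun h => hne ?_
    exact Fin.ext (infoset_take_injective G z s n'.2 n.2 h hn)
  · simp
  rw [if_pos hn, abs_mul]
  have h1 : |(if z.get n = a then (1 : ℝ) else 0) - π s (z.get n)| ≤ 1 := by
    have := hπ0 s (z.get n)
    have := hπ.le_one s (z.get n)
    rw [abs_le]
    split_ifs <;> constructor <;> linarith
  refine (mul_le_of_le_one_right (abs_nonneg _) h1).trans ?_
  by_cases hr : G.reach ξ z = 0
  · simpa [hr] using hK
  rcases hξ.2 (G.owner s) z hz (staysIn_of_reach_ne_zero G hξ.1 hr) with h0 | h0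
  · simpa [h0] using hK
  have hrp : 0 < G.reach ξ z := hq.trans_le h0
  rw [abs_div, abs_mul, abs_mul, abs_of_pos hrp, abs_of_nonneg (othersReach_nonneg G _ hπ0 _),
    abs_of_nonneg (ownReach_nonneg G _ hπ0 _ _)]
  have hp : |G.payoffOf (G.owner s) z| ≤ Δ := by
    unfold payoffOf
    split_ifs
    · exact hΔ z hz
    · rw [abs_neg]
      exact hΔ z hz
  refine div_le_div₀ hΔ0 ?_ hq h0
  calc _ ≤ Δ * 1 * 1 := by
        refine mul_le_mul (mul_le_mul hp (othersReach_le_one G _ hπ hzh)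
          (othersReach_nonneg G _ hπ0 _) hΔ0) (ownReach_le_one G _ hπ _ hzh)
          (ownReach_nonneg G _ hπ0 _ _) (by linarith)
    _ = Δ := by ring

open scoped Classical in
/-- The information sets reachable by actions in `B`. -/
def reachable (G : EFG A I) (B : I → Finset A) : Finset I :=
  Finset.univ.filter fun s => ∃ h, G.StaysIn B h ∧ G.infoset h = some s

lemma restrictedSize_eq (G : EFG A I) (P : G.Population) :
    G.restrictedSize P = (G.reachable (G.restrictedActions P)).card := by
  unfold restrictedSize reachable
  congr 1
  ext s
  simp only [Finset.mem_filter, Finset.mem_univ, true_and, mem_restrictedHist]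
  exact ⟨fun ⟨h, h1, h2⟩ => ⟨h, h1.2, h2⟩, fun ⟨h, h1, h2⟩ => ⟨h, ⟨G.infoset_mem h s h2, h1⟩, h2⟩⟩

lemma sampledRegret_eq_zero (G : EFG A I) {B : I → Finset A} {π ξ : I → A → ℝ}
    (hξ : IsProfileOn B ξ) {s : I} (hs : s ∉ G.reachable B) (z : List A) (a : A) :
    G.sampledRegret B π ξ z s a = 0 := by
  rw [sampledRegret]
  by_cases ha : a ∈ B s
  · rw [if_pos ha]
    refine Finset.sum_eq_zero fun n _ => ?_
    by_cases hn : G.infoset (z.take n) = some s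
    · rw [if_pos hn]
      by_cases hr : G.reach ξ z = 0
      · simp [hr]
      · refine absurd ?_ hs
        simp only [reachable, Finset.mem_filter, Finset.mem_univ, true_and]
        exact ⟨z.take n, (staysIn_of_reach_ne_zero G hξ hr).take n, hn⟩
    · rw [if_neg hn]
  · rw [if_neg ha]

/-- Regret matching is orthogonal to the regrets that it incurs. -/
lemma sum_posPart_mul_sampledRegret (G : EFG A I) (B : I → Finset A) (R ξ : I → A → ℝ)
    (z : List A) (s : I) :
    ∑ a ∈ B s, max 0 (R s a) *
      G.sampledRegret B (normalize B fun s a => max 0 (R s a)) ξ z s a = 0 := by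
  set π := normalize B fun s a => max 0 (R s a) with hπ
  by_cases hpos : 0 < ∑ b ∈ B s, max 0 (R s b)
  swap
  · have hnn : ∀ b ∈ B s, 0 ≤ max 0 (R s b) := fun b _ => le_max_left _ _
    have h0 : ∑ b ∈ B s, max 0 (R s b) = 0 :=
      le_antisymm (not_lt.mp hpos) (Finset.sum_nonneg hnn)
    refine Finset.sum_eq_zero fun a ha => ?_
    rw [(Finset.sum_eq_zero_iff_of_nonneg hnn).mp h0 a ha, zero_mul]
  have h1 : ∀ a ∈ B s, max 0 (R s a) * G.sampledRegret B π ξ z s a =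
      ∑ n : Fin z.length, if G.infoset (z.take n) = some s then
        (G.payoffOf (G.owner s) z * G.othersReach (G.owner s) π z *
            G.ownReach (G.owner s) π (n + 1) z / G.reach ξ z) *
          ((if z.get n = a then max 0 (R s a) else 0) - max 0 (R s a) * π s (z.get n))
        else 0 := by
    intro a ha
    rw [sampledRegret, if_pos ha, Finset.mul_sum]
    refine Finset.sum_congr rfl fun n _ => ?_
    split_ifs <;> ring
  rw [Finset.sum_congr rfl h1, Finset.sum_comm]
  refine Finset.sum_eq_zero fun n _ => ?_
  split_ifs with hn
  · rw [← Finset.mul_sum, Finset.sum_sub_distrib, Finset.sum_ite_eq, ← Finset.sum_mul]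
    have : (if z.get n ∈ B s then max 0 (R s (z.get n)) else 0) =
        (∑ b ∈ B s, max 0 (R s b)) * π s (z.get n) := by
      split_ifs with h
      · rw [hπ, normalize, if_pos h, if_pos hpos]
        field_simp
      · rw [hπ, normalize, if_neg h, mul_zero]
    rw [this, sub_self, mul_zero]
  · simp

/-- The potential argument for one step of regret matching. -/
lemma sum_sq_posPart_step (G : EFG A I) (B : I → Finset A) (R ξ : I → A → ℝ)
    (z : List A) (s : I) {K : ℝ}
    (hK : ∀ a, |G.sampledRegret B (normalize B fun s a => max 0 (R s a)) ξ z s a| ≤ K) :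
    ∑ a ∈ B s, max 0 (R s a +
      G.sampledRegret B (normalize B fun s a => max 0 (R s a)) ξ z s a) ^ 2 ≤
    ∑ a ∈ B s, max 0 (R s a) ^ 2 + (B s).card * K ^ 2 := by
  have horth := sum_posPart_mul_sampledRegret G B R ξ z s
  set r := G.sampledRegret B (normalize B fun s a => max 0 (R s a)) ξ z s with hr
  have h1 : ∀ a ∈ B s, max 0 (R s a + r a) ^ 2 ≤
      max 0 (R s a) ^ 2 + 2 * (max 0 (R s a) * r a) + K ^ 2 := by
    intro a _
    have h2 : r a ^ 2 ≤ K ^ 2 := sq_le_sq' (abs_le.mp (hK a)).1 (abs_le.mp (hK a)).2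
    have h3 : max 0 (R s a + r a) ^ 2 ≤ (max 0 (R s a) + r a) ^ 2 := by
      rcases le_total (R s a + r a) 0 with h | h
      · rw [max_eq_left h]
        nlinarith [sq_nonneg (max 0 (R s a) + r a)]
      · rw [max_eq_right h]
        have := le_max_right 0 (R s a)
        exact pow_le_pow_left₀ h (by linarith) 2
    nlinarith
  refine (Finset.sum_le_sum h1).trans (le_of_eq ?_)
  rw [Finset.sum_add_distrib, Finset.sum_add_distrib, ← Finset.mul_sum, horth]
  simp

/-! ### Populations and windows -/

section Dynamics

variable {G : EFG A I} {m : ℕ → G.Population → ℕ} {price : G.Population → ℕ}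
  {samp : G.State → I → A → ℝ} {b : ℕ → G.Response} {y : ℕ → List A}

lemma run_congr {b' : ℕ → G.Response} {y' : ℕ → List A} {t : ℕ} (hb : ∀ r ≤ t, b r = b' r)
    (hy : ∀ r < t, y r = y' r) : G.run m price samp b y t = G.run m price samp b' y' t := by
  induction t with
  | zero => simp [run, hb 0 le_rfl]
  | succ t ih =>
    rw [run, run, ih (fun r hr => hb r (Nat.le_succ_of_le hr))
      (fun r hr => hy r (Nat.lt_succ_of_lt hr)), hy t (Nat.lt_succ_self t), hb (t + 1) le_rfl]

/-- The three outcomes of an iteration: no responses are computed, the responses are already in the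
population, or a new window starts. -/
lemma run_succ_cases (t : ℕ) :
    (¬ m (G.run m price samp b y t).window (G.run m price samp b y t).pop ∣
        (G.run m price samp b y t).time + 1 ∧
      G.run m price samp b y (t + 1) = G.runMid m price samp b y t) ∨
    (m (G.run m price samp b y t).window (G.run m price samp b y t).pop ∣
        (G.run m price samp b y t).time + 1 ∧
      (fun i => insert (b (t + 1) i) ((G.run m price samp b y t).pop i)) =
        (G.run m price samp b y t).pop ∧
      G.run m price samp b y (t + 1) = { G.runMid m price samp b y t with
        cost := (G.runMid m price samp b y t).cost + price (G.run m price samp b y t).pop }) ∨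
    (m (G.run m price samp b y t).window (G.run m price samp b y t).pop ∣
        (G.run m price samp b y t).time + 1 ∧
      (fun i => insert (b (t + 1) i) ((G.run m price samp b y t).pop i)) ≠
        (G.run m price samp b y t).pop ∧
      G.run m price samp b y (t + 1) =
        { time := (G.run m price samp b y t).time + 1
          window := (G.run m price samp b y t).window + 1
          pops := Function.update (G.run m price samp b y t).pops
            ((G.run m price samp b y t).window + 1)
            (fun i => insert (b (t + 1) i) ((G.run m price samp b y t).pop i))
          regret := fun _ _ => 0
          weight := fun _ _ => 0
          cost := (G.runMid m price samp b y t).cost + price (G.run m price samp b y t).pop }) := by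
  by_cases h1 : m (G.run m price samp b y t).window (G.run m price samp b y t).pop ∣
        (G.run m price samp b y t).time + 1
  · right
    by_cases h2 : (fun i => insert (b (t + 1) i) ((G.run m price samp b y t).pop i)) =
        (G.run m price samp b y t).pop
    · left
      refine ⟨h1, h2, ?_⟩
      exact (if_pos h1).trans (if_pos h2)
    · right
      refine ⟨h1, h2, ?_⟩
      exact (if_pos h1).trans (if_neg h2)
  · left
    exact ⟨h1, if_neg h1⟩

lemma run_time (t : ℕ) : (G.run m price samp b y t).time = t := by
  induction t with
  | zero => rfl
  | succ t ih =>
    rcases run_succ_cases (G := G) (m := m) (price := price) (samp := samp) (b := b) (y := y) t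
      with h | h | h
    · rw [h.2]; simp [runMid, mccfrIter, ih]
    · rw [h.2.2]; simp [runMid, mccfrIter, ih]
    · rw [h.2.2]; simp [ih]

lemma run_window_succ (t : ℕ) :
    (G.run m price samp b y (t + 1)).window = (G.run m price samp b y t).window ∨
    (G.run m price samp b y (t + 1)).window = (G.run m price samp b y t).window + 1 := by
  rcases run_succ_cases (G := G) (m := m) (price := price) (samp := samp) (b := b) (y := y) t
    with h | h | h
  · rw [h.2]; exact Or.inl rfl
  · rw [h.2.2]; exact Or.inl rfl
  · rw [h.2.2]; exact Or.inr rfl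

lemma run_window_mono : Monotone fun t => (G.run m price samp b y t).window := by
  refine monotone_nat_of_le_succ fun t => ?_
  rcases run_window_succ (G := G) (m := m) (price := price) (samp := samp) (b := b) (y := y) t
    with h | h <;> simp [h]

lemma run_pops_succ (t : ℕ) {j : ℕ} (hj : j ≤ (G.run m price samp b y t).window) :
    (G.run m price samp b y (t + 1)).pops j = (G.run m price samp b y t).pops j := by
  rcases run_succ_cases (G := G) (m := m) (price := price) (samp := samp) (b := b) (y := y) t
    with h | h | h
  · rw [h.2]; rfl
  · rw [h.2.2]; rfl
  · rw [h.2.2]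
    exact Function.update_of_ne (by omega) _ _

lemma run_pops_eq {r t : ℕ} (hrt : r ≤ t) {j : ℕ} (hj : j ≤ (G.run m price samp b y r).window) :
    (G.run m price samp b y t).pops j = (G.run m price samp b y r).pops j := by
  induction t, hrt using Nat.le_induction with
  | base => rfl
  | succ t hrt ih => rw [run_pops_succ t (hj.trans (run_window_mono hrt)), ih]

lemma run_pop_eq {r t : ℕ} (hrt : r ≤ t)
    (hw : (G.run m price samp b y r).window = (G.run m price samp b y t).window) :
    (G.run m price samp b y r).pop = (G.run m price samp b y t).pop := by
  rw [State.pop, State.pop, ← hw, run_pops_eq hrt le_rfl]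

lemma run_pop_subset_succ (t : ℕ) (i : Fin 2) :
    (G.run m price samp b y t).pop i ⊆ (G.run m price samp b y (t + 1)).pop i := by
  rcases run_succ_cases (G := G) (m := m) (price := price) (samp := samp) (b := b) (y := y) t
    with h | h | h
  · rw [h.2]; exact subset_rfl
  · rw [h.2.2]; exact subset_rfl
  · rw [h.2.2]
    simp only [State.pop, Function.update_self]
    exact Finset.subset_insert _ _

lemma run_pop_mono {r t : ℕ} (hrt : r ≤ t) (i : Fin 2) :
    (G.run m price samp b y r).pop i ⊆ (G.run m price samp b y t).pop i := by
  induction t, hrt using Nat.le_induction with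
  | base => exact subset_rfl
  | succ t hrt ih => exact ih.trans (run_pop_subset_succ t i)

lemma run_pop_nonempty (t : ℕ) (i : Fin 2) : ((G.run m price samp b y t).pop i).Nonempty := by
  refine Finset.Nonempty.mono (run_pop_mono (Nat.zero_le t) i) ?_
  exact ⟨b 0 i, Finset.mem_singleton_self _⟩

lemma restrictedActions_nonempty {P : G.Population} (hP : ∀ i, (P i).Nonempty) (s : I) :
    (G.restrictedActions P s).Nonempty := (hP _).image _

lemma restrictedActions_subset (P : G.Population) (s : I) :
    G.restrictedActions P s ⊆ G.actions s := by
  intro a ha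
  obtain ⟨f, -, rfl⟩ := Finset.mem_image.mp ha
  exact (f ⟨s, rfl⟩).2

lemma restrictedActions_mono {P P' : G.Population} (h : ∀ i, P i ⊆ P' i) (s : I) :
    G.restrictedActions P s ⊆ G.restrictedActions P' s := Finset.image_subset_image (h _)

lemma restrictedSize_mono {P P' : G.Population} (h : ∀ i, P i ⊆ P' i) :
    G.restrictedSize P ≤ G.restrictedSize P' := by
  rw [restrictedSize_eq, restrictedSize_eq]
  refine Finset.card_le_card fun s hs => ?_
  simp only [reachable, Finset.mem_filter, Finset.mem_univ, true_and] at hs ⊢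
  obtain ⟨h', h1, h2⟩ := hs
  exact ⟨h', fun n s' hs' => restrictedActions_mono h s' (h1 n s' hs'), h2⟩

/-- Every new window adds a pure strategy to the population. -/
lemma run_window_lt_card (t : ℕ) :
    (G.run m price samp b y t).window < ∑ i, ((G.run m price samp b y t).pop i).card := by
  induction t with
  | zero => simp [run, init, State.pop]
  | succ t ih =>
    rcases run_succ_cases (G := G) (m := m) (price := price) (samp := samp) (b := b) (y := y) t
      with h | h | h
    · rw [h.2]; exact ih
    · rw [h.2.2]; exact ih
    · rw [h.2.2]
      simp only [State.pop, Function.update_self]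
      refine lt_of_le_of_lt (Nat.succ_le_of_lt ih) ?_
      obtain ⟨i, hi⟩ := Function.ne_iff.mp h.2.1
      refine Finset.sum_lt_sum (fun i _ => Finset.card_le_card (Finset.subset_insert _ _))
        ⟨i, Finset.mem_univ i, Finset.card_lt_card ?_⟩
      exact (Finset.subset_insert _ _).ssubset_of_ne (Ne.symm hi)

lemma run_window_lt (t : ℕ) :
    (G.run m price samp b y t).window < ∑ i, Fintype.card (G.Pure i) :=
  (run_window_lt_card t).trans_le (Finset.sum_le_sum fun _ _ => Finset.card_le_univ _)

/-- The number of iterations completed when the window of the state after `t` iterations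
started. -/
def windowStart (G : EFG A I) (m : ℕ → G.Population → ℕ) (price : G.Population → ℕ)
    (samp : G.State → I → A → ℝ) (b : ℕ → G.Response) (y : ℕ → List A) : ℕ → ℕ
  | 0 => 0
  | t + 1 =>
    if (G.run m price samp b y (t + 1)).window = (G.run m price samp b y t).window then
      windowStart G m price samp b y t else t + 1

lemma windowStart_congr {b' : ℕ → G.Response} {y' : ℕ → List A} {t : ℕ}
    (hb : ∀ r ≤ t, b r = b' r) (hy : ∀ r < t, y r = y' r) :
    G.windowStart m price samp b y t = G.windowStart m price samp b' y' t := by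
  induction t with
  | zero => rfl
  | succ t ih =>
    have hb' : ∀ r ≤ t, b r = b' r := fun r hr => hb r (Nat.le_succ_of_le hr)
    have hy' : ∀ r < t, y r = y' r := fun r hr => hy r (Nat.lt_succ_of_lt hr)
    rw [windowStart, windowStart, ih hb' hy', run_congr hb hy, run_congr hb' hy']

lemma windowStart_le (t : ℕ) : G.windowStart m price samp b y t ≤ t := by
  induction t with
  | zero => exact le_rfl
  | succ t ih =>
    rw [windowStart]
    split_ifs <;> omega

lemma window_eq_of_windowStart_le {r t : ℕ} (h : G.windowStart m price samp b y t ≤ r)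
    (hrt : r ≤ t) : (G.run m price samp b y r).window = (G.run m price samp b y t).window := by
  induction t with
  | zero => rw [Nat.le_zero.mp hrt]
  | succ t ih =>
    rcases hrt.lt_or_eq with h1 | h1
    · rw [windowStart] at h
      split_ifs at h with h2
      · rw [h2, ih h (Nat.le_of_lt_succ h1)]
      · omega
    · rw [h1]

lemma windowStart_eq_of_window_eq {r t : ℕ} (hrt : r ≤ t)
    (h : (G.run m price samp b y r).window = (G.run m price samp b y t).window) :
    G.windowStart m price samp b y t = G.windowStart m price samp b y r := by
  induction t, hrt using Nat.le_induction with
  | base => rfl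
  | succ t hrt ih =>
    have h1 := run_window_mono (G := G) (m := m) (price := price) (samp := samp) (b := b)
      (y := y) hrt
    have h2 := run_window_mono (G := G) (m := m) (price := price) (samp := samp) (b := b)
      (y := y) (Nat.le_succ t)
    simp only [Nat.succ_eq_add_one] at h1 h2
    rw [windowStart, if_pos (by omega), ih (by omega)]

lemma windowStart_succ_of_ne {t : ℕ}
    (h : (G.run m price samp b y (t + 1)).window ≠ (G.run m price samp b y t).window) :
    G.windowStart m price samp b y (t + 1) = t + 1 := by
  rw [windowStart, if_neg h]

lemma run_succ_of_window_eq {t : ℕ}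
    (h : (G.run m price samp b y (t + 1)).window = (G.run m price samp b y t).window) :
    (G.run m price samp b y (t + 1)).regret = (G.runMid m price samp b y t).regret ∧
    (G.run m price samp b y (t + 1)).weight = (G.runMid m price samp b y t).weight := by
  rcases run_succ_cases (G := G) (m := m) (price := price) (samp := samp) (b := b) (y := y) t
    with h' | h' | h'
  · rw [h'.2]; exact ⟨rfl, rfl⟩
  · rw [h'.2.2]; exact ⟨rfl, rfl⟩
  · rw [h'.2.2] at h
    simp at h

lemma run_succ_of_window_ne {t : ℕ}
    (h : (G.run m price samp b y (t + 1)).window ≠ (G.run m price samp b y t).window) :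
    (G.run m price samp b y (t + 1)).window = (G.run m price samp b y t).window + 1 ∧
    (G.run m price samp b y (t + 1)).regret = (fun _ _ => 0) ∧
    (G.run m price samp b y (t + 1)).weight = fun _ _ => 0 := by
  rcases run_succ_cases (G := G) (m := m) (price := price) (samp := samp) (b := b) (y := y) t
    with h' | h' | h'
  · rw [h'.2] at h; exact absurd rfl h
  · rw [h'.2.2] at h; exact absurd rfl h
  · rw [h'.2.2]; exact ⟨rfl, rfl, rfl⟩

/-- The regrets sampled in iteration `t + 1`. -/
def iterRegret (G : EFG A I) (m : ℕ → G.Population → ℕ) (price : G.Population → ℕ)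
    (samp : G.State → I → A → ℝ) (b : ℕ → G.Response) (y : ℕ → List A) (t : ℕ) : I → A → ℝ :=
  G.sampledRegret (G.restrictedActions (G.run m price samp b y t).pop)
    (G.run m price samp b y t).strategy (samp (G.run m price samp b y t)) (y t)

/-- The mean, given the past, of the regrets sampled in iteration `t + 1`. -/
def iterTrueRegret (G : EFG A I) (m : ℕ → G.Population → ℕ) (price : G.Population → ℕ)
    (samp : G.State → I → A → ℝ) (b : ℕ → G.Response) (y : ℕ → List A) (t : ℕ) : I → A → ℝ :=
  G.trueRegret (G.restrictedActions (G.run m price samp b y t).pop)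
    (G.run m price samp b y t).strategy (samp (G.run m price samp b y t))

lemma run_regret_eq (t : ℕ) (s : I) (a : A) : (G.run m price samp b y t).regret s a =
    ∑ r ∈ Finset.Ico (G.windowStart m price samp b y t) t,
      G.iterRegret m price samp b y r s a := by
  induction t with
  | zero => rfl
  | succ t ih =>
    by_cases h : (G.run m price samp b y (t + 1)).window = (G.run m price samp b y t).window
    · rw [windowStart_eq_of_window_eq (Nat.le_succ t) h.symm,
        Finset.sum_Ico_succ_top (windowStart_le t), ← ih, (run_succ_of_window_eq h).1]
      rfl
    · rw [windowStart_succ_of_ne h, (run_succ_of_window_ne h).2.1]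
      simp

lemma run_weight_eq (t : ℕ) (s : I) (a : A) : (G.run m price samp b y t).weight s a =
    ∑ r ∈ Finset.Ico (G.windowStart m price samp b y t) t,
      G.reachWeight (G.run m price samp b y r).strategy s a := by
  induction t with
  | zero => rfl
  | succ t ih =>
    by_cases h : (G.run m price samp b y (t + 1)).window = (G.run m price samp b y t).window
    · rw [windowStart_eq_of_window_eq (Nat.le_succ t) h.symm,
        Finset.sum_Ico_succ_top (windowStart_le t), ← ih, (run_succ_of_window_eq h).2]
      rfl
    · rw [windowStart_succ_of_ne h, (run_succ_of_window_ne h).2.2]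
      simp

lemma runMid_regret_eq (t : ℕ) (s : I) (a : A) : (G.runMid m price samp b y t).regret s a =
    ∑ r ∈ Finset.Ico (G.windowStart m price samp b y t) (t + 1),
      G.iterRegret m price samp b y r s a := by
  rw [Finset.sum_Ico_succ_top (windowStart_le t), ← run_regret_eq]
  rfl

lemma runMid_weight_eq (t : ℕ) : (G.runMid m price samp b y t).weight = fun s a =>
    ∑ r ∈ Finset.Ico (G.windowStart m price samp b y t) (t + 1),
      G.reachWeight (G.run m price samp b y r).strategy s a := by
  ext s a
  rw [Finset.sum_Ico_succ_top (windowStart_le t), ← run_weight_eq]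
  rfl

lemma isProfileOn_strategy (t : ℕ) :
    IsProfileOn (G.restrictedActions (G.run m price samp b y t).pop)
      (G.run m price samp b y t).strategy :=
  isProfileOn_normalize (restrictedActions_nonempty (run_pop_nonempty t))
    fun _ _ => le_max_left _ _

lemma isProfileOn_average (t : ℕ) :
    IsProfileOn (G.restrictedActions (G.run m price samp b y t).pop)
      (G.runMid m price samp b y t).average := by
  refine isProfileOn_normalize (restrictedActions_nonempty (run_pop_nonempty t)) fun s a => ?_
  rw [runMid_weight_eq]
  exact Finset.sum_nonneg fun r _ =>
    reachWeight_nonneg G (fun s => (isProfileOn_strategy r s).1) s a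

lemma IsProfileOn.isProfile {P : G.Population} {π : I → A → ℝ}
    (h : IsProfileOn (G.restrictedActions P) π) : G.IsProfile π := by
  intro s
  refine ⟨(h s).1, fun a ha => (h s).2.1 a fun h' => ha (restrictedActions_subset P s h'), ?_⟩
  rw [← (h s).2.2]
  exact (Finset.sum_subset (restrictedActions_subset P s) fun a _ ha => (h s).2.1 a ha).symm

lemma explores_iff (q₀ : ℝ) (S : G.State) (ξ : I → A → ℝ) : G.Explores q₀ S ξ ↔
    G.ExploresOn (G.restrictedActions S.pop) q₀ S.strategy ξ := by
  unfold Explores ExploresOn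
  refine and_congr Iff.rfl (forall_congr' fun i => forall₂_congr fun z hz => ?_)
  rw [mem_restrictedHist]
  exact ⟨fun h h' => h ⟨(Finset.mem_filter.mp hz).1, h'⟩, fun h h' => h h'.2⟩

/-! ### Equilibria of restricted games -/

/-- If the last-window average is an `e`-equilibrium of the restricted game and `δ`-best responses
to it belong to the population, it is an `(e + δ)`-equilibrium of the original game. -/
lemma isNash_of_response_mem {P : G.Population} {π : I → A → ℝ} {e δ : ℝ}
    (hπ : IsProfileOn (G.restrictedActions P) π)
    (hgap : ∀ i σ, IsProfileOn (G.restrictedActions P) σ → (∀ s, G.owner s ≠ i → σ s = π s) →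
      G.value σ i - G.value π i ≤ e)
    {c : G.Response} (hc : ∀ i, c i ∈ P i) (hbr : ∀ i, G.IsBestResponse δ π i (c i)) :
    G.IsNash (e + δ) π := by
  have key : ∀ i π', G.IsProfile π' → (∀ s, G.owner s ≠ i → π' s = π s) →
      G.value π' i - (e + δ) ≤ G.value π i := by
    intro i π' hπ' hs
    have h1 := hbr i π' hπ' hs
    have h2 : IsProfileOn (G.restrictedActions P) (G.deviate π i (c i)) := by
      intro s
      by_cases ho : G.owner s = i
      · subst ho
        have hmem : (c (G.owner s) ⟨s, rfl⟩).1 ∈ G.restrictedActions P s :=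
          Finset.mem_image_of_mem (fun f : G.Pure (G.owner s) => (f ⟨s, rfl⟩).1) (hc (G.owner s))
        simp only [deviate, dite_true]
        refine ⟨fun a => by split_ifs <;> simp, fun a ha => ?_, ?_⟩
        · rw [if_neg]
          rintro rfl
          exact ha hmem
        · rw [Finset.sum_ite_eq, if_pos hmem]
      · simpa [deviate, ho] using hπ s
    have h3 := hgap i _ h2 (fun s ho => by ext a; simp [deviate, ho])
    linarith
  refine ⟨hπ.isProfile, fun i => ⟨fun π' hπ' hs => ?_, key i⟩⟩
  obtain ⟨j, hj⟩ : ∃ j, j ≠ i := exists_ne i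
  have h1 := key j π' hπ' fun s hs' => hs s (by omega)
  have h2 : ∀ ρ, G.value ρ j = - G.value ρ i := by
    intro ρ
    have := sum_value G ρ
    rw [Fin.sum_univ_two] at this
    have hij : (i = 0 ∧ j = 1) ∨ (i = 1 ∧ j = 0) := by omega
    rcases hij with ⟨rfl, rfl⟩ | ⟨rfl, rfl⟩ <;> linarith
  rw [h2, h2] at h1
  linarith

/-- Once the last-window average is an approximate equilibrium of the restricted game, the next
expansion step starts a new window, unless the average is an equilibrium of the game. -/
lemma window_succ_of_not_isNash {t : ℕ} {e δ : ℝ}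
    (hgap : ∀ i σ, IsProfileOn (G.restrictedActions (G.run m price samp b y t).pop) σ →
      (∀ s, G.owner s ≠ i → σ s = (G.runMid m price samp b y t).average s) →
      G.value σ i - G.value (G.runMid m price samp b y t).average i ≤ e)
    (hm : m (G.run m price samp b y t).window (G.run m price samp b y t).pop ∣ t + 1)
    (hgood : G.GoodResponse m price samp δ b y (t + 1))
    (hn : ¬ G.IsNash (e + δ) (G.runMid m price samp b y t).average) :
    (G.run m price samp b y (t + 1)).window = (G.run m price samp b y t).window + 1 := by
  have hm' : m (G.run m price samp b y t).window (G.run m price samp b y t).pop ∣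
      (G.run m price samp b y t).time + 1 := by rwa [run_time]
  rcases run_succ_cases (G := G) (m := m) (price := price) (samp := samp) (b := b) (y := y) t
    with h | h | h
  · exact absurd hm' h.1
  · refine absurd (isNash_of_response_mem (isProfileOn_average t) hgap (fun i => ?_) (hgood hm')) hn
    rw [← congrFun h.2.1 i]
    exact Finset.mem_insert_self _ _
  · rw [h.2.2]

end Dynamics

/-! ### The regret within a window -/

section Window

variable {G : EFG A I} {m : ℕ → G.Population → ℕ} {price : G.Population → ℕ}
  {samp : G.State → I → A → ℝ} {b : ℕ → G.Response} {y : ℕ → List A}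

/-- An execution in which every sampling profile explores and every sampled history can be
sampled. -/
def IsRegular (G : EFG A I) (m : ℕ → G.Population → ℕ) (price : G.Population → ℕ)
    (samp : G.State → I → A → ℝ) (q₀ : ℝ) (b : ℕ → G.Response) (y : ℕ → List A) : Prop :=
  ∀ t, G.Explores q₀ (G.run m price samp b y t) (samp (G.run m price samp b y t)) ∧
    G.sampleProb (samp (G.run m price samp b y t)) (y t) ≠ 0

lemma IsRegular.exploresOn {q₀ : ℝ} (h : G.IsRegular m price samp q₀ b y) (t : ℕ) :
    G.ExploresOn (G.restrictedActions (G.run m price samp b y t).pop) q₀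
      (G.run m price samp b y t).strategy (samp (G.run m price samp b y t)) :=
  (explores_iff _ _ _).mp (h t).1

lemma IsRegular.mem_terminal {q₀ : ℝ} (h : G.IsRegular m price samp q₀ b y) (t : ℕ) :
    y t ∈ G.terminal := by
  by_contra hcon
  exact (h t).2 (if_neg hcon)

lemma IsRegular.reach_ne_zero {q₀ : ℝ} (h : G.IsRegular m price samp q₀ b y) (t : ℕ) :
    G.reach (samp (G.run m price samp b y t)) (y t) ≠ 0 := by
  have := (h t).2
  rwa [sampleProb, if_pos (h.mem_terminal t)] at this

lemma IsRegular.mem_restrictedHist {q₀ : ℝ} (h : G.IsRegular m price samp q₀ b y) (t : ℕ) :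
    y t ∈ G.restrictedHist (G.run m price samp b y t).pop := by
  rw [EFG.mem_restrictedHist]
  exact ⟨(Finset.mem_filter.mp (h.mem_terminal t)).1,
    staysIn_of_reach_ne_zero G (h.exploresOn t).1 (h.reach_ne_zero t)⟩

lemma IsRegular.abs_iterRegret_le {q₀ Δ : ℝ} (hq : 0 < q₀) (hΔ0 : 0 ≤ Δ)
    (hΔ : ∀ z ∈ G.terminal, |G.payoff z| ≤ Δ) (h : G.IsRegular m price samp q₀ b y) (t : ℕ) (s : I)
    (a : A) : |G.iterRegret m price samp b y t s a| ≤ Δ / q₀ :=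
  abs_sampledRegret_le G hq hΔ0 hΔ (isProfileOn_strategy t) (h.exploresOn t) (h.mem_terminal t) s a

lemma sum_sq_runMid_regret_le_add {K : ℝ}
    (hK : ∀ t s a, |G.iterRegret m price samp b y t s a| ≤ K) (t : ℕ) (s : I) :
    ∑ a ∈ G.restrictedActions (G.run m price samp b y t).pop s,
      max 0 ((G.runMid m price samp b y t).regret s a) ^ 2 ≤
    ∑ a ∈ G.restrictedActions (G.run m price samp b y t).pop s,
      max 0 ((G.run m price samp b y t).regret s a) ^ 2 +
    (G.restrictedActions (G.run m price samp b y t).pop s).card * K ^ 2 :=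
  sum_sq_posPart_step G _ (G.run m price samp b y t).regret (samp (G.run m price samp b y t)) (y t)
    s (hK t s)

/-- Regret matching keeps the squared positive sampled regrets of an information set linear in the
age of the window. -/
lemma sum_sq_run_regret_le {K : ℝ}
    (hK : ∀ t s a, |G.iterRegret m price samp b y t s a| ≤ K) (t : ℕ) (s : I) :
    ∑ a ∈ G.restrictedActions (G.run m price samp b y t).pop s,
      max 0 ((G.run m price samp b y t).regret s a) ^ 2 ≤
    ((t : ℝ) - G.windowStart m price samp b y t) *
      ((G.restrictedActions (G.run m price samp b y t).pop s).card * K ^ 2) := by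
  induction t with
  | zero => simp [run, init, windowStart]
  | succ t ih =>
    by_cases h : (G.run m price samp b y (t + 1)).window = (G.run m price samp b y t).window
    · rw [windowStart_eq_of_window_eq (Nat.le_succ t) h.symm, (run_succ_of_window_eq h).1,
        ← run_pop_eq (Nat.le_succ t) h.symm]
      have := sum_sq_runMid_regret_le_add hK t s
      push_cast
      linarith
    · rw [windowStart_succ_of_ne h, (run_succ_of_window_ne h).2.1]
      simp

lemma sum_sq_runMid_regret_le {K : ℝ}
    (hK : ∀ t s a, |G.iterRegret m price samp b y t s a| ≤ K) (t : ℕ) (s : I) :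
    ∑ a ∈ G.restrictedActions (G.run m price samp b y t).pop s,
      max 0 ((G.runMid m price samp b y t).regret s a) ^ 2 ≤
    ((t : ℝ) + 1 - G.windowStart m price samp b y t) *
      ((G.restrictedActions (G.run m price samp b y t).pop s).card * K ^ 2) := by
  have h1 := sum_sq_runMid_regret_le_add hK t s
  have h2 := sum_sq_run_regret_le hK t s
  linarith

lemma card_restrictedActions_le (P : G.Population) (s : I) :
    (G.restrictedActions P s).card ≤ G.numActions :=
  (Finset.card_le_card (restrictedActions_subset P s)).trans
    (Finset.le_sup (f := fun s => (G.actions s).card) (Finset.mem_univ s))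

/-- The deviation of the sampled regrets in the current window from their means, before
iteration `t + 1`. -/
def noise (G : EFG A I) (m : ℕ → G.Population → ℕ) (price : G.Population → ℕ)
    (samp : G.State → I → A → ℝ) (b : ℕ → G.Response) (y : ℕ → List A) (t : ℕ) (s : I) (a : A) :
    ℝ :=
  ∑ r ∈ Finset.Ico (G.windowStart m price samp b y t) t,
    (G.iterTrueRegret m price samp b y r s a - G.iterRegret m price samp b y r s a)

/-- The deviation of the sampled regrets in the current window from their means, after the
sampling step of iteration `t + 1`. -/
def noiseMid (G : EFG A I) (m : ℕ → G.Population → ℕ) (price : G.Population → ℕ)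
    (samp : G.State → I → A → ℝ) (b : ℕ → G.Response) (y : ℕ → List A) (t : ℕ) (s : I) (a : A) :
    ℝ :=
  ∑ r ∈ Finset.Ico (G.windowStart m price samp b y t) (t + 1),
    (G.iterTrueRegret m price samp b y r s a - G.iterRegret m price samp b y r s a)

lemma noiseMid_eq (t : ℕ) (s : I) (a : A) : G.noiseMid m price samp b y t s a =
    G.noise m price samp b y t s a +
      (G.iterTrueRegret m price samp b y t s a - G.iterRegret m price samp b y t s a) := by
  rw [noiseMid, Finset.sum_Ico_succ_top (windowStart_le t), noise]

/-- If the sampled regrets and their deviations from the true regrets are at most `c` per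
information set, then deviations from the last-window average in the restricted game gain at
most `2 * c * X` in total. -/
lemma card_mul_value_sub_le {q₀ c : ℝ} (hq : 0 < q₀)
    (hreg : G.IsRegular m price samp q₀ b y) (t : ℕ)
    (hR : ∀ s, ∀ a ∈ G.restrictedActions (G.run m price samp b y t).pop s,
      s ∈ G.reachable (G.restrictedActions (G.run m price samp b y t).pop) →
      (G.runMid m price samp b y t).regret s a ≤ c)
    (hD : ∀ s, ∀ a ∈ G.restrictedActions (G.run m price samp b y t).pop s,
      s ∈ G.reachable (G.restrictedActions (G.run m price samp b y t).pop) →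
      G.noiseMid m price samp b y t s a ≤ c) (hc : 0 ≤ c)
    {i : Fin 2} {σ : I → A → ℝ}
    (hσ : IsProfileOn (G.restrictedActions (G.run m price samp b y t).pop) σ)
    (hs : ∀ s, G.owner s ≠ i → σ s = (G.runMid m price samp b y t).average s) :
    ((t : ℝ) + 1 - G.windowStart m price samp b y t) *
      (G.value σ i - G.value (G.runMid m price samp b y t).average i) ≤
      2 * c * G.restrictedSize (G.run m price samp b y t).pop := by
  set B := G.restrictedActions (G.run m price samp b y t).pop with hB
  have hpop : ∀ r ∈ Finset.Ico (G.windowStart m price samp b y t) (t + 1),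
      (G.run m price samp b y r).pop = (G.run m price samp b y t).pop := by
    intro r hr
    rw [Finset.mem_Ico] at hr
    exact run_pop_eq (Nat.le_of_lt_succ hr.2)
      (window_eq_of_windowStart_le hr.1 (Nat.le_of_lt_succ hr.2))
  have hmain := card_mul_value_sub_value_average G
    (Finset.Ico (G.windowStart m price samp b y t) (t + 1)) (B := B)
    (π := fun r => (G.run m price samp b y r).strategy)
    (ξ := fun r => samp (G.run m price samp b y r)) hq
    (fun r hr => by rw [hB, ← hpop r hr]; exact isProfileOn_strategy r)
    (fun r hr => by rw [hB, ← hpop r hr]; exact hreg.exploresOn r)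
    (σ := σ) (σ' := (G.runMid m price samp b y t).average)
    (by rw [State.average, runMid_weight_eq]; rfl) hσ i hs
  have hcard : ((Finset.Ico (G.windowStart m price samp b y t) (t + 1)).card : ℝ) =
      (t : ℝ) + 1 - G.windowStart m price samp b y t := by
    rw [Nat.card_Ico, Nat.cast_sub ((windowStart_le t).trans (Nat.le_succ t))]
    push_cast
    rfl
  rw [hcard] at hmain
  rw [hmain, restrictedSize_eq, ← hB]
  have htrue : ∀ s a, ∑ r ∈ Finset.Ico (G.windowStart m price samp b y t) (t + 1),
      G.trueRegret B (G.run m price samp b y r).strategy (samp (G.run m price samp b y r)) s a =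
      (G.runMid m price samp b y t).regret s a + G.noiseMid m price samp b y t s a := by
    intro s a
    rw [runMid_regret_eq, noiseMid, ← Finset.sum_add_distrib]
    refine Finset.sum_congr rfl fun r hr => ?_
    rw [hB, ← hpop r hr, iterTrueRegret]
    ring
  simp only [htrue]
  have hzero : ∀ s, s ∉ G.reachable B → ∀ a, (G.runMid m price samp b y t).regret s a +
      G.noiseMid m price samp b y t s a = 0 := by
    intro s hs a
    rw [← htrue]
    refine Finset.sum_eq_zero fun r hr => Finset.sum_eq_zero fun z _ => ?_
    rw [sampledRegret_eq_zero G _ hs, mul_zero]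
    rw [hB, ← hpop r hr]
    exact (hreg.exploresOn r).1
  rw [← Finset.sum_subset (Finset.subset_univ (G.reachable B)) fun s _ hs => by
    simp only [hzero s hs, mul_zero, Finset.sum_const_zero]]
  calc _ ≤ ∑ s ∈ G.reachable B, (2 * c) := by
        refine Finset.sum_le_sum fun s hs => ?_
        have h1 : ∑ a ∈ B s, σ s a * ((G.runMid m price samp b y t).regret s a +
            G.noiseMid m price samp b y t s a) ≤ 2 * c := by
          calc _ ≤ ∑ a ∈ B s, σ s a * (2 * c) := by
                refine Finset.sum_le_sum fun a ha => mul_le_mul_of_nonneg_left ?_ ((hσ s).1 a)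
                linarith [hR s a ha hs, hD s a ha hs]
            _ = 2 * c := by rw [← Finset.sum_mul, (hσ s).2.2, one_mul]
        calc _ ≤ G.infosetReach σ s * (2 * c) :=
              mul_le_mul_of_nonneg_left h1 (infosetReach_nonneg G (fun s => (hσ s).1) s)
          _ ≤ 1 * (2 * c) :=
              mul_le_mul_of_nonneg_right (infosetReach_le_one G hσ s) (by linarith)
          _ = 2 * c := one_mul _
    _ = 2 * c * (G.reachable B).card := by simp [mul_comm]

/-! ### The concentration potential -/

/-- The exponential potential of a window. In window `j` with `X` information sets every pair of an
information set and an action has the initial weight `p / ((j + 1) (j + 2) X |A|)`, so that the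
window costs at most `p / ((j + 1) (j + 2))`; the term `p / (j + 2)` pays for all later windows.
The rate `l = e / (8 X K²)` is such that the compensator `2 l² K² n` is half of `l` times the
barrier `e n / (2 X)` for the noise. -/
def potential (K e p : ℝ) (S : G.State) (D : I → A → ℝ) (n : ℝ) : ℝ :=
  (∑ s ∈ G.reachable (G.restrictedActions S.pop), ∑ a ∈ G.restrictedActions S.pop s,
    p / ((S.window + 1) * (S.window + 2)) / (G.restrictedSize S.pop * G.numActions) *
      Real.exp (e / (8 * G.restrictedSize S.pop * K ^ 2) * D s a -
        2 * (e / (8 * G.restrictedSize S.pop * K ^ 2)) ^ 2 * K ^ 2 * n)) + p / (S.window + 2)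

lemma potential_nonneg (K e : ℝ) {p : ℝ} (hp : 0 ≤ p) (S : G.State) (D : I → A → ℝ) (n : ℝ) :
    0 ≤ potential K e p S D n := by
  unfold potential
  positivity

lemma potential_zero_le (K e : ℝ) {p : ℝ} (hp : 0 ≤ p) (S : G.State) :
    potential K e p S (fun _ _ => 0) 0 ≤ p / (S.window + 1) := by
  set c := p / ((S.window + 1 : ℝ) * (S.window + 2)) with hc
  have hc0 : 0 ≤ c := by positivity
  have h1 : (∑ s ∈ G.reachable (G.restrictedActions S.pop), ∑ a ∈ G.restrictedActions S.pop s,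
      c / (G.restrictedSize S.pop * G.numActions)) ≤ c := by
    calc _ ≤ ∑ s ∈ G.reachable (G.restrictedActions S.pop),
          (G.numActions : ℝ) * (c / (G.restrictedSize S.pop * G.numActions)) := by
          refine Finset.sum_le_sum fun s _ => ?_
          rw [Finset.sum_const, nsmul_eq_mul]
          refine mul_le_mul_of_nonneg_right ?_ (by positivity)
          exact_mod_cast card_restrictedActions_le S.pop s
      _ = ((G.restrictedSize S.pop : ℝ) * G.numActions) *
          (c / (G.restrictedSize S.pop * G.numActions)) := by
          rw [Finset.sum_const, nsmul_eq_mul, restrictedSize_eq]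
          ring
      _ ≤ c := by
          by_cases h0 : (G.restrictedSize S.pop : ℝ) * G.numActions = 0
          · rw [h0, zero_mul]
            exact hc0
          · rw [mul_div_cancel₀ _ h0]
  have h2 : c + p / (S.window + 2) = p / (S.window + 1) := by
    rw [hc]
    have : (0 : ℝ) < S.window + 1 := by positivity
    have : (0 : ℝ) < S.window + 2 := by positivity
    field_simp
    ring
  rw [← h2, potential]
  simpa [← hc] using h1

lemma potential_congr {K e p : ℝ} {S S' : G.State} (hw : S.window = S'.window)
    (hP : S.pop = S'.pop) (D : I → A → ℝ) (n : ℝ) :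
    potential K e p S D n = potential K e p S' D n := by
  simp only [potential, hw, hP]

/-- The start of a new window does not increase the potential. -/
lemma potential_run_succ_le (K e : ℝ) {p : ℝ} (hp : 0 ≤ p) (t : ℕ) :
    potential K e p (G.run m price samp b y (t + 1)) (G.noise m price samp b y (t + 1))
      ((t + 1 : ℕ) - G.windowStart m price samp b y (t + 1)) ≤
    potential K e p (G.run m price samp b y t) (G.noiseMid m price samp b y t)
      ((t : ℝ) + 1 - G.windowStart m price samp b y t) := by
  by_cases h : (G.run m price samp b y (t + 1)).window = (G.run m price samp b y t).window
  · rw [potential_congr h (run_pop_eq (Nat.le_succ t) h.symm).symm,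
      windowStart_eq_of_window_eq (Nat.le_succ t) h.symm]
    have : G.noise m price samp b y (t + 1) = G.noiseMid m price samp b y t := by
      ext s a
      rw [noise, noiseMid, windowStart_eq_of_window_eq (Nat.le_succ t) h.symm]
    rw [this]
    push_cast
    rfl
  · have h1 : G.noise m price samp b y (t + 1) = fun _ _ => 0 := by
      ext s a
      rw [noise, windowStart_succ_of_ne h]
      simp
    rw [h1, windowStart_succ_of_ne h, sub_self]
    refine (potential_zero_le K e hp _).trans ?_
    rw [(run_succ_of_window_ne h).1, potential]
    have : (((G.run m price samp b y t).window + 1 : ℕ) : ℝ) + 1 =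
      (G.run m price samp b y t).window + 2 := by push_cast; ring
    rw [this]
    refine le_add_of_nonneg_left (Finset.sum_nonneg fun s _ => Finset.sum_nonneg fun a _ => ?_)
    positivity

/-- Sampling does not increase the potential in the mean. -/
lemma sum_sampleProb_mul_potential_le {K e p q₀ Δ : ℝ} (hq : 0 < q₀) (hΔ0 : 0 < Δ)
    (hΔ : ∀ z ∈ G.terminal, |G.payoff z| ≤ Δ) (hK : K = Δ / q₀) (hp : 0 ≤ p) (t : ℕ)
    (hexp : G.Explores q₀ (G.run m price samp b y t) (samp (G.run m price samp b y t)))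
    (h1 : ∑ z ∈ G.terminal, G.sampleProb (samp (G.run m price samp b y t)) z = 1) :
    ∑ z ∈ G.terminal, G.sampleProb (samp (G.run m price samp b y t)) z *
      potential K e p (G.run m price samp b (Function.update y t z) t)
        (G.noiseMid m price samp b (Function.update y t z) t)
        ((t : ℝ) + 1 - G.windowStart m price samp b (Function.update y t z) t) ≤
    potential K e p (G.run m price samp b y t) (G.noise m price samp b y t)
      (t - G.windowStart m price samp b y t) := by
  have hK0 : 0 < K := hK ▸ by positivity
  have hupd : ∀ z, ∀ r < t, Function.update y t z r = y r := fun z r hr =>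
    Function.update_of_ne hr.ne _ _
  have hrun : ∀ z, ∀ r ≤ t, G.run m price samp b (Function.update y t z) r =
      G.run m price samp b y r := fun z r hr =>
    run_congr (fun _ _ => rfl) fun r' hr' => hupd z r' (hr'.trans_le hr)
  have hws : ∀ z, G.windowStart m price samp b (Function.update y t z) t =
      G.windowStart m price samp b y t := fun z =>
    windowStart_congr (fun _ _ => rfl) (hupd z)
  set S := G.run m price samp b y t with hS
  set ξ := samp S with hξ
  set B := G.restrictedActions S.pop with hB
  set r : List A → I → A → ℝ := fun z => G.sampledRegret B S.strategy ξ z with hr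
  set l := e / (8 * G.restrictedSize S.pop * K ^ 2) with hl
  set n : ℝ := t - G.windowStart m price samp b y t with hn
  have hn1 : (t : ℝ) + 1 - G.windowStart m price samp b y t = n + 1 := by rw [hn]; ring
  set D := G.noise m price samp b y t with hD
  have hmid : ∀ z s a, G.noiseMid m price samp b (Function.update y t z) t s a =
      D s a + (∑ z' ∈ G.terminal, G.sampleProb ξ z' * r z' s a - r z s a) := by
    intro z s a
    rw [noiseMid_eq]
    congr 1
    · rw [hD, noise, noise, hws]
      refine Finset.sum_congr rfl fun r' hr' => ?_
      have hlt := (Finset.mem_Ico.mp hr').2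
      rw [iterTrueRegret, iterRegret, hrun z r' hlt.le, hupd z r' hlt]
      rfl
    · rw [iterTrueRegret, iterRegret, hrun z t le_rfl, Function.update_self, trueRegret]
      congr 1
      refine Finset.sum_congr rfl fun z' hz' => ?_
      rw [sampleProb, if_pos hz']
  simp only [hrun _ t le_rfl, hws, hn1]
  simp only [potential, ← hS, ← hB, ← hl]
  set c := p / ((S.window + 1 : ℝ) * (S.window + 2)) / (G.restrictedSize S.pop * G.numActions)
    with hc
  have hc0 : 0 ≤ c := by positivity
  have hP0 : ∀ z ∈ G.terminal, 0 ≤ G.sampleProb ξ z := by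
    intro z hz
    rw [sampleProb, if_pos hz]
    exact reach_nonneg G (fun s => (hexp.1 s).1) z
  simp only [mul_add, Finset.sum_add_distrib, ← Finset.sum_mul, h1, one_mul]
  refine add_le_add ?_ le_rfl
  simp only [Finset.mul_sum]
  rw [Finset.sum_comm]
  refine Finset.sum_le_sum fun s _ => ?_
  rw [Finset.sum_comm]
  refine Finset.sum_le_sum fun a _ => ?_
  have hoe := sum_mul_exp_mean_sub_le G.terminal (G.sampleProb ξ) (fun z => r z s a) hP0 h1 hK0
    (fun z hz => hK ▸ abs_sampledRegret_le G hq hΔ0.le hΔ (isProfileOn_strategy t)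
      ((explores_iff _ _ _).mp hexp) hz s a) l
  calc _ = c * Real.exp (l * D s a - 2 * l ^ 2 * K ^ 2 * (n + 1)) *
        ∑ z ∈ G.terminal, G.sampleProb ξ z *
          Real.exp (l * (∑ z' ∈ G.terminal, G.sampleProb ξ z' * r z' s a - r z s a)) := by
        rw [Finset.mul_sum]
        refine Finset.sum_congr rfl fun z _ => ?_
        rw [hmid, mul_add, add_sub_right_comm, Real.exp_add]
        ring_nf
    _ ≤ c * Real.exp (l * D s a - 2 * l ^ 2 * K ^ 2 * (n + 1)) *
        Real.exp (2 * l ^ 2 * K ^ 2) := mul_le_mul_of_nonneg_left hoe (by positivity)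
    _ = c * Real.exp (l * D s a - 2 * l ^ 2 * K ^ 2 * n) := by
        rw [mul_assoc, ← Real.exp_add]
        congr 2
        ring

/-! ### The regret time of a window -/

lemma State.half_le_logFactor (S : G.State) {p : ℝ} (hp : 0 < p) : 1 / 2 ≤ S.logFactor p := by
  have h1 : Real.log 2 ≤ S.logFactor p := by
    refine Real.log_le_log two_pos ?_
    have : 0 ≤ (S.numWindows * G.numActions * S.finalSize : ℝ) / p := by positivity
    linarith
  linarith [Real.log_two_gt_d9]

/-- The number of iterations after which the last-window average is an `e`-equilibrium of the
restricted game, if the sampled regrets are at most `K`: the noise per information set is then at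
most `e / (2 X)` times the age of the window, and so are the sampled regrets. -/
def State.regretTime (S : G.State) (K e p : ℝ) : ℝ :=
  64 * S.logFactor p * K ^ 2 * G.numActions * S.finalSize ^ 2 / e ^ 2

lemma State.regretTime_nonneg (S : G.State) (K e : ℝ) {p : ℝ} (hp : 0 < p) :
    0 ≤ S.regretTime K e p := by
  have := S.half_le_logFactor hp
  have : 0 ≤ S.logFactor p := by linarith
  unfold regretTime
  positivity

lemma one_le_numActions (s : I) : 1 ≤ G.numActions :=
  (G.actions_nonempty s).card_pos.trans_le
    (Finset.le_sup (f := fun s => (G.actions s).card) (Finset.mem_univ s))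

/-- The union bound over windows, information sets and actions costs a logarithm. -/
lemma log_inv_weight_le (S : G.State) {p : ℝ} (hp : 0 < p) (hp1 : p ≤ 1)
    (hX : 1 ≤ G.restrictedSize S.pop) (hA : 1 ≤ G.numActions) :
    Real.log (p / ((S.window + 1) * (S.window + 2)) /
      (G.restrictedSize S.pop * G.numActions))⁻¹ ≤ 2 * S.logFactor p := by
  set Y : ℝ := 2 + (S.numWindows * G.numActions * S.finalSize : ℝ) / p with hY
  have hX' : (1 : ℝ) ≤ G.restrictedSize S.pop := by exact_mod_cast hX
  have hA' : (1 : ℝ) ≤ G.numActions := by exact_mod_cast hA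
  have hk : (S.numWindows : ℝ) = S.window + 1 := by simp [State.numWindows]
  have hw : (0 : ℝ) ≤ S.window := by positivity
  have h1 : (S.window + 1 : ℝ) * G.numActions * G.restrictedSize S.pop / p ≤ Y := by
    rw [hY, hk, State.finalSize]
    linarith
  have h2 : (S.window + 2 : ℝ) ≤ Y := by
    have h3 : (S.window + 1 : ℝ) ≤
        (S.window + 1 : ℝ) * G.numActions * G.restrictedSize S.pop / p := by
      rw [le_div_iff₀ hp]
      calc (S.window + 1 : ℝ) * p ≤ (S.window + 1 : ℝ) * 1 * 1 := by
            rw [mul_one]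
            exact mul_le_mul_of_nonneg_left hp1 (by linarith)
        _ ≤ _ := by gcongr
    rw [hY, hk, State.finalSize]
    linarith
  have hL : 2 * S.logFactor p = Real.log (Y ^ 2) := by
    rw [Real.log_pow]
    rfl
  rw [hL]
  refine Real.log_le_log (by positivity) ?_
  calc (p / ((S.window + 1 : ℝ) * (S.window + 2)) / (G.restrictedSize S.pop * G.numActions))⁻¹
      = (S.window + 1 : ℝ) * G.numActions * G.restrictedSize S.pop / p * (S.window + 2) := by
        field_simp
    _ ≤ Y * Y := mul_le_mul h1 h2 (by linarith) (le_trans (by linarith) h2)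
    _ = Y ^ 2 := by ring

/-- As long as the potential is less than `1`, the noise is below its linear barrier once the
regret time of the window has passed. -/
lemma noise_le_of_potential_lt_one {K e p n : ℝ} (hK : 0 < K) (he : 0 < e) (hp : 0 < p)
    (hp1 : p ≤ 1) (S : G.State) (D : I → A → ℝ) (hlt : potential K e p S D n < 1)
    (hn : S.regretTime K e p ≤ n) {s : I} (hs : s ∈ G.reachable (G.restrictedActions S.pop))
    {a : A} (ha : a ∈ G.restrictedActions S.pop s) :
    D s a ≤ e / (2 * G.restrictedSize S.pop) * n := by
  have hX : 1 ≤ G.restrictedSize S.pop := by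
    rw [restrictedSize_eq]
    exact Finset.card_pos.mpr ⟨s, hs⟩
  have hA : 1 ≤ G.numActions := one_le_numActions s
  have hlog := log_inv_weight_le S hp hp1 hX hA
  have hX' : (1 : ℝ) ≤ G.restrictedSize S.pop := by exact_mod_cast hX
  have hA' : (1 : ℝ) ≤ G.numActions := by exact_mod_cast hA
  have hL0 : 0 ≤ S.logFactor p := by linarith [S.half_le_logFactor hp]
  rw [potential] at hlt
  rw [State.regretTime, State.finalSize] at hn
  set X : ℝ := (G.restrictedSize S.pop : ℝ) with hXdef
  set c := p / ((S.window + 1 : ℝ) * (S.window + 2)) / (X * G.numActions) with hc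
  have hc0 : 0 < c := by positivity
  set l := e / (8 * X * K ^ 2) with hl
  have hl0 : 0 < l := by positivity
  have h1 : c * Real.exp (l * D s a - 2 * l ^ 2 * K ^ 2 * n) < 1 := by
    refine lt_of_le_of_lt ?_ hlt
    have h2 : c * Real.exp (l * D s a - 2 * l ^ 2 * K ^ 2 * n) ≤
        ∑ a ∈ G.restrictedActions S.pop s,
          c * Real.exp (l * D s a - 2 * l ^ 2 * K ^ 2 * n) :=
      Finset.single_le_sum (f := fun a => c * Real.exp (l * D s a - 2 * l ^ 2 * K ^ 2 * n))
        (fun a _ => by positivity) ha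
    have h3 := Finset.single_le_sum (f := fun s => ∑ a ∈ G.restrictedActions S.pop s,
          c * Real.exp (l * D s a - 2 * l ^ 2 * K ^ 2 * n))
        (fun s _ => Finset.sum_nonneg fun a _ => by positivity) hs
    have h4 : 0 ≤ p / (S.window + 2 : ℝ) := by positivity
    linarith
  have h5 : l * D s a - 2 * l ^ 2 * K ^ 2 * n ≤ 2 * S.logFactor p := by
    refine le_trans ?_ hlog
    rw [Real.le_log_iff_exp_le (inv_pos.mpr hc0), ← one_div, le_div_iff₀ hc0, mul_comm]
    exact h1.le
  have h6 : 2 * S.logFactor p ≤ 2 * l ^ 2 * K ^ 2 * n := by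
    have h7 : 2 * l ^ 2 * K ^ 2 * (64 * S.logFactor p * K ^ 2 * G.numActions * X ^ 2 / e ^ 2) =
        2 * S.logFactor p * G.numActions := by
      rw [hl]
      field_simp
      ring
    calc 2 * S.logFactor p ≤ 2 * S.logFactor p * G.numActions :=
          le_mul_of_one_le_right (by linarith) hA'
      _ = _ := h7.symm
      _ ≤ _ := mul_le_mul_of_nonneg_left hn (by positivity)
  -- the barrier exceeds the compensator by the logarithm of the inverse initial weight
  have h8 : e / (2 * X) = 4 * l * K ^ 2 := by
    rw [hl]
    field_simp
    ring
  rw [h8]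
  refine le_of_mul_le_mul_left ?_ hl0
  nlinarith

/-- As long as the potential is less than `1`, the last-window average is an `e`-equilibrium of the
restricted game once the regret time of the window has passed. -/
lemma value_sub_le_of_potential_lt_one {K e p q₀ Δ : ℝ} (hq : 0 < q₀) (hΔ0 : 0 < Δ)
    (hΔ : ∀ z ∈ G.terminal, |G.payoff z| ≤ Δ) (hK : K = Δ / q₀) (he : 0 < e) (hp : 0 < p)
    (hp1 : p ≤ 1) (hreg : G.IsRegular m price samp q₀ b y) (t : ℕ)
    (hlt : potential K e p (G.run m price samp b y t) (G.noiseMid m price samp b y t)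
      ((t : ℝ) + 1 - G.windowStart m price samp b y t) < 1)
    (hn : (G.run m price samp b y t).regretTime K e p ≤
      (t : ℝ) + 1 - G.windowStart m price samp b y t)
    {i : Fin 2} {σ : I → A → ℝ}
    (hσ : IsProfileOn (G.restrictedActions (G.run m price samp b y t).pop) σ)
    (hs : ∀ s, G.owner s ≠ i → σ s = (G.runMid m price samp b y t).average s) :
    G.value σ i - G.value (G.runMid m price samp b y t).average i ≤ e := by
  have hK0 : 0 < K := hK ▸ by positivity
  set n : ℝ := (t : ℝ) + 1 - G.windowStart m price samp b y t with hndef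
  set X : ℝ := (G.restrictedSize (G.run m price samp b y t).pop : ℝ) with hX
  have hn0 : 0 < n := by
    have : (G.windowStart m price samp b y t : ℝ) ≤ t := by exact_mod_cast windowStart_le t
    rw [hndef]
    linarith
  have hsq := sum_sq_runMid_regret_le
    (fun t s a => hK ▸ hreg.abs_iterRegret_le hq hΔ0.le hΔ t s a) t
  have hmain := card_mul_value_sub_le (c := e / (2 * X) * n) hq hreg t ?_ ?_ (by positivity) hσ hs
  · refine le_of_mul_le_mul_left (hmain.trans ?_) hn0
    rw [← hX]
    by_cases hX0 : X = 0
    · rw [hX0]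
      simp only [mul_zero, div_zero, zero_mul]
      positivity
    · refine le_of_eq ?_
      field_simp
      exact hndef
  · intro s a ha hsr
    have hX1 : (1 : ℝ) ≤ X := by
      rw [hX, restrictedSize_eq]
      exact_mod_cast Finset.card_pos.mpr ⟨s, hsr⟩
    have hc0 : 0 ≤ e / (2 * X) * n := by positivity
    have h1 : max 0 ((G.runMid m price samp b y t).regret s a) ^ 2 ≤
        n * (G.numActions * K ^ 2) := by
      refine (Finset.single_le_sum (f := fun a =>
        max 0 ((G.runMid m price samp b y t).regret s a) ^ 2)
        (fun a _ => sq_nonneg _) ha).trans ((hsq s).trans ?_)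
      refine mul_le_mul_of_nonneg_left ?_ hn0.le
      refine mul_le_mul_of_nonneg_right ?_ (sq_nonneg _)
      exact_mod_cast card_restrictedActions_le _ s
    have h2 : n * (G.numActions * K ^ 2) ≤ (e / (2 * X) * n) ^ 2 := by
      have h3 : 4 * K ^ 2 * G.numActions * X ^ 2 / e ^ 2 ≤ n := by
        refine le_trans ?_ hn
        rw [State.regretTime, State.finalSize, ← hX]
        have hL := (G.run m price samp b y t).half_le_logFactor hp
        have h5 : 4 * K ^ 2 ≤ 64 * (G.run m price samp b y t).logFactor p * K ^ 2 := by
          have : 0 < K ^ 2 := by positivity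
          nlinarith
        gcongr
      have h4 : (e / (2 * X) * n) ^ 2 = n * (e ^ 2 / (4 * X ^ 2) * n) := by
        field_simp
        ring
      rw [h4]
      refine mul_le_mul_of_nonneg_left ?_ hn0.le
      calc (G.numActions * K ^ 2 : ℝ) =
            e ^ 2 / (4 * X ^ 2) * (4 * K ^ 2 * G.numActions * X ^ 2 / e ^ 2) := by
            field_simp
        _ ≤ _ := mul_le_mul_of_nonneg_left h3 (by positivity)
    exact (le_max_right _ _).trans ((le_abs_self _).trans (abs_le_of_sq_le_sq (h1.trans h2) hc0))
  · intro s a ha hsr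
    exact noise_le_of_potential_lt_one hK0 he hp hp1 _ _ hlt hn hsr ha

end Window

/-! ### Termination and cost -/

section Cost

variable {G : EFG A I} {m : ℕ → G.Population → ℕ} {price : G.Population → ℕ}
  {samp : G.State → I → A → ℝ} {b : ℕ → G.Response} {y : ℕ → List A}

/-- In every window the last-window average is an `e`-equilibrium of the restricted game once the
regret time of the window has passed. -/
def Converges (G : EFG A I) (m : ℕ → G.Population → ℕ) (price : G.Population → ℕ)
    (samp : G.State → I → A → ℝ) (K e p : ℝ) (b : ℕ → G.Response) (y : ℕ → List A) : Prop :=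
  ∀ t, (G.run m price samp b y t).regretTime K e p ≤
      (t : ℝ) + 1 - G.windowStart m price samp b y t →
    ∀ i σ, IsProfileOn (G.restrictedActions (G.run m price samp b y t).pop) σ →
      (∀ s, G.owner s ≠ i → σ s = (G.runMid m price samp b y t).average s) →
      G.value σ i - G.value (G.runMid m price samp b y t).average i ≤ e

lemma regretTime_mono {S S' : G.State} (hw : S.window ≤ S'.window)
    (hP : ∀ i, S.pop i ⊆ S'.pop i) (K e : ℝ) {p : ℝ} (hp : 0 < p) :
    S.regretTime K e p ≤ S'.regretTime K e p := by
  have hX : (S.finalSize : ℝ) ≤ S'.finalSize := by exact_mod_cast restrictedSize_mono hP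
  have hL : S.logFactor p ≤ S'.logFactor p := by
    refine Real.log_le_log (by positivity) ?_
    have : (S.numWindows : ℝ) ≤ S'.numWindows := by exact_mod_cast Nat.succ_le_succ hw
    gcongr
  have hL0 : 0 ≤ S.logFactor p := by linarith [S.half_le_logFactor hp]
  have hL0' : 0 ≤ S'.logFactor p := hL0.trans hL
  unfold State.regretTime
  gcongr

/-- A window ends by the first multiple of the frequency after its regret time. -/
lemma sub_windowStart_lt {K e δ p : ℝ} (hp : 0 < p) (hm : ∀ j P, 0 < m j P)
    (hconv : G.Converges m price samp K e p b y) {T : ℕ}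
    (hn : ∀ r < T, ¬ G.IsNash (e + δ) (G.runMid m price samp b y r).average)
    (hgood : ∀ r < T, G.GoodResponse m price samp δ b y (r + 1)) {t : ℕ} (ht : t ≤ T) :
    (t : ℝ) - G.windowStart m price samp b y t <
      (G.run m price samp b y t).regretTime K e p +
        m (G.run m price samp b y t).window (G.run m price samp b y t).pop := by
  by_contra! hcon
  set q := m (G.run m price samp b y t).window (G.run m price samp b y t).pop with hq
  set N := (G.run m price samp b y t).regretTime K e p with hN
  have hN0 : 0 ≤ N := State.regretTime_nonneg _ K e hp
  have hq0 : 0 < q := hm _ _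
  set a := G.windowStart m price samp b y t with ha
  -- the last multiple of `q` that is at most `t`
  set t₁ := q * (t / q) with ht₁
  have h1 : t < t₁ + q := by
    have := Nat.div_add_mod t q
    have := Nat.mod_lt t hq0
    omega
  have h1' : t₁ ≤ t := Nat.mul_div_le t q
  have h2 : N + a < t₁ := by
    have : (t : ℝ) < t₁ + q := by exact_mod_cast h1
    linarith
  have h3 : a < t₁ := by
    have : (a : ℝ) < t₁ := by linarith
    exact_mod_cast this
  obtain ⟨r, hr⟩ : ∃ r, t₁ = r + 1 := ⟨t₁ - 1, by omega⟩
  have har : a ≤ r := by omega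
  have hrt : r + 1 ≤ t := by omega
  have hw := window_eq_of_windowStart_le har (Nat.le_of_succ_le hrt)
  have hw' := window_eq_of_windowStart_le (Nat.le_succ_of_le har) hrt
  have hpop := run_pop_eq (Nat.le_of_succ_le hrt) hw
  have hstart : G.windowStart m price samp b y r = a :=
    (windowStart_eq_of_window_eq (Nat.le_of_succ_le hrt) hw).symm
  have hNr : (G.run m price samp b y r).regretTime K e p ≤ N :=
    regretTime_mono hw.le (fun i => by rw [hpop]) K e hp
  have h4 : (G.run m price samp b y r).regretTime K e p ≤
      (r : ℝ) + 1 - G.windowStart m price samp b y r := by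
    have : (t₁ : ℝ) = r + 1 := by rw [hr]; push_cast; rfl
    rw [hstart]
    linarith
  have h5 := window_succ_of_not_isNash (hconv r h4)
    (by rw [hw, hpop, ← hr]; exact Dvd.intro _ rfl) (hgood r (by omega)) (hn r (by omega))
  simp only [Nat.succ_eq_add_one] at hw'
  omega

/-- There are finitely many windows, each of which is finite, so the algorithm terminates. -/
lemma exists_isNash {K e δ p : ℝ} (hp : 0 < p) (hm : ∀ j P, 0 < m j P)
    (hconv : G.Converges m price samp K e p b y)
    (hgood : ∀ t, (∀ r < t, ¬ G.IsNash (e + δ) (G.runMid m price samp b y r).average) →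
      G.GoodResponse m price samp δ b y t) :
    ∃ t, G.IsNash (e + δ) (G.runMid m price samp b y t).average := by
  by_contra! hcon
  have hage : ∀ t, _ := fun t => sub_windowStart_lt (t := t) hp hm hconv (fun r _ => hcon r)
    (fun r _ => hgood _ fun r' _ => hcon r') le_rfl
  -- the window index is bounded, so it is maximal from some `t₀` on, and that window never ends
  set t₀ := Function.argmin fun t =>
    ∑ i, Fintype.card (G.Pure i) - (G.run m price samp b y t).window with ht₀
  have hmax : ∀ t, (G.run m price samp b y t).window ≤ (G.run m price samp b y t₀).window := by
    intro t
    have h1 := Function.argmin_le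
      (fun t => ∑ i, Fintype.card (G.Pure i) - (G.run m price samp b y t).window) t
    have h2 := run_window_lt (G := G) (m := m) (price := price) (samp := samp) (b := b) (y := y) t
    simp only [← ht₀] at h1
    omega
  obtain ⟨n, hn⟩ := exists_nat_gt ((G.run m price samp b y t₀).regretTime K e p +
    m (G.run m price samp b y t₀).window (G.run m price samp b y t₀).pop)
  have hle : t₀ ≤ t₀ + n := Nat.le_add_right _ _
  have hw : (G.run m price samp b y t₀).window = (G.run m price samp b y (t₀ + n)).window :=
    le_antisymm (run_window_mono hle) (hmax _)
  have h1 := hage (t₀ + n)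
  rw [windowStart_eq_of_window_eq hle hw, ← hw, ← run_pop_eq hle hw] at h1
  have h2 : (G.run m price samp b y (t₀ + n)).regretTime K e p ≤
      (G.run m price samp b y t₀).regretTime K e p :=
    regretTime_mono hw.ge (fun i => by rw [run_pop_eq hle hw]) K e hp
  have h3 : (G.windowStart m price samp b y t₀ : ℝ) ≤ t₀ := by exact_mod_cast windowStart_le t₀
  push_cast at h1
  linarith

/-- The cost of an iteration: a trajectory, and a round of responses if the iteration number is a
multiple of the frequency, which is when the integer quotient increases. -/
lemma run_cost_succ_le (t : ℕ) (hy : (y t).length ≤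
      G.restrictedHorizon (G.run m price samp b y t).pop) :
    ((G.run m price samp b y (t + 1)).cost : ℝ) ≤ (G.run m price samp b y t).cost +
      G.restrictedHorizon (G.run m price samp b y t).pop +
      price (G.run m price samp b y t).pop *
        (((t + 1) / m (G.run m price samp b y t).window (G.run m price samp b y t).pop : ℕ) -
        (t / m (G.run m price samp b y t).window (G.run m price samp b y t).pop : ℕ)) := by
  set q := m (G.run m price samp b y t).window (G.run m price samp b y t).pop
  have hmid : ((G.runMid m price samp b y t).cost : ℝ) ≤ (G.run m price samp b y t).cost +
      G.restrictedHorizon (G.run m price samp b y t).pop := by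
    have : (G.runMid m price samp b y t).cost =
      (G.run m price samp b y t).cost + (y t).length := rfl
    rw [this]
    exact_mod_cast Nat.add_le_add_left hy _
  have hdvd : q ∣ t + 1 → (((t + 1) / q : ℕ) : ℝ) - (t / q : ℕ) = 1 := by
    intro h
    rw [Nat.succ_div, if_pos h]
    push_cast
    ring
  have hmono : (0 : ℝ) ≤ ((t + 1) / q : ℕ) - (t / q : ℕ) := by
    rw [sub_nonneg]
    exact_mod_cast Nat.div_le_div_right (Nat.le_succ t)
  rcases run_succ_cases (G := G) (m := m) (price := price) (samp := samp) (b := b) (y := y) t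
    with h | h | h
  · rw [h.2]
    have : (0 : ℝ) ≤ price (G.run m price samp b y t).pop *
      (((t + 1) / q : ℕ) - (t / q : ℕ)) := by positivity
    linarith
  · have hd := hdvd (by simpa [run_time] using h.1)
    rw [h.2.2, hd]
    push_cast
    linarith
  · have hd := hdvd (by simpa [run_time] using h.1)
    rw [h.2.2, hd]
    push_cast
    linarith

/-- A bound for the cost of a window that ends at most `q + 1` iterations after its regret time
`N`, where `q` is its frequency. -/
def windowCost (m : ℕ → G.Population → ℕ) (price : G.Population → ℕ) (N : ℝ)
    (P : ℕ → G.Population) (j : ℕ) : ℝ :=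
  G.restrictedHorizon (P j) * (N + m j (P j) + 1) +
    price (P j) * ((N + m j (P j) + 1) / m j (P j) + 1)

lemma div_sub_div_le {a t q : ℕ} (hq : 0 < q) :
    ((t / q : ℕ) : ℝ) - (a / q : ℕ) ≤ ((t : ℝ) - a) / q + 1 := by
  have h1 : ((t / q : ℕ) : ℝ) ≤ (t : ℝ) / q := Nat.cast_div_le
  have h2 : (a : ℝ) / q ≤ (a / q : ℕ) + 1 := by
    have hq' : (0 : ℝ) < q := by exact_mod_cast hq
    rw [div_le_iff₀ hq']
    have h3 := Nat.lt_div_mul_add (a := a) hq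
    have h4 : (a : ℝ) < (a / q : ℕ) * q + q := by exact_mod_cast h3
    linarith
  rw [sub_div]
  linarith

lemma current_window_cost_le (hm : ∀ j P, 0 < m j P) {N : ℝ} {t : ℕ}
    (hage : (t : ℝ) - G.windowStart m price samp b y t ≤
      N + m (G.run m price samp b y t).window (G.run m price samp b y t).pop) :
    G.restrictedHorizon (G.run m price samp b y t).pop *
        ((t : ℝ) + 1 - G.windowStart m price samp b y t) +
      price (G.run m price samp b y t).pop *
        (((t + 1) / m (G.run m price samp b y t).window (G.run m price samp b y t).pop : ℕ) -
        (G.windowStart m price samp b y t /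
          m (G.run m price samp b y t).window (G.run m price samp b y t).pop : ℕ)) ≤
    windowCost m price N (G.run m price samp b y t).pops (G.run m price samp b y t).window := by
  have hpop : (G.run m price samp b y t).pops (G.run m price samp b y t).window =
    (G.run m price samp b y t).pop := rfl
  rw [windowCost, hpop]
  set q := m (G.run m price samp b y t).window (G.run m price samp b y t).pop with hq
  have hq0 : 0 < q := hm _ _
  have h1 := div_sub_div_le (a := G.windowStart m price samp b y t) (t := t + 1) hq0
  refine add_le_add (mul_le_mul_of_nonneg_left ?_ (Nat.cast_nonneg _))
    (mul_le_mul_of_nonneg_left (h1.trans ?_) (Nat.cast_nonneg _))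
  · linarith
  · push_cast
    gcongr
    linarith

/-- The cost so far is at most that of the first round of responses, of the completed windows, and
of the completed part of the current one. -/
lemma run_cost_le (hm : ∀ j P, 0 < m j P) {N : ℝ} {T : ℕ}
    (hage : ∀ t ≤ T, (t : ℝ) - G.windowStart m price samp b y t ≤
      N + m (G.run m price samp b y t).window (G.run m price samp b y t).pop)
    (hy : ∀ t, (y t).length ≤ G.restrictedHorizon (G.run m price samp b y t).pop) {t : ℕ}
    (ht : t ≤ T) :
    ((G.run m price samp b y t).cost : ℝ) ≤ price ((G.run m price samp b y t).pops 0) +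
      ∑ j ∈ Finset.range (G.run m price samp b y t).window,
        windowCost m price N (G.run m price samp b y t).pops j +
      (G.restrictedHorizon (G.run m price samp b y t).pop *
        ((t : ℝ) - G.windowStart m price samp b y t) +
      price (G.run m price samp b y t).pop *
        ((t / m (G.run m price samp b y t).window (G.run m price samp b y t).pop : ℕ) -
        (G.windowStart m price samp b y t /
          m (G.run m price samp b y t).window (G.run m price samp b y t).pop : ℕ))) := by
  induction t with
  | zero => simp [run, init, windowStart]
  | succ t ih =>
    have ht' : t ≤ T := Nat.le_of_succ_le ht
    have h1 := ih ht'
    have h2 := run_cost_succ_le (m := m) (price := price) (samp := samp) (b := b) t (hy t)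
    have hp0 : (G.run m price samp b y (t + 1)).pops 0 = (G.run m price samp b y t).pops 0 :=
      run_pops_succ t (Nat.zero_le _)
    have hsum : ∑ j ∈ Finset.range (G.run m price samp b y t).window,
        windowCost m price N (G.run m price samp b y (t + 1)).pops j =
        ∑ j ∈ Finset.range (G.run m price samp b y t).window,
        windowCost m price N (G.run m price samp b y t).pops j := by
      refine Finset.sum_congr rfl fun j hj => ?_
      rw [windowCost, windowCost, run_pops_succ t (Finset.mem_range.mp hj).le]
    by_cases h : (G.run m price samp b y (t + 1)).window = (G.run m price samp b y t).window
    · rw [← run_pop_eq (Nat.le_succ t) h.symm, h, hp0, hsum,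
        windowStart_eq_of_window_eq (Nat.le_succ t) h.symm]
      push_cast
      linarith
    · have h3 := current_window_cost_le hm (hage t ht')
      rw [windowStart_succ_of_ne h, (run_succ_of_window_ne h).1, Finset.sum_range_succ, hsum, hp0]
      have h4 : windowCost m price N (G.run m price samp b y (t + 1)).pops
          (G.run m price samp b y t).window = windowCost m price N (G.run m price samp b y t).pops
          (G.run m price samp b y t).window := by
        rw [windowCost, windowCost, run_pops_succ t le_rfl]
      rw [h4]
      simp only [sub_self, mul_zero, add_zero]
      linarith

lemma run_pops_subset (t : ℕ) {j : ℕ} (hj : j ≤ (G.run m price samp b y t).window) (i : Fin 2) :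
    (G.run m price samp b y t).pops j i ⊆ (G.run m price samp b y t).pop i := by
  induction t with
  | zero => exact subset_rfl
  | succ t ih =>
    rcases Nat.lt_or_ge (G.run m price samp b y t).window j with h | h
    · have : j = (G.run m price samp b y (t + 1)).window := by
        rcases run_window_succ (G := G) (m := m) (price := price) (samp := samp) (b := b) (y := y) t
          with h' | h' <;> omega
      rw [this]
      exact subset_rfl
    · rw [run_pops_succ t h]
      exact (ih h).trans (run_pop_subset_succ t i)

lemma restrictedHorizon_le (P : G.Population) : G.restrictedHorizon P ≤ G.horizon :=
  Finset.sup_mono (Finset.filter_subset _ _)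

/-- The total cost in terms of the regret time `N` and a bound `R` for the cost of a round of
responses. -/
lemma run_cost_succ_le_of_price_le (hm : ∀ j P, 0 < m j P) {N R : ℝ} (hN : 0 ≤ N) (hR : 0 ≤ R)
    {T : ℕ}
    (hage : ∀ t ≤ T, (t : ℝ) - G.windowStart m price samp b y t ≤
      N + m (G.run m price samp b y t).window (G.run m price samp b y t).pop)
    (hy : ∀ t, (y t).length ≤ G.restrictedHorizon (G.run m price samp b y t).pop)
    (hprice : ∀ j ≤ (G.run m price samp b y T).window,
      (price ((G.run m price samp b y T).pops j) : ℝ) ≤ R) :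
    ((G.run m price samp b y (T + 1)).cost : ℝ) ≤
      (G.run m price samp b y T).numWindows * G.horizon * N +
      (∑ j ∈ Finset.range (G.run m price samp b y T).numWindows,
        (2 * (G.restrictedHorizon ((G.run m price samp b y T).pops j) *
          m j ((G.run m price samp b y T).pops j)) +
          R * N / m j ((G.run m price samp b y T).pops j))) +
      4 * ((G.run m price samp b y T).numWindows * R) := by
  have h1 := run_cost_le hm hage hy le_rfl
  have h2 := run_cost_succ_le (m := m) (price := price) (samp := samp) (b := b) T (hy T)
  have h3 := current_window_cost_le hm (hage T le_rfl)
  have h4 : ((G.run m price samp b y (T + 1)).cost : ℝ) ≤ R +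
      ∑ j ∈ Finset.range (G.run m price samp b y T).numWindows,
        windowCost m price N (G.run m price samp b y T).pops j := by
    rw [State.numWindows, Finset.sum_range_succ]
    linarith [hprice 0 (Nat.zero_le _)]
  have h5 : ∀ j ∈ Finset.range (G.run m price samp b y T).numWindows,
      windowCost m price N (G.run m price samp b y T).pops j ≤
      (2 * (G.restrictedHorizon ((G.run m price samp b y T).pops j) *
          m j ((G.run m price samp b y T).pops j)) +
          R * N / m j ((G.run m price samp b y T).pops j)) + (G.horizon * N + 3 * R) := by
    intro j hj
    have hj' := hprice j (Nat.le_of_lt_succ (Finset.mem_range.mp hj))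
    rw [windowCost]
    set P := (G.run m price samp b y T).pops j
    have hq : (1 : ℝ) ≤ m j P := by exact_mod_cast hm j P
    have hq0 : (0 : ℝ) < m j P := by linarith
    set q : ℝ := (m j P : ℝ)
    have hH : (G.restrictedHorizon P : ℝ) ≤ G.horizon := by exact_mod_cast restrictedHorizon_le P
    have hH0 : (0 : ℝ) ≤ G.restrictedHorizon P := Nat.cast_nonneg _
    have e1 : (G.restrictedHorizon P : ℝ) * (N + q + 1) ≤
        2 * (G.restrictedHorizon P * q) + G.horizon * N := by
      nlinarith [mul_le_mul_of_nonneg_right hH hN, mul_le_mul_of_nonneg_left hq hH0]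
    have e2 : (price P : ℝ) * ((N + q + 1) / q + 1) ≤ R * N / q + 3 * R := by
      calc (price P : ℝ) * ((N + q + 1) / q + 1) ≤ R * ((N + q + 1) / q + 1) := by
            refine mul_le_mul_of_nonneg_right hj' (by positivity)
        _ = R * N / q + R * (2 + 1 / q) := by
            field_simp
            ring
        _ ≤ R * N / q + R * 3 := by
            have : 1 / q ≤ 1 := by rwa [div_le_one hq0]
            gcongr
            linarith
        _ = _ := by ring
    linarith
  have h6 := Finset.sum_le_sum h5
  rw [Finset.sum_add_distrib] at h6
  simp only [Finset.sum_const, Finset.card_range, nsmul_eq_mul] at h6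
  have hk : (1 : ℝ) ≤ (G.run m price samp b y T).numWindows := by
    exact_mod_cast Nat.succ_le_succ (Nat.zero_le _)
  nlinarith [mul_le_mul_of_nonneg_right hk hR]

lemma one_le_horizon {B : I → Finset A} (h : (G.reachable B).Nonempty) : 1 ≤ G.horizon := by
  obtain ⟨s, -⟩ := h
  obtain ⟨h, hs⟩ := G.infoset_surj s
  obtain ⟨a, ha⟩ := G.actions_nonempty s
  rw [← G.avail_eq h s hs] at ha
  have hmem : h ++ [a] ∈ G.hist := by simpa [GameTree.avail] using ha
  refine le_trans ?_ (Finset.le_sup (f := List.length) hmem)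
  simp

/-- If no information set is reachable in the restricted game, it is the whole game. -/
lemma restrictedHorizon_eq_of_reachable_empty {P : G.Population}
    (h : G.reachable (G.restrictedActions P) = ∅) : G.restrictedHorizon P = G.horizon := by
  have key : ∀ h ∈ G.hist, G.StaysIn (G.restrictedActions P) h := by
    intro h'
    induction h' using List.reverseRecOn with
    | nil => exact fun _ n => n.elim0
    | append_singleton g a ih =>
      intro hg n s hs
      have hst := ih (G.prefix_mem g a hg)
      have hn := n.2
      simp only [List.length_append, List.length_singleton] at hn
      have hs' : s ∈ G.reachable (G.restrictedActions P) := by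
        simp only [reachable, Finset.mem_filter, Finset.mem_univ, true_and]
        refine ⟨g.take n, hst.take n, ?_⟩
        rwa [List.take_append_of_le_length (by omega)] at hs
      rw [h] at hs'
      exact absurd hs' (Finset.notMem_empty s)
  unfold restrictedHorizon horizon
  congr 1
  ext h'
  rw [mem_restrictedHist]
  exact ⟨fun h => h.1, fun h => ⟨h, key h' h⟩⟩

/-- A terminal history that is reached under the current strategy has to be sampled with
probability at least `q₀`. -/
lemma IsRegular.q_le_one {q₀ : ℝ} (h : G.IsRegular m price samp q₀ b y) : q₀ ≤ 1 := by
  obtain ⟨z, hz, hpos⟩ := exists_terminal_reach_pos G (restrictedActions_subset _)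
    (isProfileOn_strategy (m := m) (price := price) (samp := samp) (b := b) (y := y) 0)
  have hst := staysIn_of_reach_ne_zero G (isProfileOn_strategy 0) hpos.ne'
  rcases (h.exploresOn 0).2 0 z hz hst with h0 | h0
  · rw [← othersReach_mul_ownReach G 0, h0, zero_mul] at hpos
    exact absurd hpos (lt_irrefl _)
  · exact h0.trans (reach_le_one G (h.exploresOn 0).1 (Finset.mem_filter.mp hz).1)

lemma IsRegular.length_le {q₀ : ℝ} (h : G.IsRegular m price samp q₀ b y) (t : ℕ) :
    (y t).length ≤ G.restrictedHorizon (G.run m price samp b y t).pop :=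
  Finset.le_sup (f := List.length) (h.mem_restrictedHist t)

/-- The time of the first equilibrium, and the cost up to it in terms of the regret time of the last
window. -/
lemma exists_isLeast_isNash {K e δ p q₀ : ℝ} (hp : 0 < p) (hm : ∀ j P, 0 < m j P)
    (hreg : G.IsRegular m price samp q₀ b y)
    (hconv : G.Converges m price samp K e p b y)
    (hgood : ∀ t, (∀ r < t, ¬ G.IsNash (e + δ) (G.runMid m price samp b y r).average) →
      G.GoodResponse m price samp δ b y t) :
    ∃ τ, IsLeast {t | G.IsNash (e + δ) (G.runMid m price samp b y t).average} τ ∧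
      ∀ R : ℝ, 0 ≤ R → (∀ j ≤ (G.run m price samp b y τ).window,
        (price ((G.run m price samp b y τ).pops j) : ℝ) ≤ R) →
      ((G.run m price samp b y (τ + 1)).cost : ℝ) ≤
        (G.run m price samp b y τ).numWindows * G.horizon *
          (G.run m price samp b y τ).regretTime K e p +
        (∑ j ∈ Finset.range (G.run m price samp b y τ).numWindows,
          (2 * (G.restrictedHorizon ((G.run m price samp b y τ).pops j) *
            m j ((G.run m price samp b y τ).pops j)) +
            R * (G.run m price samp b y τ).regretTime K e p /
              m j ((G.run m price samp b y τ).pops j))) +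
        4 * ((G.run m price samp b y τ).numWindows * R) := by
  classical
  have hex := exists_isNash hp hm hconv hgood
  have hmin : ∀ r < Nat.find hex, ¬ G.IsNash (e + δ) (G.runMid m price samp b y r).average :=
    fun r hr => Nat.find_min hex hr
  refine ⟨Nat.find hex, ⟨Nat.find_spec hex, fun t ht => Nat.find_min' hex ht⟩,
    fun R hR hprice => ?_⟩
  refine run_cost_succ_le_of_price_le hm (State.regretTime_nonneg _ K e hp) hR (fun t ht => ?_)
    hreg.length_le hprice
  refine (sub_windowStart_lt hp hm hconv hmin
    (fun r hr => hgood _ fun r' hr' => hmin r' (by omega)) ht).le.trans ?_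
  exact add_le_add (regretTime_mono (run_window_mono ht) (run_pop_mono ht) K e hp) le_rfl

/-- The regret time of a single information set is at least of the order of one iteration, which
absorbs lower-order terms of the cost. -/
lemma one_le_four_mul {K e : ℝ} (he : 0 < e) (hK : e ≤ 2 * K) (S : G.State)
    (hX : 1 ≤ S.finalSize) :
    1 ≤ 4 * (K ^ 2 * (G.numActions * S.finalSize ^ 2) / e ^ 2) ∧
    (S.finalSize : ℝ) ≤ 4 * (K ^ 2 * (G.numActions * S.finalSize ^ 2) / e ^ 2) := by
  have hne : (G.reachable (G.restrictedActions S.pop)).Nonempty := by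
    rw [← Finset.card_pos, ← restrictedSize_eq]
    exact hX
  obtain ⟨s, -⟩ := hne
  have hA : (1 : ℝ) ≤ G.numActions := by exact_mod_cast one_le_numActions s
  have hX' : (1 : ℝ) ≤ S.finalSize := by exact_mod_cast hX
  have h1 : 1 ≤ 4 * (K ^ 2 / e ^ 2) := by
    rw [← mul_div_assoc, one_le_div (by positivity)]
    nlinarith
  have h2 : (S.finalSize : ℝ) ≤ G.numActions * S.finalSize ^ 2 := by nlinarith
  have h3 : 4 * (K ^ 2 * (G.numActions * S.finalSize ^ 2) / e ^ 2) =
      4 * (K ^ 2 / e ^ 2) * (G.numActions * S.finalSize ^ 2) := by ring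
  rw [h3]
  have h4 : (S.finalSize : ℝ) ≤ 4 * (K ^ 2 / e ^ 2) * (G.numActions * S.finalSize ^ 2) := by
    nlinarith
  exact ⟨hX'.trans h4, h4⟩

/-- The numerical step for oracle best responses. -/
lemma oracle_cost_le {K e p : ℝ} (hp : 0 < p) (he : 0 < e) (hK : e ≤ 2 * K) (S : G.State)
    (m : ℕ → G.Population → ℕ) :
    S.numWindows * G.horizon * S.regretTime K e p +
      (∑ j ∈ Finset.range S.numWindows,
        (2 * (G.restrictedHorizon (S.pops j) * m j (S.pops j)) +
          S.finalSize * S.regretTime K e p / m j (S.pops j))) +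
      4 * (S.numWindows * S.finalSize) ≤
    1000 * S.logFactor p ^ 1 * S.oracleBound m (K ^ 2) e := by
  have hL := S.half_le_logFactor hp
  set L := S.logFactor p with hLdef
  set Y : ℝ := K ^ 2 * (G.numActions * S.finalSize ^ 2) / e ^ 2 with hY
  have hY0 : 0 ≤ Y := by positivity
  have hN : S.regretTime K e p = 64 * L * Y := by
    rw [State.regretTime, hY, ← hLdef]
    ring
  have hkH : 4 * (S.numWindows * S.finalSize : ℝ) ≤ 16 * (S.numWindows * G.horizon * Y) := by
    rcases Nat.eq_zero_or_pos S.finalSize with h0 | h0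
    · rw [h0]
      simp only [Nat.cast_zero, mul_zero]
      positivity
    · have hH : (1 : ℝ) ≤ G.horizon := by
        refine Nat.one_le_cast.mpr (one_le_horizon (B := G.restrictedActions S.pop) ?_)
        rw [← Finset.card_pos, ← restrictedSize_eq]
        exact h0
      have h1 := (one_le_four_mul he hK S h0).2
      rw [← hY] at h1
      have h2 : (S.numWindows * S.finalSize : ℝ) ≤ S.numWindows * (G.horizon * (4 * Y)) := by
        refine mul_le_mul_of_nonneg_left ?_ (Nat.cast_nonneg _)
        nlinarith
      linarith
  have hb : S.oracleBound m (K ^ 2) e = S.numWindows * G.horizon * Y +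
      ∑ j ∈ Finset.range S.numWindows, ((G.restrictedHorizon (S.pops j) * m j (S.pops j) : ℝ) +
        S.finalSize * Y / m j (S.pops j)) := by
    rw [State.oracleBound, hY]
    congr 1
    · ring
    · refine Finset.sum_congr rfl fun j _ => ?_
      rw [div_mul_eq_div_div]
      ring
  rw [hb, hN, pow_one, mul_add, Finset.mul_sum]
  have hsum : (∑ j ∈ Finset.range S.numWindows,
        (2 * (G.restrictedHorizon (S.pops j) * m j (S.pops j)) +
          S.finalSize * (64 * L * Y) / m j (S.pops j))) ≤
      ∑ j ∈ Finset.range S.numWindows, 1000 * L *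
        ((G.restrictedHorizon (S.pops j) * m j (S.pops j) : ℝ) +
        S.finalSize * Y / m j (S.pops j)) := by
    refine Finset.sum_le_sum fun j _ => ?_
    have h1 : (0 : ℝ) ≤ G.restrictedHorizon (S.pops j) * m j (S.pops j) := by positivity
    have h2 : 0 ≤ S.finalSize * Y / (m j (S.pops j) : ℝ) := by positivity
    have h3 : S.finalSize * (64 * L * Y) / (m j (S.pops j) : ℝ) =
        64 * L * (S.finalSize * Y / (m j (S.pops j) : ℝ)) := by ring
    rw [h3]
    nlinarith
  have h4 : (0 : ℝ) ≤ S.numWindows * G.horizon * Y := by positivity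
  nlinarith

/-- The numerical step for approximate best responses. -/
lemma approx_cost_le {K e p : ℝ} (hp : 0 < p) (he : 0 < e) (hK : e ≤ 2 * K) (S : G.State)
    (hS : ∀ j ≤ S.window, ∀ i, S.pops j i ⊆ S.pop i)
    {m : ℕ → G.Population → ℕ} (hm : ∀ j P, 0 < m j P) :
    S.numWindows * G.horizon * S.regretTime K e p +
      (∑ j ∈ Finset.range S.numWindows,
        (2 * (G.restrictedHorizon (S.pops j) * m j (S.pops j)) +
          2 * G.horizon * S.regretTime K e p / m j (S.pops j))) +
      4 * (S.numWindows * (2 * G.horizon)) ≤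
    1000 * S.logFactor p ^ 1 * S.approxBound m (K ^ 2) e := by
  have hL := S.half_le_logFactor hp
  set L := S.logFactor p with hLdef
  set Y : ℝ := K ^ 2 * (G.numActions * S.finalSize ^ 2) / e ^ 2 with hY
  have hY0 : 0 ≤ Y := by positivity
  have hN : S.regretTime K e p = 64 * L * Y := by
    rw [State.regretTime, hY, ← hLdef]
    ring
  have hmpos : ∀ j P, (1 : ℝ) ≤ m j P := fun j P => by exact_mod_cast hm j P
  have hkH : (S.numWindows * G.horizon : ℝ) ≤ 4 * (S.numWindows * G.horizon * Y) +
      ∑ j ∈ Finset.range S.numWindows, (G.restrictedHorizon (S.pops j) * m j (S.pops j) : ℝ) := by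
    rcases Nat.eq_zero_or_pos S.finalSize with h0 | h0
    · have h1 : (S.numWindows * G.horizon : ℝ) ≤
          ∑ j ∈ Finset.range S.numWindows,
            (G.restrictedHorizon (S.pops j) * m j (S.pops j) : ℝ) := by
        calc (S.numWindows * G.horizon : ℝ) =
              ∑ j ∈ Finset.range S.numWindows, (G.horizon : ℝ) := by simp
          _ ≤ _ := by
            refine Finset.sum_le_sum fun j hj => ?_
            have hX : G.restrictedSize (S.pops j) = 0 := Nat.le_zero.mp
              ((restrictedSize_mono (hS j (Nat.le_of_lt_succ (Finset.mem_range.mp hj)))).trans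
                h0.le)
            rw [restrictedSize_eq, Finset.card_eq_zero] at hX
            rw [restrictedHorizon_eq_of_reachable_empty hX]
            exact le_mul_of_one_le_right (Nat.cast_nonneg _) (hmpos j _)
      have h2 : (0 : ℝ) ≤ S.numWindows * G.horizon * Y := by positivity
      linarith
    · have h1 := (one_le_four_mul he hK S h0).1
      rw [← hY] at h1
      have h2 : (0 : ℝ) ≤ S.numWindows * G.horizon := by positivity
      have h3 : (0 : ℝ) ≤ ∑ j ∈ Finset.range S.numWindows,
        (G.restrictedHorizon (S.pops j) * m j (S.pops j) : ℝ) :=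
        Finset.sum_nonneg fun j _ => by positivity
      nlinarith
  have hb : S.approxBound m (K ^ 2) e = S.numWindows * G.horizon * Y +
      ∑ j ∈ Finset.range S.numWindows, ((G.restrictedHorizon (S.pops j) * m j (S.pops j) : ℝ) +
        G.horizon * Y / m j (S.pops j)) := by
    rw [State.approxBound, hY]
    congr 1
    · ring
    · refine Finset.sum_congr rfl fun j _ => ?_
      rw [div_mul_eq_div_div]
      ring
  rw [hb, hN, pow_one]
  have hsplit1 : (∑ j ∈ Finset.range S.numWindows,
        (2 * (G.restrictedHorizon (S.pops j) * m j (S.pops j)) +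
          2 * G.horizon * (64 * L * Y) / m j (S.pops j))) =
      2 * (∑ j ∈ Finset.range S.numWindows,
        (G.restrictedHorizon (S.pops j) * m j (S.pops j) : ℝ)) +
      128 * L * ∑ j ∈ Finset.range S.numWindows, G.horizon * Y / (m j (S.pops j) : ℝ) := by
    rw [Finset.sum_add_distrib, Finset.mul_sum, Finset.mul_sum]
    congr 1
    refine Finset.sum_congr rfl fun j _ => by ring
  rw [hsplit1, Finset.sum_add_distrib]
  have h3 : (0 : ℝ) ≤ ∑ j ∈ Finset.range S.numWindows,
    (G.restrictedHorizon (S.pops j) * m j (S.pops j) : ℝ) :=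
    Finset.sum_nonneg fun j _ => by positivity
  have h5 : (0 : ℝ) ≤ ∑ j ∈ Finset.range S.numWindows, G.horizon * Y / (m j (S.pops j) : ℝ) :=
    Finset.sum_nonneg fun j _ => by positivity
  have h4 : (0 : ℝ) ≤ S.numWindows * G.horizon * Y := by positivity
  nlinarith

end Cost

/-! ### Random executions -/

section Execution

variable {G : EFG A I} {m : ℕ → G.Population → ℕ} {price : G.Population → ℕ}
  {samp : G.State → I → A → ℝ} {q₀ : ℝ} {Ω : Type w} [MeasurableSpace Ω] {μ : Measure Ω}
  [IsProbabilityMeasure μ] {β : ℕ → Ω → G.Response} {ζ : ℕ → Ω → List A}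

lemma response_nonempty (G : EFG A I) : Nonempty G.Response :=
  ⟨fun _ s => ⟨(G.actions_nonempty s.1).choose, (G.actions_nonempty s.1).choose_spec⟩⟩

lemma IsExecution.law' (h : G.IsExecution m price samp q₀ μ β ζ) (t : ℕ) (b : ℕ → G.Response)
    (y : ℕ → List A) (z : List A) :
    μ.real (pastEvent β ζ t b y ∩ {ω | ζ t ω = z}) =
      μ.real (pastEvent β ζ t b y) * G.sampleProb (samp (G.run m price samp b y t)) z :=
  h.law t b y z

lemma IsExecution.ae_isRegular (h : G.IsExecution m price samp q₀ μ β ζ) :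
    ∀ᵐ ω ∂μ, G.IsRegular m price samp q₀ (fun r => β r ω) (fun r => ζ r ω) := by
  have := response_nonempty G
  filter_upwards [h.explores, ae_law_ne_zero μ
    (fun t b y => G.sampleProb (samp (G.run m price samp b y t))) h.law'
    (fun t b b' y y' hb hy => by rw [run_congr hb hy])] with ω h1 h2
  exact fun t => ⟨h1 t, h2 t⟩

/-- The probability that the concentration potential ever reaches `1` is at most its initial value
`p`. -/
lemma IsExecution.measure_potential_le (h : G.IsExecution m price samp q₀ μ β ζ) {K e p Δ : ℝ}
    (hq : 0 < q₀) (hΔ0 : 0 < Δ) (hΔ : ∀ z ∈ G.terminal, |G.payoff z| ≤ Δ) (hK : K = Δ / q₀)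
    (hp : 0 ≤ p) :
    μ {ω | ∃ t, 1 ≤ potential K e p (G.run m price samp (fun r => β r ω) (fun r => ζ r ω) t)
      (G.noiseMid m price samp (fun r => β r ω) (fun r => ζ r ω) t)
      ((t : ℝ) + 1 - G.windowStart m price samp (fun r => β r ω) (fun r => ζ r ω) t)} ≤
    ENNReal.ofReal p := by
  have := response_nonempty G
  refine measure_exists_one_le μ h.measurable_response h.measurable_sample G.terminal
    (fun t b y => G.sampleProb (samp (G.run m price samp b y t)))
    (fun t b y z hz => if_neg hz) h.law'
    (fun t b y => potential K e p (G.run m price samp b y t) (G.noise m price samp b y t)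
      (t - G.windowStart m price samp b y t))
    (fun t b y => potential K e p (G.run m price samp b y t) (G.noiseMid m price samp b y t)
      ((t : ℝ) + 1 - G.windowStart m price samp b y t))
    (fun _ _ _ => potential_nonneg K e hp _ _ _) (fun _ _ _ => potential_nonneg K e hp _ _ _)
    ?_ ?_ ?_ (fun t b y => potential_run_succ_le K e hp t) ?_
  · intro t b b' y y' hb hy
    have hn : G.noise m price samp b y t = G.noise m price samp b' y' t := by
      ext s a
      rw [noise, noise, windowStart_congr hb hy]
      refine Finset.sum_congr rfl fun r hr => ?_
      have hr' := (Finset.mem_Ico.mp hr).2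
      rw [iterTrueRegret, iterRegret, iterTrueRegret, iterRegret, hy r hr',
        run_congr (fun r' h' => hb r' (h'.trans hr'.le)) (fun r' h' => hy r' (h'.trans hr'))]
    simp only [run_congr hb hy, windowStart_congr hb hy, hn]
  · intro t b b' y y' hb hy
    have hy' : ∀ r < t, y r = y' r := fun r hr => hy r hr.le
    have hn : G.noiseMid m price samp b y t = G.noiseMid m price samp b' y' t := by
      ext s a
      rw [noiseMid, noiseMid, windowStart_congr hb hy']
      refine Finset.sum_congr rfl fun r hr => ?_
      have hr' := Nat.le_of_lt_succ (Finset.mem_Ico.mp hr).2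
      rw [iterTrueRegret, iterRegret, iterTrueRegret, iterRegret, hy r hr',
        run_congr (fun r' h' => hb r' (h'.trans hr')) (fun r' h' => hy' r' (h'.trans_le hr'))]
    simp only [run_congr hb hy', windowStart_congr hb hy', hn]
  · intro t b y h0
    have hexp : G.Explores q₀ (G.run m price samp b y t) (samp (G.run m price samp b y t)) := by
      by_contra hcon
      refine h0 ?_
      rw [measureReal_eq_zero_iff]
      refine measure_mono_null (fun ω hω => ?_) h.explores
      intro hall
      have h1 := hall t
      rw [run_congr hω.1 hω.2] at h1
      exact hcon h1
    refine sum_sampleProb_mul_potential_le hq hΔ0 hΔ hK hp t hexp ?_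
    exact sum_law_eq_one μ h.measurable_response h.measurable_sample t G.terminal
      (G.sampleProb (samp (G.run m price samp b y t))) (fun z hz => if_neg hz) (h.law' t b y) h0
  · intro b y
    have h1 : G.noise m price samp b y 0 = fun _ _ => 0 := by
      ext s a
      simp [noise]
    have h2 := potential_zero_le K e hp (G.run m price samp b y 0)
    simpa [h1, windowStart, run, init] using h2

/-- If the responses are `δ`-best responses up to a probability `η`, then with probability at
least `1 - p - η` the algorithm terminates within the given cost. -/
lemma IsExecution.le_measure_reachesWithin (h : G.IsExecution m price samp q₀ μ β ζ)
    {e δ p Δ η : ℝ} (hq : 0 < q₀) (hΔ : ∀ z ∈ G.terminal, |G.payoff z| ≤ Δ) (he : 0 < e)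
    (heΔ : e ≤ 2 * Δ) (hp : 0 < p) (hp1 : p ≤ 1) (hm : ∀ j P, 0 < m j P)
    (hη : μ.real {ω | ∃ t, (∀ r < t, ¬ G.IsNash (e + δ) (G.runMid m price samp
        (fun r => β r ω) (fun r => ζ r ω) r).average) ∧
        ¬ G.GoodResponse m price samp δ (fun r => β r ω) (fun r => ζ r ω) t} ≤ η)
    (R bound : G.State → ℝ) (hR : ∀ S, 0 ≤ R S)
    (hprice : ∀ S : G.State, (∀ j ≤ S.window, ∀ i, S.pops j i ⊆ S.pop i) →
      ∀ j ≤ S.window, (price (S.pops j) : ℝ) ≤ R S)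
    (hbound : ∀ S : G.State, (∀ j ≤ S.window, ∀ i, S.pops j i ⊆ S.pop i) → e ≤ 2 * (Δ / q₀) →
      S.numWindows * G.horizon * S.regretTime (Δ / q₀) e p +
      (∑ j ∈ Finset.range S.numWindows,
        (2 * (G.restrictedHorizon (S.pops j) * m j (S.pops j)) +
          R S * S.regretTime (Δ / q₀) e p / m j (S.pops j))) +
      4 * (S.numWindows * R S) ≤ bound S) :
    1 - p - η ≤ μ.real {ω | G.ReachesWithin m price samp (e + δ) bound
      (fun r => β r ω) (fun r => ζ r ω)} := by
  have hΔ0 : 0 < Δ := by linarith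
  set E₁ := {ω | ∃ t, 1 ≤ potential (Δ / q₀) e p
      (G.run m price samp (fun r => β r ω) (fun r => ζ r ω) t)
      (G.noiseMid m price samp (fun r => β r ω) (fun r => ζ r ω) t)
      ((t : ℝ) + 1 - G.windowStart m price samp (fun r => β r ω) (fun r => ζ r ω) t)} with hE₁
  set E₂ := {ω | ∃ t, (∀ r < t, ¬ G.IsNash (e + δ) (G.runMid m price samp
        (fun r => β r ω) (fun r => ζ r ω) r).average) ∧
        ¬ G.GoodResponse m price samp δ (fun r => β r ω) (fun r => ζ r ω) t} with hE₂
  set E₃ := {ω | ¬ G.IsRegular m price samp q₀ (fun r => β r ω) (fun r => ζ r ω)} with hE₃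
  set E := {ω | G.ReachesWithin m price samp (e + δ) bound
      (fun r => β r ω) (fun r => ζ r ω)} with hE
  -- outside `E₁`, `E₂` and the null set `E₃` the algorithm terminates within the bound
  have h1 : μ.real E₁ ≤ p :=
    ENNReal.toReal_le_of_le_ofReal hp.le (h.measure_potential_le hq hΔ0 hΔ rfl hp.le)
  have h3 : μ.real E₃ = 0 := (measureReal_eq_zero_iff).mpr h.ae_isRegular
  have hcover : Set.univ ⊆ E ∪ (E₁ ∪ (E₂ ∪ E₃)) := by
    intro ω _
    by_contra hcon
    simp only [Set.mem_union, not_or] at hcon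
    obtain ⟨hωE, hω1, hω2, hω3⟩ := hcon
    refine hωE ?_
    have hreg : G.IsRegular m price samp q₀ (fun r => β r ω) (fun r => ζ r ω) := not_not.mp hω3
    have hpot : ∀ t, potential (Δ / q₀) e p
        (G.run m price samp (fun r => β r ω) (fun r => ζ r ω) t)
        (G.noiseMid m price samp (fun r => β r ω) (fun r => ζ r ω) t)
        ((t : ℝ) + 1 - G.windowStart m price samp (fun r => β r ω) (fun r => ζ r ω) t) < 1 :=
      fun t => not_le.mp fun hle => hω1 ⟨t, hle⟩
    have hgood : ∀ t, (∀ r < t, ¬ G.IsNash (e + δ) (G.runMid m price samp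
        (fun r => β r ω) (fun r => ζ r ω) r).average) →
        G.GoodResponse m price samp δ (fun r => β r ω) (fun r => ζ r ω) t :=
      fun t ht => by_contra fun hcon => hω2 ⟨t, ht, hcon⟩
    have hconv : G.Converges m price samp (Δ / q₀) e p (fun r => β r ω) (fun r => ζ r ω) :=
      fun t hn i σ hσ hs =>
        value_sub_le_of_potential_lt_one hq hΔ0 hΔ rfl he hp hp1 hreg t (hpot t) hn hσ hs
    obtain ⟨τ, hτ, hcost⟩ := exists_isLeast_isNash hp hm hreg hconv hgood
    have hsub := fun j hj i => run_pops_subset (m := m) (price := price) (samp := samp)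
      (b := fun r => β r ω) (y := fun r => ζ r ω) τ (j := j) hj i
    have heK : e ≤ 2 * (Δ / q₀) := by
      have : Δ ≤ Δ / q₀ := by
        rw [le_div_iff₀ hq]
        exact mul_le_of_le_one_right hΔ0.le hreg.q_le_one
      linarith
    set S := G.runMid m price samp (fun r => β r ω) (fun r => ζ r ω) τ
    exact ⟨τ, hτ, (hcost (R S) (hR S) (hprice S hsub)).trans (hbound S hsub heK)⟩
  have h4 : (1 : ℝ) ≤ μ.real E + (μ.real E₁ + (μ.real E₂ + μ.real E₃)) := by
    calc (1 : ℝ) = μ.real Set.univ := by simp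
      _ ≤ μ.real (E ∪ (E₁ ∪ (E₂ ∪ E₃))) := measureReal_mono hcover
      _ ≤ _ := (measureReal_union_le _ _).trans (add_le_add le_rfl
        ((measureReal_union_le _ _).trans (add_le_add le_rfl (measureReal_union_le _ _))))
  linarith

end Execution

end EFG

end

end SRMDO

theorem mainTheorem5 :
    ∃ C : ℝ, 0 < C ∧ ∃ d : ℕ,
      ∀ (A : Type u) (I : Type v) [Fintype A] [DecidableEq A] [Fintype I] [DecidableEq I]
        (G : SRMDO.EFG A I)
        (Δ ε p q₀ : ℝ) (_ : ∀ z ∈ G.terminal, |G.payoff z| ≤ Δ)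
        (_ : 0 < ε) (_ : ε ≤ 2 * Δ) (_ : 0 < p) (_ : p ≤ 1) (_ : 0 < q₀)
        (m : ℕ → G.Population → ℕ) (_ : ∀ j P, 0 < m j P)
        (samp : G.State → I → A → ℝ)
        (Ω : Type w) [MeasurableSpace Ω] (μ : MeasureTheory.Measure Ω)
        [MeasureTheory.IsProbabilityMeasure μ]
        (β : ℕ → Ω → G.Response) (ζ : ℕ → Ω → List A),
        -- oracle best responses, charged with the size of the current restricted game
        (G.IsExecution m (fun P => G.restrictedSize P) samp q₀ μ β ζ →
          (∀ᵐ ω ∂μ, ∀ t, G.GoodResponse m (fun P => G.restrictedSize P) samp 0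
            (fun r => β r ω) (fun r => ζ r ω) t) →
          1 - p ≤ μ.real {ω | G.ReachesWithin m (fun P => G.restrictedSize P) samp ε
            (fun S => C * S.logFactor p ^ d * S.oracleBound m ((Δ / q₀) ^ 2) ε)
            (fun r => β r ω) (fun r => ζ r ω)}) ∧
        -- approximate best responses, charged with the horizon for each player
        (∀ δ η : ℝ, 0 ≤ δ → δ < ε →
          G.IsExecution m (fun _ => 2 * G.horizon) samp q₀ μ β ζ →
          μ.real {ω | ∃ t,
            (∀ r < t, ¬ G.IsNash ε (G.runMid m (fun _ => 2 * G.horizon) samp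
              (fun r => β r ω) (fun r => ζ r ω) r).average) ∧
            ¬ G.GoodResponse m (fun _ => 2 * G.horizon) samp δ
              (fun r => β r ω) (fun r => ζ r ω) t} ≤ η →
          1 - p - η ≤ μ.real {ω | G.ReachesWithin m (fun _ => 2 * G.horizon) samp ε
            (fun S => C * S.logFactor p ^ d * S.approxBound m ((Δ / q₀) ^ 2) (ε - δ))
            (fun r => β r ω) (fun r => ζ r ω)}) := by
  refine ⟨1000, by norm_num, 1, ?_⟩
  intro A I _ _ _ _ G Δ ε p q₀ hΔ hε hεΔ hp hp1 hq m hm samp Ω _ μ _ β ζ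
  refine ⟨fun hex hgood => ?_, fun δ η hδ hδε hex hη => ?_⟩
  · have hη : μ.real {ω | ∃ t,
        (∀ r < t, ¬ G.IsNash (ε + 0) (G.runMid m (fun P => G.restrictedSize P) samp
          (fun r => β r ω) (fun r => ζ r ω) r).average) ∧
        ¬ G.GoodResponse m (fun P => G.restrictedSize P) samp 0
          (fun r => β r ω) (fun r => ζ r ω) t} ≤ 0 := by
      refine le_of_eq ((MeasureTheory.measureReal_eq_zero_iff).mpr ?_)
      refine MeasureTheory.measure_mono_null (fun ω hω => ?_) hgood
      obtain ⟨t, -, ht⟩ := hω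
      exact fun hall => ht (hall t)
    have key := hex.le_measure_reachesWithin hq hΔ hε hεΔ hp hp1 hm hη
      (fun S => S.finalSize) (fun S => 1000 * S.logFactor p ^ 1 * S.oracleBound m ((Δ / q₀) ^ 2) ε)
      (fun S => Nat.cast_nonneg _)
      (fun S hS j hj => Nat.cast_le.mpr (SRMDO.EFG.restrictedSize_mono (hS j hj)))
      (fun S _ heK => SRMDO.EFG.oracle_cost_le hp hε heK S m)
    rwa [add_zero, sub_zero] at key
  · have hε' : ε - δ + δ = ε := sub_add_cancel ε δ
    have key := hex.le_measure_reachesWithin (e := ε - δ) (δ := δ) (η := η) hq hΔ (sub_pos.mpr hδε)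
      (by linarith) hp hp1 hm (by rw [hε']; exact hη)
      (fun _ => 2 * (G.horizon : ℝ))
      (fun S => 1000 * S.logFactor p ^ 1 * S.approxBound m ((Δ / q₀) ^ 2) (ε - δ))
      (fun _ => by positivity) (fun _ _ _ _ => by simp)
      (fun S hS heK => SRMDO.EFG.approx_cost_le hp (sub_pos.mpr hδε) heK S hS hm)
    rwa [hε'] at key
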